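/- Let $0<\alpha<\gamma\le 2$ and $0\le\beta\le 1$. Let $\nu_\beta$ be the measure on $[0,\infty)$ given by $\nu_\beta(dx)=(1-\beta)x^{-\beta}\,dx$ if $0\le\beta<1$ and $\nu_1=\delta_0$. On a probability space $(\Omega',\mathcal F',\mathbf P')$ let $(S_\gamma(t))_{t\ge0}$ be a symmetric $\gamma$-stable (S$\gamma$S) Lévy motion, i.e. a Lévy process with $\mathbf E' e^{iuS_\gamma(t)}=e^{-t\sigma^\gamma|u|^\gamma}$ for some $\sigma>0$, and let $(M_\beta(t))_{t\ge0}$ be a $\beta$-Mittag-Leffler process independent of $S_\gamma$. For $0<\beta<1$ this means $M_\beta(t)=\inf\{u\ge0: S_\beta(u)\ge t\}$, where $S_\beta$ is a $\beta$-stable subordinator (a Lévy process with nondecreasing paths and $\mathbf E' e^{-\theta S_\beta(t)}=e^{-t\theta^\beta}$ for $\theta\ge0$); for $\beta=0$ it means $M_0(0)=0$ and $M_0(t)=E$ for $t>0$, with $E$ a standard exponential random variable; and $M_1(t)=t$. Let $Z_{\alpha,\beta}$ be a symmetric $\alpha$-stable (S$\alpha$S) random measure on $\Omega'\times[0,\infty)$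 with control measure $m=\mathbf P'\times\nu_\beta$, defined on a probability space $(\Omega,\mathcal F,\mathbf P)$: it is independently scattered, almost surely $\sigma$-additive, and $\mathbf E e^{iuZ_{\alpha,\beta}(A)}=e^{-m(A)|u|^\alpha}$ for all measurable $A$ with $m(A)<\infty$. For $g\in L^\alpha(m)$ the integral $\int g\,dZ_{\alpha,\beta}$ is the limit in probability of the integrals of simple functions converging to $g$ in $L^\alpha(m)$. Then the process $$Y_{\alpha,\beta,\gamma}(t)=\int_{\Omega'\times[0,\infty)} S_\gamma\bigl(M_\beta((t-x)_+,\omega'),\omega'\bigr)\,dZ_{\alpha,\beta}(\omega',x),\qquad t\ge0,$$ is well defined: for every $t\ge 0$ the integrand is in $L^\alpha(m)$, and the integral exists and is unique up to almost sure equality. Moreover $Y_{\alpha,\beta,\gamma}$ is an S$\alpha$S process (all its finite-dimensional laws are symmetric $\alpha$-stable); it is $H$-self-similar with $$H=\frac{\beta}{\gamma}+\frac{1-\beta}{\alpha},$$ i.e. for every $c>0$ the processes $(Y_{\alpha,\beta,\gamma}(ct))_{t\ge0}$ and $(c^HY_{\alpha,\beta,\gamma}(t))_{t\ge0}$ have the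 same finite-dimensional laws; and it has stationary increments, i.e. for every $s\ge0$ the processes $(Y_{\alpha,\beta,\gamma}(t+s)-Y_{\alpha,\beta,\gamma}(s))_{t\ge0}$ and $(Y_{\alpha,\beta,\gamma}(t)-Y_{\alpha,\beta,\gamma}(0))_{t\ge0}$ have the same finite-dimensional laws. -/

import Mathlib

open MeasureTheory ProbabilityTheory Filter
open scoped NNReal ENNReal Topology

noncomputable section

namespace StableProcess

section Processes

variable {Ω : Type*} [MeasurableSpace Ω]

/-- A real Lévy process indexed by `[0, ∞)`: it starts at zero, has independent and stationary
increments, and almost all of its paths are right-continuous with left limits. -/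
structure IsLevyProcess (X : ℝ≥0 → Ω → ℝ) (P : Measure Ω) : Prop where
  measurable : ∀ t, Measurable (X t)
  zero : ∀ᵐ ω ∂P, X 0 ω = 0
  indep : HasIndepIncrements X P
  stationary : ∀ s t, IdentDistrib (fun ω => X (s + t) ω - X s ω) (X t) P P
  cadlag : ∀ᵐ ω ∂P, ∀ t, ContinuousWithinAt (fun s => X s ω) (Set.Ici t) t ∧
    ∃ l : ℝ, Tendsto (fun s => X s ω) (𝓝[<] t) (𝓝 l)

/-- A symmetric `γ`-stable Lévy motion, with an arbitrary scale `σ > 0`: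
`E exp(i u S(t)) = exp(-t σ^γ |u|^γ)`. -/
structure IsSymmStableLevyMotion (γ : ℝ) (S : ℝ≥0 → Ω → ℝ) (P : Measure Ω) : Prop where
  levy : IsLevyProcess S P
  charFun_eq : ∃ σ : ℝ, 0 < σ ∧ ∀ (t : ℝ≥0) (u : ℝ),
    charFun (P.map (S t)) u = ((Real.exp (-((t : ℝ) * σ ^ γ * |u| ^ γ)) : ℝ) : ℂ)

/-- The (standard) `β`-stable subordinator: a Lévy process with nondecreasing paths and
`E exp(-θ S(t)) = exp(-t θ^β)` for `θ ≥ 0`. -/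
structure IsStableSubordinator (β : ℝ) (S : ℝ≥0 → Ω → ℝ) (P : Measure Ω) : Prop where
  levy : IsLevyProcess S P
  monotone : ∀ᵐ ω ∂P, Monotone (fun t => S t ω)
  laplace : ∀ (t : ℝ≥0) (θ : ℝ), 0 ≤ θ →
    ∫ ω, Real.exp (-(θ * S t ω)) ∂P = Real.exp (-((t : ℝ) * θ ^ β))

/-- The `β`-Mittag-Leffler process, `0 ≤ β ≤ 1`. For `0 < β < 1` it is the inverse
`M(t) = inf {u ≥ 0 : S(u) ≥ t}` of a `β`-stable subordinator `S`; for `β = 0` it is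
`M(0) = 0`, `M(t) = E` for `t > 0`, with `E` standard exponential; for `β = 1` it is `M(t) = t`. -/
structure IsMittagLefflerProcess (β : ℝ) (M : ℝ≥0 → Ω → ℝ≥0) (P : Measure Ω) : Prop where
  measurable : ∀ t, Measurable (M t)
  eq_zero_case : β = 0 → ∃ E : Ω → ℝ≥0, Measurable E ∧
    HasLaw (fun ω => (E ω : ℝ)) (expMeasure 1) P ∧
    ∀ᵐ ω ∂P, M 0 ω = 0 ∧ ∀ t, 0 < t → M t ω = E ω
  eq_one_case : β = 1 → ∀ᵐ ω ∂P, ∀ t, M t ω = t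
  inverse_case : 0 < β → β < 1 → ∃ S : ℝ≥0 → Ω → ℝ, IsStableSubordinator β S P ∧
    ∀ᵐ ω ∂P, ∀ t : ℝ≥0, M t ω = sInf {u : ℝ≥0 | (t : ℝ) ≤ S u ω}

/-- A probability law `μ` on `ℝ^ι` is symmetric `α`-stable: it is symmetric, and if `X₁`, `X₂` are
independent with law `μ` then `a X₁ + b X₂` has the law of `(a^α + b^α)^(1/α) X₁`,
for all `a, b > 0`. -/
structure IsSymmStableLaw {ι : Type*} (α : ℝ) (μ : Measure (ι → ℝ)) : Prop where
  isProbabilityMeasure : IsProbabilityMeasure μ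
  symm : μ.map (fun x => -x) = μ
  stable : ∀ a b : ℝ, 0 < a → 0 < b →
    Measure.conv (μ.map (fun x => a • x)) (μ.map (fun x => b • x)) =
      μ.map (fun x => ((a ^ α + b ^ α) ^ (1 / α)) • x)

/-- A symmetric `α`-stable process: all finite-dimensional laws are symmetric `α`-stable. -/
structure IsSymmStableProcess (α : ℝ) (Y : ℝ≥0 → Ω → ℝ) (P : Measure Ω) : Prop where
  measurable : ∀ t, Measurable (Y t)
  stable : ∀ I : Finset ℝ≥0, IsSymmStableLaw α (P.map (fun ω (t : I) => Y t ω))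

/-- `H`-self-similarity: `(Y(ct))` and `(c^H Y(t))` have the same finite-dimensional laws,
for every `c > 0`. -/
def IsSelfSimilar (H : ℝ) (Y : ℝ≥0 → Ω → ℝ) (P : Measure Ω) : Prop :=
  ∀ c : ℝ≥0, 0 < c → ∀ I : Finset ℝ≥0,
    IdentDistrib (fun ω (t : I) => Y (c * t) ω) (fun ω (t : I) => (c : ℝ) ^ H * Y t ω) P P

/-- Stationary increments: `(Y(t + s) - Y(s))` and `(Y(t) - Y(0))` have the same
finite-dimensional laws, for every `s ≥ 0`. -/
def HasStationaryIncrements (Y : ℝ≥0 → Ω → ℝ) (P : Measure Ω) : Prop :=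
  ∀ s : ℝ≥0, ∀ I : Finset ℝ≥0,
    IdentDistrib (fun ω (t : I) => Y (t + s) ω - Y s ω) (fun ω (t : I) => Y t ω - Y 0 ω) P P

end Processes

section RandomMeasure

variable {E Ω : Type*} [MeasurableSpace E] [MeasurableSpace Ω]

/-- A symmetric `α`-stable random measure `Z` on `E` with control measure `m` (in the `α`-stable
normalization `E exp(i u Z(A)) = exp(-m(A) |u|^α)`). Only the values of `Z` on measurable sets of
finite `m`-measure matter. The series in `sigma_additive` converges almost surely, in general only
conditionally. -/
structure IsSymmStableRandomMeasure (α : ℝ) (m : Measure E) (Z : Set E → Ω → ℝ)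
    (P : Measure Ω) : Prop where
  measurable : ∀ A, MeasurableSet A → m A < ∞ → Measurable (Z A)
  charFun_eq : ∀ A, MeasurableSet A → m A < ∞ → ∀ u : ℝ,
    charFun (P.map (Z A)) u = ((Real.exp (-((m A).toReal * |u| ^ α)) : ℝ) : ℂ)
  indep_scattered : ∀ (n : ℕ) (A : Fin n → Set E), (∀ i, MeasurableSet (A i)) →
    (∀ i, m (A i) < ∞) → Pairwise (fun i j => Disjoint (A i) (A j)) →
    iIndepFun (fun i => Z (A i)) P
  sigma_additive : ∀ A : ℕ → Set E, (∀ i, MeasurableSet (A i)) →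
    m (⋃ i, A i) < ∞ → Pairwise (fun i j => Disjoint (A i) (A j)) →
    ∀ᵐ ω ∂P, Tendsto (fun n => ∑ i ∈ Finset.range n, Z (A i) ω) atTop (𝓝 (Z (⋃ i, A i) ω))

/-- The integral `∑ c Z(f = c)` of a simple function. -/
def simpleIntegral (Z : Set E → Ω → ℝ) (f : SimpleFunc E ℝ) (ω : Ω) : ℝ :=
  ∑ c ∈ f.range, c * Z (f ⁻¹' {c}) ω

/-- The random variable `Y` is the stochastic integral `∫ g dZ`: the function `g` is in `L^α(m)`,
and `Y` is the limit in probability of the integrals of simple functions that converge to `g` in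
`L^α(m)`. -/
structure IsStableIntegral (α : ℝ) (m : Measure E) (Z : Set E → Ω → ℝ) (P : Measure Ω)
    (g : E → ℝ) (Y : Ω → ℝ) : Prop where
  memLp : MemLp g (ENNReal.ofReal α) m
  measurable : Measurable Y
  exists_approx : ∃ f : ℕ → SimpleFunc E ℝ,
    (∀ n, MemLp (f n) (ENNReal.ofReal α) m) ∧
    Tendsto (fun n => eLpNorm (fun x => f n x - g x) (ENNReal.ofReal α) m) atTop (𝓝 0) ∧
    TendstoInMeasure P (fun n => simpleIntegral Z (f n)) atTop Y

end RandomMeasure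

/-- The measure `ν_β` on `[0, ∞)`: `(1 - β) x^(-β) dx` for `β < 1`, the point mass at `0` for
`β = 1`. -/
def nu (β : ℝ) : Measure ℝ≥0 :=
  if β = 1 then Measure.dirac 0
  else (((volume : Measure ℝ).restrict (Set.Ici 0)).withDensity
    (fun x => ENNReal.ofReal ((1 - β) * x ^ (-β)))).map Real.toNNReal

/-- The integrand `(ω', x) ↦ S(M((t - x)₊, ω'), ω')`; subtraction in `ℝ≥0` is truncated at zero,
so `t - x` is the positive part. -/
def kernel {Ω' : Type*} (S : ℝ≥0 → Ω' → ℝ) (M : ℝ≥0 → Ω' → ℝ≥0) (t : ℝ≥0) (p : Ω' × ℝ≥0) : ℝ :=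
  S (M (t - p.2) p.1) p.1

end StableProcess

end

/-! The integral against `Z` turns laws into a deterministic quantity. The joint characteristic
function of stable integrals of `g_i` is `exp (-∫ |∑ θ_i g_i|^α dm)`. Finite-dimensional laws of `Y`
therefore depend only on these numbers (`charFunDual_isStableIntegral`,
`identDistrib_of_isStableIntegral`). Stability is immediate from the formula, and self-similarity
and stationary increments become identities between integrals of the kernel.

To compute such an integral, condition on the time change. With `Ψ(u) = E |∑ θ_i S(u_i)|^α`
(`pathMoment`), the Lévy motion enters only through three facts: `Ψ(c u) = c^(α/γ) Ψ(u)`, `Ψ(0) =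
0`, and `E |∑ θ_i (S(u_i) - S(b))|^α = Ψ(u - b)` when `b ≤ u_i`. What remains concerns `M` and
`ν_β`.

Integrability: `α < γ` gives `E |S(1)|^α < ∞`, the exponential tail of `M(t)` makes `E M(t)^(α/γ)`
finite, and `ν_β [0, t] < ∞`.

Self-similarity: `ν_β` scales with exponent `1 - β` and `M(ct)` has the law of `c^β M(t)`, so the
integral scales with exponent `1 - β + β α/γ = α H`.

Stationary increments: the increments of `x`-delayed `M` after time `s` must have the same law as
`x`-delayed `M`, when `x` has the infinite law `ν_β` (`IsMittagLefflerVersion.shift`). For `0 < β <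
1`, the strong Markov property of the subordinator at its first passage over `s - x` says that `M`
starts afresh after a residual time, the overshoot over `s - x`, or `x - s` if `x ≥ s`
(`IsStableSubordinator.lintegral_pathInv_add`). So it suffices that `ν_β` is invariant for the
residual time (`IsStableSubordinator.map_residual`). This is a Laplace transform computation: the
double transform of the overshoot is `(q^β - l^β) / ((q - l) q^β)`, that of `ν_β` is a multiple of
`l^(β - 1)`, and together they give a transform in `s` proportional to `1/q`, that is, a function
constant in `s`. The strong Markov property and the overshoot formula are both obtained on the grids
`ℕ / (n + 1)`, where only independent increments are needed, and then by a limit using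
right-continuity. The cases `β = 0` and `β = 1` are direct. -/

noncomputable section

namespace StableProcess

/-! ### Tails from characteristic functions -/

section TailBound

/-- Tail bound for a law on `ℝ` whose characteristic function is `exp (-K |t| ^ α)`. -/
lemma measureReal_abs_gt_le_of_charFun {μ : Measure ℝ} [IsProbabilityMeasure μ] {K α : ℝ}
    (hK : 0 ≤ K) (hα : 0 < α)
    (h : ∀ t, charFun μ t = ((Real.exp (-(K * |t| ^ α)) : ℝ) : ℂ)) {r : ℝ} (hr : 0 < r) :
    μ.real {x | r < |x|} ≤ 2 * K * (2 / r) ^ α := by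
  refine (measureReal_abs_gt_le_integral_charFun hr).trans ?_
  have hr' : 0 ≤ 2 * r⁻¹ := by positivity
  have hbd : ‖∫ t in (-2 * r⁻¹)..(2 * r⁻¹), 1 - charFun μ t‖
      ≤ (K * (2 / r) ^ α) * |2 * r⁻¹ - (-2 * r⁻¹)| := by
    refine intervalIntegral.norm_integral_le_of_norm_le_const fun t ht => ?_
    have ht' : |t| ≤ 2 / r := by
      rw [Set.uIoc_of_le (by linarith)] at ht
      rw [abs_le, div_eq_mul_inv]
      exact ⟨by linarith [ht.1], ht.2⟩
    have hle : |t| ^ α ≤ (2 / r) ^ α := Real.rpow_le_rpow (abs_nonneg _) ht' hα.le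
    have hnn : 0 ≤ K * |t| ^ α := by positivity
    rw [h t, ← Complex.ofReal_one, ← Complex.ofReal_sub, Complex.norm_real, Real.norm_eq_abs,
      abs_of_nonneg (by simpa using hnn)]
    have := Real.add_one_le_exp (-(K * |t| ^ α))
    nlinarith [mul_le_mul_of_nonneg_left hle hK]
  calc 2⁻¹ * r * ‖∫ t in (-2 * r⁻¹)..(2 * r⁻¹), 1 - charFun μ t‖
      ≤ 2⁻¹ * r * ((K * (2 / r) ^ α) * |2 * r⁻¹ - (-2 * r⁻¹)|) := by gcongr
    _ = 2 * K * (2 / r) ^ α := by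
      rw [abs_of_nonneg (by linarith)]
      field_simp
      ring

end TailBound

/-! ### Integrals of simple functions: additivity and characteristic function -/

section SimpleIntegral

variable {E Ω : Type*} [MeasurableSpace E] [MeasurableSpace Ω] {α : ℝ} {m : Measure E}
  {Z : Set E → Ω → ℝ} {P : Measure Ω}

/-- For the constant sequence `∅` the partial sums are `n Z(∅)`; they converge, so their constant
difference `Z(∅)` must be `0`. -/
lemma IsSymmStableRandomMeasure.ae_empty (hZ : IsSymmStableRandomMeasure α m Z P) :
    ∀ᵐ ω ∂P, Z ∅ ω = 0 := by
  have h := hZ.sigma_additive (fun _ => ∅) (by simp) (by simp) (by simp [Pairwise])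
  filter_upwards [h] with ω hω
  simp only [Finset.sum_const, Finset.card_range, Set.iUnion_empty, nsmul_eq_mul] at hω
  have h2 := ((tendsto_add_atTop_iff_nat 1).2 hω).sub hω
  simp only [Nat.cast_add, Nat.cast_one, sub_self, add_mul, one_mul, add_sub_cancel_left] at h2
  exact tendsto_nhds_unique tendsto_const_nhds h2

lemma IsSymmStableRandomMeasure.ae_union (hZ : IsSymmStableRandomMeasure α m Z P) {A B : Set E}
    (hA : MeasurableSet A) (hB : MeasurableSet B) (hmA : m A < ∞) (hmB : m B < ∞)
    (hAB : Disjoint A B) : ∀ᵐ ω ∂P, Z (A ∪ B) ω = Z A ω + Z B ω := by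
  let C : ℕ → Set E := fun n => if n = 0 then A else if n = 1 then B else ∅
  have hC : ⋃ i, C i = A ∪ B := by
    ext x
    simp only [Set.mem_iUnion, Set.mem_union]
    constructor
    · rintro ⟨i, hi⟩
      by_cases h0 : i = 0
      · subst h0; exact Or.inl (by simpa [C] using hi)
      · by_cases h1 : i = 1
        · subst h1; exact Or.inr (by simpa [C] using hi)
        · simp [C, h0, h1] at hi
    · rintro (h | h)
      · exact ⟨0, by simpa [C] using h⟩
      · exact ⟨1, by simpa [C] using h⟩
  have h := hZ.sigma_additive C (fun i => by simp only [C]; split_ifs <;> simp [hA, hB])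
    (by rw [hC]; exact (measure_union_le _ _).trans_lt (ENNReal.add_lt_top.2 ⟨hmA, hmB⟩))
    (fun i j hij => by
      simp only [C]
      split_ifs with h1 h2 h3 h4 h5 <;> simp_all [hAB.symm])
  filter_upwards [h, hZ.ae_empty] with ω hω h0
  rw [hC] at hω
  have : ∀ n, ∑ i ∈ Finset.range (n + 2), Z (C i) ω = Z A ω + Z B ω := by
    intro n
    induction n with
    | zero => simp [Finset.sum_range_succ, C]
    | succ n ih => rw [Finset.sum_range_succ, ih]; simp [C, h0]
  have h2 := (tendsto_add_atTop_iff_nat 2).2 hω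
  simp only [this] at h2
  exact (tendsto_nhds_unique tendsto_const_nhds h2).symm

lemma IsSymmStableRandomMeasure.ae_biUnion_finset (hZ : IsSymmStableRandomMeasure α m Z P)
    {ι : Type*} [DecidableEq ι] (s : Finset ι) (A : ι → Set E) (hA : ∀ i ∈ s, MeasurableSet (A i))
    (hm : ∀ i ∈ s, m (A i) < ∞) (hd : Pairwise fun i j => Disjoint (A i) (A j)) :
    ∀ᵐ ω ∂P, Z (⋃ i ∈ s, A i) ω = ∑ i ∈ s, Z (A i) ω := by
  induction s using Finset.induction_on with
  | empty => simpa using hZ.ae_empty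
  | insert a s ha ih =>
    have hA' : ∀ i ∈ s, MeasurableSet (A i) := fun i hi => hA i (Finset.mem_insert_of_mem hi)
    have hm' : ∀ i ∈ s, m (A i) < ∞ := fun i hi => hm i (Finset.mem_insert_of_mem hi)
    have hu := hZ.ae_union (hA a (Finset.mem_insert_self _ _)) (Finset.measurableSet_biUnion s hA')
      (hm a (Finset.mem_insert_self _ _))
      (measure_biUnion_lt_top s.finite_toSet hm')
      (by
        rw [Set.disjoint_iUnion₂_right]
        exact fun i hi => hd (fun h => ha (h ▸ hi)))
    filter_upwards [ih hA' hm', hu] with ω h1 h2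
    rw [Finset.set_biUnion_insert, h2, h1, Finset.sum_insert ha]

/-- Finite additivity over the fibres of `φ`. Pieces where `φ` vanishes may have infinite measure,
where `Z` carries no information; the zero coefficient removes them. Applied to `f.pair g` it gives
additivity of the integral. -/
lemma IsSymmStableRandomMeasure.ae_simpleIntegral_map (hZ : IsSymmStableRandomMeasure α m Z P)
    {F : Type*} (f : SimpleFunc E F) (φ : F → ℝ)
    (hφ : ∀ x, φ x ≠ 0 → m (f ⁻¹' {x}) < ∞) :
    ∀ᵐ ω ∂P, simpleIntegral Z (f.map φ) ω = ∑ x ∈ f.range, φ x * Z (f ⁻¹' {x}) ω := by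
  classical
  have h : ∀ c : (f.map φ).range, ∀ᵐ ω ∂P, (c : ℝ) ≠ 0 → Z ((f.map φ) ⁻¹' {(c : ℝ)}) ω
      = ∑ x ∈ f.range with φ x = c, Z (f ⁻¹' {x}) ω := by
    rintro ⟨c, hc⟩
    by_cases h0 : c = 0
    · simp [h0]
    have hb := hZ.ae_biUnion_finset {x ∈ f.range | φ x = c} (fun x => f ⁻¹' {x})
      (fun x _ => f.measurableSet_preimage _)
      (fun x hx => hφ x (by rw [(Finset.mem_filter.1 hx).2]; exact h0))
      (fun x y hxy => Disjoint.preimage _ (by simpa using hxy))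
    have hs : (f.map φ) ⁻¹' {c} = ⋃ x ∈ ({x ∈ f.range | φ x = c} : Finset F), f ⁻¹' {x} := by
      ext y
      simp
    filter_upwards [hb] with ω hω _
    simp only [hs]
    exact hω
  filter_upwards [ae_all_iff.2 h] with ω hω
  rw [simpleIntegral, SimpleFunc.range_map]
  rw [← Finset.sum_fiberwise_of_maps_to (s := f.range) (t := f.range.image φ) (g := φ)
    (fun x hx => Finset.mem_image_of_mem _ hx)]
  refine Finset.sum_congr rfl fun c hc => ?_
  by_cases h0 : c = 0
  · subst h0
    rw [zero_mul, Finset.sum_eq_zero]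
    intro x hx
    rw [(Finset.mem_filter.1 hx).2, zero_mul]
  · rw [hω ⟨c, by rw [SimpleFunc.range_map]; exact hc⟩ h0, Finset.mul_sum]
    refine Finset.sum_congr rfl fun x hx => ?_
    rw [(Finset.mem_filter.1 hx).2]

lemma measure_preimage_lt_top (hα : 0 < α) {f : SimpleFunc E ℝ}
    (hf : MemLp f (ENNReal.ofReal α) m) {c : ℝ} (hc : c ≠ 0) : m (f ⁻¹' {c}) < ∞ :=
  (SimpleFunc.memLp_iff (by simpa using hα) ENNReal.ofReal_ne_top).1 hf c hc

lemma IsSymmStableRandomMeasure.ae_simpleIntegral_add (hZ : IsSymmStableRandomMeasure α m Z P)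
    (hα : 0 < α) {f g : SimpleFunc E ℝ} (hf : MemLp f (ENNReal.ofReal α) m)
    (hg : MemLp g (ENNReal.ofReal α) m) :
    ∀ᵐ ω ∂P, simpleIntegral Z (f + g) ω = simpleIntegral Z f ω + simpleIntegral Z g ω := by
  have hfin : ∀ x : ℝ × ℝ, (x.1 ≠ 0 ∨ x.2 ≠ 0) → m ((f.pair g) ⁻¹' {x}) < ∞ := by
    rintro ⟨a, b⟩ h
    rw [SimpleFunc.pair_preimage_singleton]
    rcases h with h | h
    · exact (measure_mono Set.inter_subset_left).trans_lt (measure_preimage_lt_top hα hf h)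
    · exact (measure_mono Set.inter_subset_right).trans_lt (measure_preimage_lt_top hα hg h)
  have h1 := hZ.ae_simpleIntegral_map (f.pair g) Prod.fst (fun x hx => hfin x (Or.inl hx))
  have h2 := hZ.ae_simpleIntegral_map (f.pair g) Prod.snd (fun x hx => hfin x (Or.inr hx))
  have h3 := hZ.ae_simpleIntegral_map (f.pair g) (fun x => x.1 + x.2) (fun x hx => hfin x (by
    by_contra h
    push Not at h
    simp [h.1, h.2] at hx))
  have e1 : (f.pair g).map Prod.fst = f := by ext; simp
  have e2 : (f.pair g).map Prod.snd = g := by ext; simp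
  have e3 : (f.pair g).map (fun x => x.1 + x.2) = f + g := by ext; simp
  rw [e1] at h1
  rw [e2] at h2
  rw [e3] at h3
  filter_upwards [h1, h2, h3] with ω h1 h2 h3
  rw [h1, h2, h3, ← Finset.sum_add_distrib]
  exact Finset.sum_congr rfl fun x _ => by ring

lemma IsSymmStableRandomMeasure.ae_simpleIntegral_const_mul
    (hZ : IsSymmStableRandomMeasure α m Z P) (hα : 0 < α) (c : ℝ) {f : SimpleFunc E ℝ}
    (hf : MemLp f (ENNReal.ofReal α) m) :
    ∀ᵐ ω ∂P, simpleIntegral Z (f.map (fun x => c * x)) ω = c * simpleIntegral Z f ω := by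
  have h := hZ.ae_simpleIntegral_map f (fun x => c * x)
    (fun x hx => measure_preimage_lt_top hα hf (right_ne_zero_of_mul hx))
  filter_upwards [h] with ω hω
  rw [hω, simpleIntegral, Finset.mul_sum]
  exact Finset.sum_congr rfl fun x _ => by ring

lemma IsSymmStableRandomMeasure.measurable_simpleIntegral
    (hZ : IsSymmStableRandomMeasure α m Z P) (hα : 0 < α) {f : SimpleFunc E ℝ}
    (hf : MemLp f (ENNReal.ofReal α) m) : Measurable (simpleIntegral Z f) := by
  refine Finset.measurable_sum _ fun c _ => ?_
  by_cases hc : c = 0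
  · simp [hc]
  · exact (hZ.measurable _ (f.measurableSet_preimage _)
      (measure_preimage_lt_top hα hf hc)).const_mul c

lemma IsSymmStableRandomMeasure.charFun_simpleIntegral [IsProbabilityMeasure P]
    (hZ : IsSymmStableRandomMeasure α m Z P) (hα : 0 < α) {f : SimpleFunc E ℝ}
    (hf : MemLp f (ENNReal.ofReal α) m) (u : ℝ) :
    charFun (P.map (simpleIntegral Z f)) u
      = ((Real.exp (-((∫⁻ x, ‖f x‖ₑ ^ α ∂m).toReal * |u| ^ α)) : ℝ) : ℂ) := by
  classical
  -- The level set of `0` is dropped because it may have infinite measure; the remaining ones are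
  -- disjoint of finite measure, hence give independent variables.
  set s := f.range.erase 0 with hs
  have hne : ∀ c ∈ s, c ≠ 0 := fun c hc => Finset.ne_of_mem_erase hc
  have hfin : ∀ c ∈ s, m (f ⁻¹' {c}) < ∞ := fun c hc => measure_preimage_lt_top hα hf (hne c hc)
  have hsum : simpleIntegral Z f = fun ω => ∑ c ∈ s, c * Z (f ⁻¹' {c}) ω := by
    ext ω
    rw [simpleIntegral, hs]
    by_cases h0 : (0 : ℝ) ∈ f.range
    · rw [← Finset.add_sum_erase _ _ h0]; simp
    · rw [Finset.erase_eq_of_notMem h0]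
  have hint : ∫⁻ x, ‖f x‖ₑ ^ α ∂m = ∑ c ∈ s, ‖c‖ₑ ^ α * m (f ⁻¹' {c}) := by
    have : (fun x => ‖f x‖ₑ ^ α) = f.map (fun c : ℝ => ‖c‖ₑ ^ α) := by ext; simp
    rw [this, SimpleFunc.lintegral_eq_lintegral, SimpleFunc.map_lintegral, hs]
    by_cases h0 : (0 : ℝ) ∈ f.range
    · rw [← Finset.add_sum_erase _ _ h0]; simp [hα]
    · rw [Finset.erase_eq_of_notMem h0]
  have hind : iIndepFun (s.restrict fun c => Z (f ⁻¹' {c})) P := by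
    let e := s.equivFin
    have h := hZ.indep_scattered s.card (fun i => f ⁻¹' {((e.symm i : s) : ℝ)})
      (fun i => f.measurableSet_preimage _) (fun i => hfin _ (e.symm i).2)
      (fun i j hij => Disjoint.preimage _ (Set.disjoint_singleton.2
        fun h => hij (e.symm.injective (Subtype.ext h))))
    have h2 := h.precomp e.injective
    simpa [Function.comp_def, Finset.restrict_def] using h2
  have hind' : iIndepFun (s.restrict fun c ω => c * Z (f ⁻¹' {c}) ω) P :=
    hind.comp (fun c x => (c : ℝ) * x) (fun c => measurable_const_mul _)
  have hmeas : ∀ c ∈ s, Measurable (Z (f ⁻¹' {c})) := fun c hc =>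
    hZ.measurable _ (f.measurableSet_preimage _) (hfin c hc)
  rw [hsum, hind'.charFun_map_fun_finsetSum_eq_prod
    (fun c hc => ((hmeas c hc).const_mul c).aemeasurable), Finset.prod_apply]
  have hterm : ∀ c ∈ s, charFun (P.map fun ω => c * Z (f ⁻¹' {c}) ω) u
      = ((Real.exp (-((‖c‖ₑ ^ α * m (f ⁻¹' {c})).toReal * |u| ^ α)) : ℝ) : ℂ) := by
    intro c hc
    rw [charFun_map_mul_comp (hmeas c hc).aemeasurable,
      hZ.charFun_eq _ (f.measurableSet_preimage _) (hfin c hc)]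
    congr 3
    rw [abs_mul, Real.mul_rpow (abs_nonneg _) (abs_nonneg _), ENNReal.toReal_mul,
      ← ENNReal.toReal_rpow, toReal_enorm, Real.norm_eq_abs]
    ring
  rw [Finset.prod_congr rfl hterm, ← Complex.ofReal_prod, ← Real.exp_sum, hint,
    ENNReal.toReal_sum (fun c hc => ENNReal.mul_ne_top
      (ENNReal.rpow_ne_top_of_nonneg hα.le (by simp)) (hfin c hc).ne), Finset.sum_mul]
  simp [Finset.sum_neg_distrib]

end SimpleIntegral

/-! ### Completeness for convergence in probability -/

section CauchyInMeasure

/-- A sequence of random variables that is Cauchy in probability has a subsequence that converges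
almost surely. -/
lemma exists_ae_tendsto_subseq_of_cauchy {Ω : Type*} [MeasurableSpace Ω] {P : Measure Ω}
    [IsFiniteMeasure P] {X : ℕ → Ω → ℝ} (hX : ∀ n, Measurable (X n))
    (h : ∀ ε : ℝ, 0 < ε → ∀ᶠ p : ℕ × ℕ in atTop, P.real {ω | ε < |X p.1 ω - X p.2 ω|} ≤ ε) :
    ∃ (Y : Ω → ℝ) (φ : ℕ → ℕ), Measurable Y ∧ StrictMono φ ∧
      ∀ᵐ ω ∂P, Tendsto (fun n => X (φ n) ω) atTop (𝓝 (Y ω)) := by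
  have h1 : ∀ n : ℕ, ∀ᶠ k in atTop, ∀ l, k ≤ l →
      P.real {ω | (1 / 2 : ℝ) ^ n < |X l ω - X k ω|} ≤ (1 / 2 : ℝ) ^ n := by
    intro n
    obtain ⟨a, ha⟩ := eventually_atTop_prod_self.1 (h ((1 / 2 : ℝ) ^ n) (by positivity))
    filter_upwards [eventually_ge_atTop a] with k hk l hl
    exact ha l k (hk.trans hl) hk
  obtain ⟨φ, hφ, hφ'⟩ := extraction_forall_of_eventually h1
  have hsum : ∑' n, P {ω | (1 / 2 : ℝ) ^ n < |X (φ (n + 1)) ω - X (φ n) ω|} ≠ ∞ := by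
    refine ne_top_of_le_ne_top ?_ (ENNReal.tsum_le_tsum
      (g := fun n => ENNReal.ofReal ((1 / 2 : ℝ) ^ n)) fun n => ?_)
    · rw [← ENNReal.ofReal_tsum_of_nonneg (fun n => by positivity) summable_geometric_two]
      exact ENNReal.ofReal_ne_top
    · rw [← ENNReal.toReal_le_toReal (measure_ne_top _ _) ENNReal.ofReal_ne_top,
        ENNReal.toReal_ofReal (by positivity)]
      exact hφ' n _ (hφ.monotone n.le_succ)
  have hae : ∀ᵐ ω ∂P, ∃ l, Tendsto (fun n => X (φ n) ω) atTop (𝓝 l) := by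
    filter_upwards [ae_eventually_notMem hsum] with ω hω
    refine cauchySeq_tendsto_of_complete ?_
    refine cauchySeq_of_summable_dist ?_
    obtain ⟨N, hN⟩ := eventually_atTop.1 hω
    refine (summable_nat_add_iff N).1 ?_
    refine Summable.of_nonneg_of_le (fun n => dist_nonneg) (fun n => ?_)
      ((summable_nat_add_iff N).2 summable_geometric_two)
    have := hN (n + N) (by omega)
    simp only [not_lt] at this
    rw [dist_comm]
    exact this
  obtain ⟨Y, hY, hY'⟩ := measurable_limit_of_tendsto_metrizable_ae
    (fun n => (hX (φ n)).aemeasurable) hae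
  exact ⟨Y, φ, hY, hφ, hY'⟩

end CauchyInMeasure

/-! ### The functional `∫ |g|^α` and convergence in `L^α` -/

section Modular

variable {E : Type*} [MeasurableSpace E] {α : ℝ} {m : Measure E}

lemma lintegral_rpow_enorm_eq (hα : 0 < α) (g : E → ℝ) :
    ∫⁻ x, ‖g x‖ₑ ^ α ∂m = eLpNorm g (ENNReal.ofReal α) m ^ α := by
  rw [eLpNorm_eq_lintegral_rpow_enorm_toReal (by simpa using hα) ENNReal.ofReal_ne_top,
    ENNReal.toReal_ofReal hα.le, ← ENNReal.rpow_mul, one_div_mul_cancel hα.ne', ENNReal.rpow_one]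

lemma lintegral_rpow_enorm_ne_top (hα : 0 < α) {g : E → ℝ}
    (hg : MemLp g (ENNReal.ofReal α) m) : ∫⁻ x, ‖g x‖ₑ ^ α ∂m ≠ ∞ := by
  rw [lintegral_rpow_enorm_eq hα]
  exact ENNReal.rpow_ne_top_of_nonneg hα.le hg.eLpNorm_ne_top

lemma memLp_of_lintegral_rpow_enorm_ne_top (hα : 0 < α) {g : E → ℝ}
    (hg : AEStronglyMeasurable g m) (h : ∫⁻ x, ‖g x‖ₑ ^ α ∂m ≠ ∞) :
    MemLp g (ENNReal.ofReal α) m := by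
  refine ⟨hg, lt_top_iff_ne_top.2 fun h' => h ?_⟩
  rw [lintegral_rpow_enorm_eq hα, h', ENNReal.top_rpow_of_pos hα]

lemma ENNReal_tendsto_of_le_add {ι : Type*} {l : Filter ι} {a e : ι → ℝ≥0∞} {b : ℝ≥0∞}
    (hb : b ≠ ∞) (he : Tendsto e l (𝓝 0)) (h1 : ∀ i, a i ≤ b + e i) (h2 : ∀ i, b ≤ a i + e i) :
    Tendsto a l (𝓝 b) := by
  have hlo : Tendsto (fun i => b - e i) l (𝓝 b) := by
    simpa using ENNReal.Tendsto.sub tendsto_const_nhds he (Or.inl hb)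
  have hhi : Tendsto (fun i => b + e i) l (𝓝 b) := by
    simpa using tendsto_const_nhds.add he
  exact tendsto_of_tendsto_of_tendsto_of_le_of_le hlo hhi (fun i => tsub_le_iff_right.2 (h2 i)) h1

/-- For `α ≥ 1` this is the triangle inequality for the norm. For `α < 1` the norm is not
subadditive, but its `α`-th power is, by `(a + b)^α ≤ a^α + b^α`. -/
lemma tendsto_lintegral_rpow_enorm (hα : 0 < α) {f : ℕ → E → ℝ} {g : E → ℝ}
    (hf : ∀ n, MemLp (f n) (ENNReal.ofReal α) m) (hg : MemLp g (ENNReal.ofReal α) m)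
    (h : Tendsto (fun n => eLpNorm (fun x => f n x - g x) (ENNReal.ofReal α) m) atTop (𝓝 0)) :
    Tendsto (fun n => ∫⁻ x, ‖f n x‖ₑ ^ α ∂m) atTop (𝓝 (∫⁻ x, ‖g x‖ₑ ^ α ∂m)) := by
  have hc : Continuous fun x : ℝ≥0∞ => x ^ α := ENNReal.continuous_rpow_const
  rcases le_or_gt 1 α with h1 | h1
  · simp only [lintegral_rpow_enorm_eq hα]
    refine (hc.tendsto _).comp ?_
    have h1' : 1 ≤ ENNReal.ofReal α := by simpa using ENNReal.ofReal_le_ofReal h1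
    refine ENNReal_tendsto_of_le_add hg.eLpNorm_ne_top h (fun n => ?_) (fun n => ?_)
    · have : f n = g + fun x => f n x - g x := by ext; simp
      conv_lhs => rw [this]
      exact eLpNorm_add_le hg.1 ((hf n).1.sub hg.1) h1'
    · have : g = f n - fun x => f n x - g x := by ext; simp
      conv_lhs => rw [this]
      exact eLpNorm_sub_le (hf n).1 ((hf n).1.sub hg.1) h1'
  · have h0 : Tendsto (fun n => ∫⁻ x, ‖f n x - g x‖ₑ ^ α ∂m) atTop (𝓝 0) := by
      simp only [lintegral_rpow_enorm_eq (m := m) hα]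
      have := (hc.tendsto 0).comp h
      rwa [ENNReal.zero_rpow_of_pos hα] at this
    have key : ∀ (u v w : E → ℝ), AEStronglyMeasurable v m → (∀ x, ‖u x‖ₑ ≤ ‖v x‖ₑ + ‖w x‖ₑ) →
        ∫⁻ x, ‖u x‖ₑ ^ α ∂m ≤ ∫⁻ x, ‖v x‖ₑ ^ α ∂m + ∫⁻ x, ‖w x‖ₑ ^ α ∂m := by
      intro u v w hv huvw
      rw [← lintegral_add_left' (hv.enorm.pow_const α)]
      refine lintegral_mono fun x => ?_
      exact (ENNReal.rpow_le_rpow (huvw x) hα.le).trans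
        (ENNReal.rpow_add_le_add_rpow _ _ hα.le h1.le)
    refine ENNReal_tendsto_of_le_add (lintegral_rpow_enorm_ne_top hα hg) h0
      (fun n => key _ _ _ hg.1 fun x => ?_) (fun n => key _ _ _ (hf n).1 fun x => ?_)
    · simpa using enorm_add_le (g x) (f n x - g x)
    · simpa using enorm_sub_le (a := f n x) (b := f n x - g x)

lemma tendsto_eLpNorm_add {ι : Type*} {l : Filter ι} {p : ℝ≥0∞} {f g : ι → E → ℝ}
    (hfm : ∀ n, AEStronglyMeasurable (f n) m) (hgm : ∀ n, AEStronglyMeasurable (g n) m)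
    (hf : Tendsto (fun n => eLpNorm (f n) p m) l (𝓝 0))
    (hg : Tendsto (fun n => eLpNorm (g n) p m) l (𝓝 0)) :
    Tendsto (fun n => eLpNorm (fun x => f n x + g n x) p m) l (𝓝 0) := by
  have h : Tendsto (fun n => ENNReal.LpAddConst p * (eLpNorm (f n) p m + eLpNorm (g n) p m)) l (𝓝 0) := by
    simpa using ENNReal.Tendsto.const_mul (hf.add hg) (Or.inr (ENNReal.LpAddConst_lt_top p).ne)
  exact tendsto_of_tendsto_of_tendsto_of_le_of_le tendsto_const_nhds h (fun _ => zero_le)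
    fun n => eLpNorm_add_le' (hfm n) (hgm n) p

end Modular

/-! ### The stable integral: linearity, law, uniqueness, existence -/

section StableIntegral

variable {E Ω : Type*} [MeasurableSpace E] [MeasurableSpace Ω] {α : ℝ} {m : Measure E}
  {Z : Set E → Ω → ℝ} {P : Measure Ω} {g g₁ g₂ : E → ℝ} {Y Y₁ Y₂ : Ω → ℝ}

lemma memLp_const_mul_map (c : ℝ) {p : ℝ≥0∞} {f : SimpleFunc E ℝ} (hf : MemLp f p m) :
    MemLp (f.map fun x => c * x) p m := by
  have : ⇑(f.map fun x => c * x) = fun x => c * f x := by ext; simp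
  rw [this]
  exact hf.const_mul c

/-- Along a subsequence, the integrals of simple functions in the definition of the stable integral
converge almost surely. -/
lemma IsStableIntegral.exists_ae_tendsto (h : IsStableIntegral α m Z P g Y) :
    ∃ f : ℕ → SimpleFunc E ℝ, (∀ n, MemLp (f n) (ENNReal.ofReal α) m) ∧
      Tendsto (fun n => eLpNorm (fun x => f n x - g x) (ENNReal.ofReal α) m) atTop (𝓝 0) ∧
      ∀ᵐ ω ∂P, Tendsto (fun n => simpleIntegral Z (f n) ω) atTop (𝓝 (Y ω)) := by
  obtain ⟨f, hf, hfg, hfY⟩ := h.exists_approx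
  obtain ⟨φ, hφ, hφ'⟩ := hfY.exists_seq_tendsto_ae
  exact ⟨fun n => f (φ n), fun n => hf _, hfg.comp hφ.tendsto_atTop, hφ'⟩

/-- Converse of `exists_ae_tendsto`. Linear operations are carried out on almost surely convergent
subsequences and brought back here to convergence in probability. -/
lemma IsStableIntegral.of_ae_tendsto [IsFiniteMeasure P] (hα : 0 < α)
    (hZ : IsSymmStableRandomMeasure α m Z P)
    (hg : MemLp g (ENNReal.ofReal α) m) (hY : Measurable Y) {f : ℕ → SimpleFunc E ℝ}
    (hf : ∀ n, MemLp (f n) (ENNReal.ofReal α) m)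
    (hfg : Tendsto (fun n => eLpNorm (fun x => f n x - g x) (ENNReal.ofReal α) m) atTop (𝓝 0))
    (h : ∀ᵐ ω ∂P, Tendsto (fun n => simpleIntegral Z (f n) ω) atTop (𝓝 (Y ω))) :
    IsStableIntegral α m Z P g Y :=
  ⟨hg, hY, f, hf, hfg, tendstoInMeasure_of_tendsto_ae
    (fun n => (hZ.measurable_simpleIntegral hα (hf n)).aestronglyMeasurable) h⟩

lemma IsStableIntegral.const_mul [IsFiniteMeasure P] (hα : 0 < α)
    (hZ : IsSymmStableRandomMeasure α m Z P)
    (h : IsStableIntegral α m Z P g Y) (c : ℝ) :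
    IsStableIntegral α m Z P (fun x => c * g x) (fun ω => c * Y ω) := by
  obtain ⟨f, hf, hfg, hfY⟩ := h.exists_ae_tendsto
  refine .of_ae_tendsto hα hZ (h.memLp.const_mul c) (h.measurable.const_mul c)
    (f := fun n => (f n).map fun x => c * x) (fun n => memLp_const_mul_map c (hf n)) ?_ ?_
  · have : ∀ n, (fun x => ((f n).map fun x => c * x) x - c * g x) = c • fun x => f n x - g x := by
      intro n; ext x; simp [mul_sub]
    simp only [this, eLpNorm_const_smul]
    simpa using ENNReal.Tendsto.const_mul hfg (Or.inr enorm_ne_top)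
  · filter_upwards [hfY, ae_all_iff.2 fun n => hZ.ae_simpleIntegral_const_mul hα c (hf n)]
      with ω h1 h2
    simp only [h2]
    exact h1.const_mul c

lemma IsStableIntegral.add [IsFiniteMeasure P] (hα : 0 < α)
    (hZ : IsSymmStableRandomMeasure α m Z P)
    (h₁ : IsStableIntegral α m Z P g₁ Y₁) (h₂ : IsStableIntegral α m Z P g₂ Y₂) :
    IsStableIntegral α m Z P (fun x => g₁ x + g₂ x) (fun ω => Y₁ ω + Y₂ ω) := by
  obtain ⟨f₁, hf₁, hfg₁, hfY₁⟩ := h₁.exists_ae_tendsto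
  obtain ⟨f₂, hf₂, hfg₂, hfY₂⟩ := h₂.exists_ae_tendsto
  refine .of_ae_tendsto hα hZ (h₁.memLp.add h₂.memLp) (h₁.measurable.add h₂.measurable)
    (f := fun n => f₁ n + f₂ n) (fun n => (hf₁ n).add (hf₂ n)) ?_ ?_
  · have := tendsto_eLpNorm_add (fun n => (hf₁ n).1.sub h₁.memLp.1)
      (fun n => (hf₂ n).1.sub h₂.memLp.1) hfg₁ hfg₂
    refine this.congr fun n => ?_
    congr 1
    ext x
    simp
    ring
  · filter_upwards [hfY₁, hfY₂, ae_all_iff.2 fun n => hZ.ae_simpleIntegral_add hα (hf₁ n) (hf₂ n)]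
      with ω h1 h2 h3
    simp only [h3]
    exact h1.add h2

lemma IsStableIntegral.zero [IsFiniteMeasure P] (hα : 0 < α)
    (hZ : IsSymmStableRandomMeasure α m Z P) :
    IsStableIntegral α m Z P (fun _ => 0) (fun _ => 0) := by
  refine .of_ae_tendsto hα hZ MemLp.zero' measurable_const (f := fun _ => 0)
    (fun _ => MemLp.zero) ?_ ?_
  · simp
  · refine ae_of_all _ fun ω => ?_
    have : simpleIntegral Z (0 : SimpleFunc E ℝ) ω = 0 := by
      refine Finset.sum_eq_zero fun c hc => ?_
      obtain ⟨x, hx⟩ := SimpleFunc.mem_range.1 hc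
      simp only [SimpleFunc.coe_zero, Pi.zero_apply] at hx
      simp [← hx]
    simp [this]

lemma IsStableIntegral.sum [IsFiniteMeasure P] (hα : 0 < α)
    (hZ : IsSymmStableRandomMeasure α m Z P) {ι : Type*} (s : Finset ι)
    {g : ι → E → ℝ} {Y : ι → Ω → ℝ} (h : ∀ i, IsStableIntegral α m Z P (g i) (Y i)) :
    IsStableIntegral α m Z P (fun x => ∑ i ∈ s, g i x) (fun ω => ∑ i ∈ s, Y i ω) := by
  classical
  induction s using Finset.induction_on with
  | empty => simpa using IsStableIntegral.zero hα hZ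
  | insert a s ha ih => simpa only [Finset.sum_insert ha] using (h a).add hα hZ ih

lemma IsStableIntegral.sub [IsFiniteMeasure P] (hα : 0 < α)
    (hZ : IsSymmStableRandomMeasure α m Z P)
    (h₁ : IsStableIntegral α m Z P g₁ Y₁) (h₂ : IsStableIntegral α m Z P g₂ Y₂) :
    IsStableIntegral α m Z P (fun x => g₁ x - g₂ x) (fun ω => Y₁ ω - Y₂ ω) := by
  simpa [sub_eq_add_neg] using h₁.add hα hZ (h₂.const_mul hα hZ (-1))

/-- Passage to the limit from simple functions: dominated convergence for the characteristic
functions, continuity of `∫ |g|^α` for the exponents. -/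
lemma IsStableIntegral.charFun_eq [IsProbabilityMeasure P] (hα : 0 < α)
    (hZ : IsSymmStableRandomMeasure α m Z P) (h : IsStableIntegral α m Z P g Y) (u : ℝ) :
    charFun (P.map Y) u
      = ((Real.exp (-((∫⁻ x, ‖g x‖ₑ ^ α ∂m).toReal * |u| ^ α)) : ℝ) : ℂ) := by
  obtain ⟨f, hf, hfg, hfY⟩ := h.exists_ae_tendsto
  have h1 : Tendsto (fun n => charFun (P.map (simpleIntegral Z (f n))) u) atTop
      (𝓝 (charFun (P.map Y) u)) := by
    have hm : ∀ n, Measurable (simpleIntegral Z (f n)) :=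
      fun n => hZ.measurable_simpleIntegral hα (hf n)
    have he : ∀ X : Ω → ℝ, Measurable X →
        charFun (P.map X) u = ∫ ω, Complex.exp (u * X ω * Complex.I) ∂P := by
      intro X hX
      rw [charFun_apply_real, integral_map hX.aemeasurable]
      exact Measurable.aestronglyMeasurable (by fun_prop)
    rw [he Y h.measurable]
    simp only [fun n => he _ (hm n)]
    refine tendsto_integral_of_dominated_convergence (fun _ => 1) (fun n => ?_)
      (integrable_const _) (fun n => ae_of_all _ fun ω => ?_) ?_
    · have := hm n
      exact Measurable.aestronglyMeasurable (by fun_prop)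
    · rw [← Complex.ofReal_mul, Complex.norm_exp_ofReal_mul_I]
    · filter_upwards [hfY] with ω hω
      have hc : Continuous fun x : ℝ => Complex.exp (u * x * Complex.I) := by fun_prop
      exact (hc.tendsto _).comp hω
  simp only [fun n => hZ.charFun_simpleIntegral hα (hf n) u] at h1
  refine tendsto_nhds_unique h1 ?_
  have h2 := (ENNReal.tendsto_toReal (lintegral_rpow_enorm_ne_top hα h.memLp)).comp
    (tendsto_lintegral_rpow_enorm hα hf h.memLp hfg)
  have hc : Continuous fun x : ℝ => ((Real.exp (-(x * |u| ^ α)) : ℝ) : ℂ) := by fun_prop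
  exact (hc.tendsto _).comp h2

/-- The difference is an integral of `0`, so its characteristic function is `1` and its law is the
point mass at `0`. -/
lemma IsStableIntegral.ae_eq [IsProbabilityMeasure P] (hα : 0 < α)
    (hZ : IsSymmStableRandomMeasure α m Z P)
    (h₁ : IsStableIntegral α m Z P g Y₁) (h₂ : IsStableIntegral α m Z P g Y₂) :
    Y₁ =ᵐ[P] Y₂ := by
  have h := h₁.sub hα hZ h₂
  have hlaw : P.map (fun ω => Y₁ ω - Y₂ ω) = Measure.dirac 0 := by
    have : IsProbabilityMeasure (P.map fun ω => Y₁ ω - Y₂ ω) :=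
      Measure.isProbabilityMeasure_map h.measurable.aemeasurable
    refine Measure.ext_of_charFun ?_
    ext u
    rw [h.charFun_eq hα hZ]
    simp [hα]
  have h0 : ∀ᵐ x ∂(P.map fun ω => Y₁ ω - Y₂ ω), x = 0 := by
    rw [hlaw, ae_dirac_eq]
    exact rfl
  filter_upwards [ae_of_ae_map h.measurable.aemeasurable h0] with ω hω
  exact sub_eq_zero.1 hω

/-- Integrals of `L^α`-approximating simple functions are Cauchy in probability: the law of a
difference has scale `∫ |f_k - f_l|^α`, and the tail bound turns smallness of the scale into
smallness of tails. -/
lemma exists_isStableIntegral [IsProbabilityMeasure P] (hα : 0 < α)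
    (hZ : IsSymmStableRandomMeasure α m Z P) (hg : MemLp g (ENNReal.ofReal α) m) :
    ∃ Y, IsStableIntegral α m Z P g Y := by
  have hex : ∀ n : ℕ, ∃ f : SimpleFunc E ℝ,
      eLpNorm (g - ⇑f) (ENNReal.ofReal α) m < ((n : ℝ≥0∞) + 1)⁻¹ ∧
        MemLp f (ENNReal.ofReal α) m := fun n =>
    hg.exists_simpleFunc_eLpNorm_sub_lt ENNReal.ofReal_ne_top (by simp)
  choose f hfg hf using hex
  have hfg' : Tendsto (fun n => eLpNorm (fun x => f n x - g x) (ENNReal.ofReal α) m) atTop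
      (𝓝 0) := by
    have h0 : Tendsto (fun n : ℕ => ((n : ℝ≥0∞) + 1)⁻¹) atTop (𝓝 0) := by
      have := (tendsto_add_atTop_iff_nat 1).2 ENNReal.tendsto_inv_nat_nhds_zero
      simpa using this
    refine tendsto_of_tendsto_of_tendsto_of_le_of_le tendsto_const_nhds h0 (fun _ => zero_le)
      fun n => ?_
    change eLpNorm (⇑(f n) - g) _ _ ≤ _
    rw [eLpNorm_sub_comm]
    exact (hfg n).le
  have hm : ∀ n, Measurable (simpleIntegral Z (f n)) :=
    fun n => hZ.measurable_simpleIntegral hα (hf n)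
  let d : ℕ × ℕ → SimpleFunc E ℝ := fun p => f p.1 + (f p.2).map fun x => -1 * x
  have hcauchy : Tendsto (fun p : ℕ × ℕ => eLpNorm (⇑(d p))
      (ENNReal.ofReal α) m) atTop (𝓝 0) := by
    have h1 : Tendsto (fun p : ℕ × ℕ => eLpNorm (fun x => f p.1 x - g x) (ENNReal.ofReal α) m)
        atTop (𝓝 0) := by
      rw [← prod_atTop_atTop_eq]
      exact hfg'.comp tendsto_fst
    have h2 : Tendsto (fun p : ℕ × ℕ => eLpNorm (fun x => g x - f p.2 x) (ENNReal.ofReal α) m)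
        atTop (𝓝 0) := by
      rw [← prod_atTop_atTop_eq]
      refine (hfg'.comp tendsto_snd).congr fun p => ?_
      exact eLpNorm_sub_comm (⇑(f p.2)) g _ _
    have h3 := tendsto_eLpNorm_add (f := fun (p : ℕ × ℕ) x => f p.1 x - g x)
      (g := fun (p : ℕ × ℕ) x => g x - f p.2 x) (fun p => (hf p.1).1.sub hg.1)
      (fun p => hg.1.sub (hf p.2).1) h1 h2
    refine h3.congr fun p => ?_
    congr 1
    ext x
    simp [d]
    ring
  have hN : Tendsto (fun p : ℕ × ℕ =>
      (∫⁻ x, ‖(d p) x‖ₑ ^ α ∂m).toReal) atTop (𝓝 0) := by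
    simp only [fun p : ℕ × ℕ => lintegral_rpow_enorm_eq (m := m) hα
      (⇑(d p))]
    have hc : Continuous fun x : ℝ≥0∞ => x ^ α := ENNReal.continuous_rpow_const
    have := (hc.tendsto 0).comp hcauchy
    rw [ENNReal.zero_rpow_of_pos hα] at this
    simpa [Function.comp_def] using (ENNReal.tendsto_toReal ENNReal.zero_ne_top).comp this
  obtain ⟨Y, φ, hY, hφ, hYφ⟩ := exists_ae_tendsto_subseq_of_cauchy (P := P) hm (by
    intro ε hε
    have h1 : Tendsto (fun p : ℕ × ℕ => 2 * (∫⁻ x, ‖(d p) x‖ₑ ^ α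
        ∂m).toReal * (2 / ε) ^ α) atTop (𝓝 0) := by
      simpa using (hN.const_mul 2).mul_const ((2 / ε) ^ α)
    filter_upwards [h1.eventually (gt_mem_nhds hε)] with p hp
    have hfp : MemLp (⇑(d p)) (ENNReal.ofReal α) m :=
      (hf p.1).add (memLp_const_mul_map (-1) (hf p.2))
    have hmp := hZ.measurable_simpleIntegral hα hfp
    have : IsProbabilityMeasure (P.map (simpleIntegral Z (d p))) :=
      Measure.isProbabilityMeasure_map hmp.aemeasurable
    have hb := measureReal_abs_gt_le_of_charFun ENNReal.toReal_nonneg hα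
      (hZ.charFun_simpleIntegral hα hfp) hε
    rw [map_measureReal_apply hmp (measurableSet_lt measurable_const (measurable_id'.abs))] at hb
    refine (Eq.le ?_).trans (hb.trans hp.le)
    refine measureReal_congr (eventuallyEq_set.2 ?_)
    filter_upwards [hZ.ae_simpleIntegral_add hα (hf p.1) (memLp_const_mul_map (-1) (hf p.2)),
      hZ.ae_simpleIntegral_const_mul hα (-1) (hf p.2)] with ω h1 h2
    simp only [Set.mem_preimage, d, h1, h2, Set.mem_ofPred_eq]
    simp [sub_eq_add_neg])
  exact ⟨Y, .of_ae_tendsto hα hZ hg hY (fun n => hf (φ n)) (hfg'.comp hφ.tendsto_atTop) hYφ⟩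

end StableIntegral

/-! ### Finite-dimensional laws of stable integrals -/

section FiniteDimensional

variable {E Ω : Type*} [MeasurableSpace E] [MeasurableSpace Ω] {α : ℝ} {m : Measure E}
  {Z : Set E → Ω → ℝ} {P : Measure Ω} {ι : Type*} [Fintype ι]

lemma dual_apply_eq_sum [DecidableEq ι] (L : StrongDual ℝ (ι → ℝ)) (x : ι → ℝ) :
    L x = ∑ i, L (Pi.single i 1) * x i := by
  conv_lhs => rw [pi_eq_sum_univ' x, map_sum]
  refine Finset.sum_congr rfl fun i _ => ?_
  rw [map_smul, smul_eq_mul, mul_comm]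

/-- The joint characteristic function of finitely many stable integrals. -/
lemma charFunDual_isStableIntegral [DecidableEq ι] [IsProbabilityMeasure P] (hα : 0 < α)
    (hZ : IsSymmStableRandomMeasure α m Z P) {g : ι → E → ℝ} {Y : ι → Ω → ℝ}
    (h : ∀ i, IsStableIntegral α m Z P (g i) (Y i)) (L : StrongDual ℝ (ι → ℝ)) :
    charFunDual (P.map fun ω i => Y i ω) L
      = ((Real.exp (-(∫⁻ x, ‖∑ i, L (Pi.single i 1) * g i x‖ₑ ^ α ∂m).toReal) : ℝ) : ℂ) := by
  have hm : Measurable fun ω i => Y i ω := measurable_pi_lambda _ fun i => (h i).measurable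
  have hs := IsStableIntegral.sum hα hZ Finset.univ
    (fun i => (h i).const_mul hα hZ (L (Pi.single i 1)))
  rw [charFunDual_eq_charFun_map_one, Measure.map_map L.measurable hm]
  have : (L ∘ fun ω i => Y i ω) = fun ω => ∑ i, L (Pi.single i 1) * Y i ω := by
    ext ω
    exact dual_apply_eq_sum L _
  rw [this, hs.charFun_eq hα hZ]
  simp

lemma enorm_const_mul_rpow (hα : 0 < α) (c x : ℝ) :
    ‖c * x‖ₑ ^ α = ENNReal.ofReal (|c| ^ α) * ‖x‖ₑ ^ α := by
  rw [enorm_mul, ENNReal.mul_rpow_of_nonneg _ _ hα.le, Real.enorm_eq_ofReal_abs c,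
    ENNReal.ofReal_rpow_of_nonneg (abs_nonneg c) hα.le]

lemma lintegral_const_mul_rpow (hα : 0 < α) (c : ℝ) (g : E → ℝ) :
    ∫⁻ x, ‖c * g x‖ₑ ^ α ∂m = ENNReal.ofReal (|c| ^ α) * ∫⁻ x, ‖g x‖ₑ ^ α ∂m := by
  simp only [enorm_const_mul_rpow hα]
  rw [lintegral_const_mul' _ _ ENNReal.ofReal_ne_top]

/-- Scaling by `c` multiplies the exponent of the characteristic function by `|c|^α`. Hence `c = ±1`
give the same law, and the exponents for `a` and `b` add up to the one for `(a^α + b^α)^(1/α)`. -/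
lemma isSymmStableLaw_of_isStableIntegral [IsProbabilityMeasure P] (hα : 0 < α)
    (hZ : IsSymmStableRandomMeasure α m Z P) {g : ι → E → ℝ} {Y : ι → Ω → ℝ}
    (h : ∀ i, IsStableIntegral α m Z P (g i) (Y i)) :
    IsSymmStableLaw α (P.map fun ω i => Y i ω) := by
  classical
  have hm : Measurable fun ω i => Y i ω := measurable_pi_lambda _ fun i => (h i).measurable
  set μ := P.map fun ω i => Y i ω with hμ
  have hprob : IsProbabilityMeasure μ := Measure.isProbabilityMeasure_map hm.aemeasurable
  have hsm : ∀ c : ℝ, Measurable fun x : ι → ℝ => c • x := fun c => measurable_const_smul c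
  have hprob' : ∀ c : ℝ, IsProbabilityMeasure (μ.map fun x => c • x) := fun c =>
    Measure.isProbabilityMeasure_map (hsm c).aemeasurable
  have hcf : ∀ (c : ℝ) (L : StrongDual ℝ (ι → ℝ)), charFunDual (μ.map fun x => c • x) L
      = ((Real.exp (-(|c| ^ α *
        (∫⁻ x, ‖∑ i, L (Pi.single i 1) * g i x‖ₑ ^ α ∂m).toReal)) : ℝ) : ℂ) := by
    intro c L
    have h1 : (μ.map fun x => c • x) = P.map fun ω i => c * Y i ω := by
      rw [hμ, Measure.map_map (hsm c) hm]
      rfl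
    rw [h1, charFunDual_isStableIntegral hα hZ (fun i => (h i).const_mul hα hZ c)]
    have h2 : ∀ x, ∑ i, L (Pi.single i 1) * (c * g i x)
        = c * ∑ i, L (Pi.single i 1) * g i x := by
      intro x
      rw [Finset.mul_sum]
      exact Finset.sum_congr rfl fun i _ => by ring
    simp only [h2]
    rw [lintegral_const_mul_rpow hα, ENNReal.toReal_mul, ENNReal.toReal_ofReal (by positivity)]
  refine ⟨hprob, ?_, fun a b ha hb => ?_⟩
  · have h1 : μ.map (fun x => -x) = μ.map fun x => (-1 : ℝ) • x := by simp
    have h2 : μ = μ.map fun x => (1 : ℝ) • x := by simp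
    rw [h1]
    conv_rhs => rw [h2]
    refine Measure.ext_of_charFunDual ?_
    ext L
    rw [hcf, hcf]
    simp
  · refine Measure.ext_of_charFunDual ?_
    ext L
    rw [charFunDual_conv, hcf, hcf, hcf, ← Complex.ofReal_mul, ← Real.exp_add,
      abs_of_pos ha, abs_of_pos hb, abs_of_nonneg (by positivity), ← Real.rpow_mul (by positivity),
      one_div_mul_cancel hα.ne', Real.rpow_one]
    congr 2
    ring

/-- The reduction on which the theorem rests: equality of laws becomes equality of deterministic
integrals. -/
lemma identDistrib_of_isStableIntegral [IsProbabilityMeasure P] (hα : 0 < α)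
    (hZ : IsSymmStableRandomMeasure α m Z P) {g g' : ι → E → ℝ} {Y Y' : ι → Ω → ℝ}
    (h : ∀ i, IsStableIntegral α m Z P (g i) (Y i))
    (h' : ∀ i, IsStableIntegral α m Z P (g' i) (Y' i))
    (heq : ∀ θ : ι → ℝ, ∫⁻ x, ‖∑ i, θ i * g i x‖ₑ ^ α ∂m = ∫⁻ x, ‖∑ i, θ i * g' i x‖ₑ ^ α ∂m) :
    IdentDistrib (fun ω i => Y i ω) (fun ω i => Y' i ω) P P := by
  classical
  have hm : Measurable fun ω i => Y i ω := measurable_pi_lambda _ fun i => (h i).measurable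
  have hm' : Measurable fun ω i => Y' i ω := measurable_pi_lambda _ fun i => (h' i).measurable
  refine ⟨hm.aemeasurable, hm'.aemeasurable, ?_⟩
  have := Measure.isProbabilityMeasure_map (μ := P) hm.aemeasurable
  have := Measure.isProbabilityMeasure_map (μ := P) hm'.aemeasurable
  refine Measure.ext_of_charFunDual ?_
  ext L
  rw [charFunDual_isStableIntegral hα hZ h, charFunDual_isStableIntegral hα hZ h', heq]

end FiniteDimensional

/-! ### Lévy processes as random paths -/

section IndependentIncrements

variable {Ω : Type*} [MeasurableSpace Ω] {P : Measure Ω}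
  {X Y : ℝ≥0 → Ω → ℝ}

/-- Values of a process at finitely many times become partial sums of increments along one sequence.
The time `0` is inserted as the start, and the sequence stays at its last point so as to be defined
on `ℕ`. -/
lemma exists_monotone_seq (I : Finset ℝ≥0) :
    ∃ t : ℕ → ℝ≥0, Monotone t ∧ t 0 = 0 ∧ ∀ i ∈ I, ∃ k, t k = i := by
  classical
  set J := insert 0 I with hJ
  have hpos : 0 < J.card := Finset.card_pos.2 ⟨0, by simp [hJ]⟩
  refine ⟨fun k => J.orderEmbOfFin rfl ⟨min k (J.card - 1), by omega⟩, ?_, ?_, ?_⟩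
  · intro a b hab
    refine (J.orderEmbOfFin rfl).monotone ?_
    simp only [Fin.mk_le_mk]
    omega
  · have h0 : (0 : ℝ≥0) ∈ J := by simp [hJ]
    have h1 := J.min'_le 0 h0
    simp only [Nat.zero_min]
    rw [Finset.orderEmbOfFin_zero rfl hpos]
    exact le_antisymm h1 zero_le
  · intro i hi
    have : i ∈ Set.range (J.orderEmbOfFin rfl) := by
      rw [Finset.range_orderEmbOfFin]
      simp [hJ, hi]
    obtain ⟨⟨k, hk⟩, hki⟩ := this
    refine ⟨k, ?_⟩
    have hmin : min k (J.card - 1) = k := by omega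
    simp only [hmin, hki]

/-- The law of a process with independent increments that starts at zero is determined by the laws
of its increments. -/
lemma map_eq_of_hasIndepIncrements [IsProbabilityMeasure P] (hXm : ∀ t, Measurable (X t))
    (hYm : ∀ t, Measurable (Y t))
    (hX : HasIndepIncrements X P) (hY : HasIndepIncrements Y P)
    (hX0 : ∀ᵐ ω ∂P, X 0 ω = 0) (hY0 : ∀ᵐ ω ∂P, Y 0 ω = 0)
    (h : ∀ s t, s ≤ t → P.map (fun ω => X t ω - X s ω) = P.map (fun ω => Y t ω - Y s ω)) :
    P.map (fun ω t => X t ω) = P.map (fun ω t => Y t ω) := by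
  rw [map_eq_iff_forall_finset_map_restrict_eq (measurable_pi_lambda _ hXm).aemeasurable
    (measurable_pi_lambda _ hYm).aemeasurable]
  intro I
  obtain ⟨t, ht, ht0, htI⟩ := exists_monotone_seq I
  choose k hk using fun i : I => htI i i.2
  let Φ : (ℕ → ℝ) → (I → ℝ) := fun d i => ∑ j ∈ Finset.range (k i), d j
  have hΦ : Measurable Φ := by fun_prop
  have key : ∀ W : ℝ≥0 → Ω → ℝ, (∀ t, Measurable (W t)) → HasIndepIncrements W P →
      (∀ᵐ ω ∂P, W 0 ω = 0) → P.map (fun ω => I.restrict (W · ω))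
        = (Measure.infinitePi fun j => P.map fun ω => W (t (j + 1)) ω - W (t j) ω).map Φ := by
    intro W hWm hW hW0
    have hD : ∀ j, Measurable fun ω => W (t (j + 1)) ω - W (t j) ω :=
      fun j => (hWm _).sub (hWm _)
    rw [← (iIndepFun_iff_map_fun_eq_infinitePi_map hD).1 (hW.nat ht),
      Measure.map_map hΦ (measurable_pi_lambda _ hD)]
    refine Measure.map_congr ?_
    filter_upwards [hW0] with ω hω
    ext i
    simp only [Finset.restrict, Function.comp, Φ]
    rw [Finset.sum_range_sub (fun j => W (t j) ω), ht0, hω, hk, sub_zero]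
  rw [key X hXm hX hX0, key Y hYm hY hY0]
  congr 2
  ext1 j
  exact h _ _ (ht j.le_succ)

/-- The increments after time `b` are independent of the values at times `a ≤ b` and `b`. -/
lemma indepFun_future [IsProbabilityMeasure P] (hXm : ∀ t, Measurable (X t))
    (hX : HasIndepIncrements X P)
    (hX0 : ∀ᵐ ω ∂P, X 0 ω = 0) {a b : ℝ≥0} (hab : a ≤ b) :
    IndepFun (fun ω => (X a ω, X b ω)) (fun ω t => X (b + t) ω - X b ω) P := by
  refine IndepFun.indepFun_process ((hXm a).prodMk (hXm b)) (fun t => (hXm _).sub (hXm _))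
    fun I => ?_
  obtain ⟨t, ht, ht0, htI⟩ := exists_monotone_seq I
  choose k hk using fun i : I => htI i i.2
  -- The times are `0, a, b, b + t 1, ...`, as `t 0 = 0`. The first two increments give the values
  -- at `a` and `b`; those from index `2` on give the increments after `b`.
  let τ : ℕ → ℝ≥0 := fun n => if n = 0 then 0 else if n = 1 then a else b + t (n - 2)
  have hτ : Monotone τ := by
    refine monotone_nat_of_le_succ fun n => ?_
    match n with
    | 0 => simp [τ]
    | 1 => simp [τ, ht0, hab]
    | n + 2 =>
      simp only [τ]
      simpa using ht (Nat.le_succ n)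
  have hind := hX.nat hτ
  obtain ⟨K, hK⟩ := (Set.finite_range k).bddAbove
  have h := hind.indepFun_finset {0, 1} (Finset.Ico 2 (2 + K)) (by
    rw [Finset.disjoint_left]
    intro x hx hx'
    simp only [Finset.mem_insert, Finset.mem_singleton] at hx
    simp only [Finset.mem_Ico] at hx'
    omega) (fun j => (hXm _).sub (hXm _))
  let φ : (({0, 1} : Finset ℕ) → ℝ) → ℝ × ℝ := fun d =>
    (d ⟨0, by simp⟩, d ⟨0, by simp⟩ + d ⟨1, by simp⟩)
  let ψ : (Finset.Ico 2 (2 + K) → ℝ) → (I → ℝ) := fun d i =>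
    ∑ j ∈ (Finset.range (k i)).attach, d ⟨j + 2, by
      have h1 := Finset.mem_range.1 j.2
      have h2 := hK (Set.mem_range_self i)
      simp only [Finset.mem_Ico]
      omega⟩
  have hφ : Measurable φ := by fun_prop
  have hψ : Measurable ψ := by
    refine measurable_pi_lambda _ fun i => ?_
    exact Finset.measurable_sum _ fun j _ => measurable_pi_apply _
  refine (h.comp hφ hψ).congr ?_ (ae_of_all _ fun ω => ?_)
  · filter_upwards [hX0] with ω hω
    simp [φ, τ, hω, ht0]
  · ext i
    simp only [ψ, Function.comp]
    rw [Finset.sum_attach (Finset.range (k i))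
      (fun j => X (τ (j + 2 + 1)) ω - X (τ (j + 2)) ω)]
    have h1 : ∀ j, τ (j + 2) = b + t j := fun j => by simp [τ]
    simp only [h1]
    rw [Finset.sum_range_sub (fun j => X (b + t j) ω), ht0, hk, add_zero]

lemma HasIndepIncrements.shift (hX : HasIndepIncrements X P) (b : ℝ≥0) :
    HasIndepIncrements (fun t ω => X (b + t) ω - X b ω) P := by
  intro n t ht
  have := hX n (fun i => b + t i) (fun i j hij => add_le_add_right (ht hij) b)
  simpa using this

lemma HasIndepIncrements.comp_monotone (hX : HasIndepIncrements X P) {f : ℝ≥0 → ℝ≥0}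
    (hf : Monotone f) : HasIndepIncrements (fun t ω => X (f t) ω) P :=
  fun n t ht => hX n (fun i => f (t i)) (hf.comp ht)

lemma IsLevyProcess.map_sub (hX : IsLevyProcess X P) {s t : ℝ≥0} (hst : s ≤ t) :
    P.map (fun ω => X t ω - X s ω) = P.map (X (t - s)) := by
  have := (hX.stationary s (t - s)).map_eq
  rwa [add_tsub_cancel_of_le hst] at this

/-- The process of increments after time `b` has the law of the process. -/
lemma IsLevyProcess.map_shift [IsProbabilityMeasure P] (hX : IsLevyProcess X P) (b : ℝ≥0) :
    P.map (fun ω t => X (b + t) ω - X b ω) = P.map (fun ω t => X t ω) := by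
  refine map_eq_of_hasIndepIncrements (X := fun t ω => X (b + t) ω - X b ω)
    (fun t => (hX.measurable _).sub (hX.measurable _)) hX.measurable
    (HasIndepIncrements.shift hX.indep b) hX.indep (by simp) hX.zero fun s t hst => ?_
  have : (fun ω => X (b + t) ω - X b ω - (X (b + s) ω - X b ω))
      = fun ω => X (b + t) ω - X (b + s) ω := by ext; ring
  rw [this, hX.map_sub hst, hX.map_sub (by gcongr), add_tsub_add_eq_tsub_left]

/-- If the marginals of a Lévy process are self-similar then so is the process. -/
lemma IsLevyProcess.map_scale [IsProbabilityMeasure P] (hX : IsLevyProcess X P) {c : ℝ≥0} {d : ℝ}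
    (h : ∀ t, P.map (X (c * t)) = P.map (fun ω => d * X t ω)) :
    P.map (fun ω t => X (c * t) ω) = P.map (fun ω t => d * X t ω) := by
  refine map_eq_of_hasIndepIncrements (X := fun t ω => X (c * t) ω) (Y := fun t ω => d * X t ω)
    (fun t => hX.measurable _) (fun t => (hX.measurable t).const_mul d)
    (HasIndepIncrements.comp_monotone hX.indep (fun a b hab => mul_le_mul_right hab c))
    (hX.indep.smul d) (by simpa using hX.zero) (by filter_upwards [hX.zero] with ω h; simp [h])
    fun s t hst => ?_
  have h1 : (fun ω => d * X t ω - d * X s ω) = (fun x => d * x) ∘ fun ω => X t ω - X s ω := by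
    ext; simp [mul_sub]
  have h2 : Measurable fun ω => X t ω - X s ω := (hX.measurable _).sub (hX.measurable _)
  rw [hX.map_sub (mul_le_mul_right hst c), h1, ← Measure.map_map (measurable_const_mul d) h2,
    hX.map_sub hst,
    Measure.map_map (measurable_const_mul d) (hX.measurable _), ← mul_tsub, h]
  rfl

end IndependentIncrements

/-! ### Jointly measurable evaluation of right-continuous paths -/

section PathEval

/-- The first point of the grid `ℕ / (k + 1)` strictly to the right of `u`. -/
def gridPoint (k : ℕ) (u : ℝ≥0) : ℝ≥0 := ((⌊((k : ℝ≥0) + 1) * u⌋₊ : ℝ≥0) + 1) / ((k : ℝ≥0) + 1)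

lemma lt_gridPoint (k : ℕ) (u : ℝ≥0) : u < gridPoint k u := by
  rw [gridPoint, lt_div_iff₀ (by positivity), mul_comm]
  exact Nat.lt_floor_add_one _

lemma gridPoint_le (k : ℕ) (u : ℝ≥0) : gridPoint k u ≤ u + 1 / ((k : ℝ≥0) + 1) := by
  rw [gridPoint, add_div]
  gcongr
  rw [div_le_iff₀ (by positivity), mul_comm]
  exact Nat.floor_le zero_le

lemma tendsto_one_div_add_one : Tendsto (fun k : ℕ => 1 / ((k : ℝ≥0) + 1)) atTop (𝓝 0) := by
  rw [← NNReal.tendsto_coe]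
  simpa using tendsto_one_div_add_atTop_nhds_zero_nat (𝕜 := ℝ)

lemma tendsto_gridPoint (u : ℝ≥0) : Tendsto (fun k => gridPoint k u) atTop (𝓝[≥] u) := by
  refine tendsto_nhdsWithin_iff.2 ⟨?_, Eventually.of_forall fun k => (lt_gridPoint k u).le⟩
  have h : Tendsto (fun k : ℕ => u + 1 / ((k : ℝ≥0) + 1)) atTop (𝓝 u) := by
    simpa using tendsto_one_div_add_one.const_add u
  exact tendsto_of_tendsto_of_tendsto_of_le_of_le tendsto_const_nhds h
    (fun k => (lt_gridPoint k u).le) (fun k => gridPoint_le k u)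

/-- Evaluation of a path at a point through its values on rational grids. It is jointly measurable
for the product `σ`-algebra on paths, and is the usual evaluation of right-continuous paths. -/
def pathEval (p : ℝ≥0 → ℝ) (u : ℝ≥0) : ℝ := limsup (fun k : ℕ => p (gridPoint k u)) atTop

lemma pathEval_eq {p : ℝ≥0 → ℝ} {u : ℝ≥0} (h : ContinuousWithinAt p (Set.Ici u) u) :
    pathEval p u = p u :=
  (h.tendsto.comp (tendsto_gridPoint u)).limsup_eq

/-- At each `k` only countably many grid points occur, and evaluation at a fixed time is measurable
for the product `σ`-algebra. -/
lemma measurable_pathEval : Measurable fun z : (ℝ≥0 → ℝ) × ℝ≥0 => pathEval z.1 z.2 := by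
  refine Measurable.limsup fun k => ?_
  have h1 : Measurable fun z : (ℝ≥0 → ℝ) × ℕ =>
      z.1 (((z.2 : ℝ≥0) + 1) / ((k : ℝ≥0) + 1)) :=
    measurable_from_prod_countable_left fun n =>
      measurable_pi_apply (((n : ℝ≥0) + 1) / ((k : ℝ≥0) + 1))
  have h2 : Measurable fun z : (ℝ≥0 → ℝ) × ℝ≥0 => (z.1, ⌊((k : ℝ≥0) + 1) * z.2⌋₊) :=
    measurable_fst.prodMk (Nat.measurable_floor.comp (measurable_snd.const_mul _))
  exact h1.comp h2

attribute [irreducible] pathEval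

lemma _root_.Measurable.pathEval {A : Type*} [MeasurableSpace A] {f : A → ℝ≥0 → ℝ} {g : A → ℝ≥0}
    (hf : Measurable f) (hg : Measurable g) : Measurable fun a => pathEval (f a) (g a) :=
  measurable_pathEval.comp (hf.prodMk hg)

end PathEval

/-! ### The inverse of an increasing path -/

section PathInverse

/-- The first passage time of a path over the level `t`, computed at rational times. -/
def pathInv (p : ℝ≥0 → ℝ) (t : ℝ≥0) : ℝ≥0 :=
  (⨅ q : ℚ, if (t : ℝ) ≤ p (Real.toNNReal q) then ((Real.toNNReal q : ℝ≥0) : ℝ≥0∞) else ∞).toNNReal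

lemma measurable_pathInv : Measurable fun z : (ℝ≥0 → ℝ) × ℝ≥0 => pathInv z.1 z.2 := by
  refine ENNReal.measurable_toNNReal.comp (Measurable.iInf fun q => ?_)
  refine Measurable.ite (measurableSet_le (by fun_prop) ?_) measurable_const measurable_const
  exact (measurable_pi_apply _).comp measurable_fst

/-- A strictly increasing right-continuous unbounded path that starts at zero. -/
structure IsGoodPath (x : ℝ≥0 → ℝ) : Prop where
  strictMono : StrictMono x
  rightCont : ∀ t, ContinuousWithinAt x (Set.Ici t) t
  zero : x 0 = 0
  unbounded : ∀ r : ℝ, ∃ u, r ≤ x u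

variable {x : ℝ≥0 → ℝ}

lemma IsGoodPath.nonneg (hx : IsGoodPath x) (u : ℝ≥0) : 0 ≤ x u := by
  rw [← hx.zero]
  exact hx.strictMono.monotone zero_le

/-- Infima over rational times suffice: right-continuity carries `t ≤ x w` for `w > v` down to `v`,
and conversely rationals above `v` come arbitrarily close. This equivalence is the source of the
later properties of the inverse. -/
lemma IsGoodPath.pathInv_le_iff (hx : IsGoodPath x) {t u : ℝ≥0} :
    pathInv x t ≤ u ↔ (t : ℝ) ≤ x u := by
  set A : ℝ≥0∞ := ⨅ q : ℚ, if (t : ℝ) ≤ x (Real.toNNReal q) then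
    ((Real.toNNReal q : ℝ≥0) : ℝ≥0∞) else ∞ with hA
  have hmono := hx.strictMono.monotone
  have key : ∀ v : ℝ≥0, A ≤ v ↔ (t : ℝ) ≤ x v := by
    intro v
    constructor
    · intro h
      have h1 : ∀ w, v < w → (t : ℝ) ≤ x w := by
        intro w hw
        have : A < w := h.trans_lt (by exact_mod_cast hw)
        obtain ⟨q, hq⟩ := iInf_lt_iff.1 this
        split_ifs at hq with hq'
        · exact hq'.trans (hmono (by exact_mod_cast hq.le))
        · simp at hq
      have h2 : Tendsto x (𝓝[>] v) (𝓝 (x v)) :=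
        (hx.rightCont v).tendsto.mono_left (nhdsWithin_mono _ Set.Ioi_subset_Ici_self)
      exact ge_of_tendsto h2 (by filter_upwards [self_mem_nhdsWithin] with w hw using h1 w hw)
    · intro h
      refine le_of_forall_gt_imp_ge_of_dense fun b hb => ?_
      obtain ⟨r, hr1, hr2⟩ := ENNReal.lt_iff_exists_nnreal_btwn.1 hb
      obtain ⟨q, _, hq1, hq2⟩ := (NNReal.lt_iff_exists_rat_btwn v r).1 (by exact_mod_cast hr1)
      refine (iInf_le _ q).trans ?_
      rw [if_pos (h.trans (hmono hq1.le))]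
      exact le_trans (by exact_mod_cast hq2.le) hr2.le
  -- `toNNReal` would send an infinite infimum to `0`; unboundedness of the path excludes this.
  have hfin : A ≠ ∞ := by
    obtain ⟨u, hu⟩ := hx.unbounded t
    exact ne_top_of_le_ne_top ENNReal.coe_ne_top ((key u).2 hu)
  rw [← key u, pathInv, ← hA]
  conv_rhs => rw [← ENNReal.coe_toNNReal hfin]
  rw [ENNReal.coe_le_coe]

attribute [irreducible] pathInv

lemma _root_.Measurable.pathInv {A : Type*} [MeasurableSpace A] {f : A → ℝ≥0 → ℝ} {g : A → ℝ≥0}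
    (hf : Measurable f) (hg : Measurable g) : Measurable fun a => pathInv (f a) (g a) :=
  measurable_pathInv.comp (hf.prodMk hg)

lemma IsGoodPath.sInf_eq (hx : IsGoodPath x) (t : ℝ≥0) :
    sInf {u : ℝ≥0 | (t : ℝ) ≤ x u} = pathInv x t := by
  have : {u : ℝ≥0 | (t : ℝ) ≤ x u} = Set.Ici (pathInv x t) := by
    ext u
    exact hx.pathInv_le_iff.symm
  rw [this, csInf_Ici]

lemma IsGoodPath.le_eval_pathInv (hx : IsGoodPath x) (t : ℝ≥0) : (t : ℝ) ≤ x (pathInv x t) :=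
  hx.pathInv_le_iff.1 le_rfl

lemma IsGoodPath.pathInv_mono (hx : IsGoodPath x) : Monotone (pathInv x) := fun _ _ h =>
  hx.pathInv_le_iff.2 (le_trans (by exact_mod_cast h) (hx.le_eval_pathInv _))

lemma IsGoodPath.pathInv_zero (hx : IsGoodPath x) : pathInv x 0 = 0 :=
  le_antisymm (hx.pathInv_le_iff.2 (by simp [hx.zero])) zero_le

lemma IsGoodPath.pathInv_eval (hx : IsGoodPath x) (u : ℝ≥0) :
    pathInv x (Real.toNNReal (x u)) = u := by
  have h := Real.coe_toNNReal _ (hx.nonneg u)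
  refine le_antisymm (hx.pathInv_le_iff.2 h.le) ?_
  have := hx.le_eval_pathInv (Real.toNNReal (x u))
  rw [h] at this
  exact hx.strictMono.le_iff_le.1 this

/-- Jumps of the path only create flat pieces of the inverse. By strict monotonicity each `u` is the
passage time over the level `x u`, so the monotone inverse is onto and cannot jump. -/
lemma IsGoodPath.continuous_pathInv (hx : IsGoodPath x) : Continuous (pathInv x) :=
  hx.pathInv_mono.continuous_of_surjective fun u => ⟨_, hx.pathInv_eval u⟩

lemma IsGoodPath.shift (hx : IsGoodPath x) (a : ℝ≥0) : IsGoodPath fun u => x (a + u) - x a where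
  strictMono u v h := sub_lt_sub_right (hx.strictMono (by gcongr)) _
  rightCont t := by
    refine ContinuousWithinAt.sub ?_ continuousWithinAt_const
    refine (hx.rightCont (a + t)).comp (t := Set.Ici (a + t)) (f := fun u => a + u)
      (by fun_prop) fun u hu => ?_
    exact add_le_add_right (Set.mem_Ici.1 hu) a
  zero := by simp
  unbounded r := by
    obtain ⟨u, hu⟩ := hx.unbounded (r + x a)
    refine ⟨u, ?_⟩
    have := hx.strictMono.monotone (le_add_self : u ≤ a + u)
    linarith

/-- Seen from time `a`, the level still to be reached is `t - x a`. If `t ≤ x a`, both truncated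
sides are `0`. -/
lemma IsGoodPath.pathInv_shift (hx : IsGoodPath x) (a t : ℝ≥0) :
    pathInv (fun u => x (a + u) - x a) (Real.toNNReal (t - x a)) = pathInv x t - a := by
  refine eq_of_forall_ge_iff fun u => ?_
  have h0 := (hx.shift a).nonneg u
  rw [(hx.shift a).pathInv_le_iff, tsub_le_iff_left, hx.pathInv_le_iff, Real.coe_toNNReal',
    max_le_iff]
  constructor
  · rintro ⟨h, -⟩; linarith
  · intro h; exact ⟨by linarith, h0⟩

lemma IsGoodPath.scale (hx : IsGoodPath x) {c : ℝ≥0} {d : ℝ} (hc : 0 < c) (hd : 0 < d) :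
    IsGoodPath fun u => d * x (c * u) where
  strictMono u v h := mul_lt_mul_of_pos_left (hx.strictMono (by gcongr)) hd
  rightCont t := by
    refine ContinuousWithinAt.mul continuousWithinAt_const ?_
    refine (hx.rightCont (c * t)).comp (t := Set.Ici (c * t)) (f := fun u => c * u)
      (by fun_prop) fun u hu => ?_
    exact mul_le_mul_right (Set.mem_Ici.1 hu) c
  zero := by simp [hx.zero]
  unbounded r := by
    obtain ⟨u, hu⟩ := hx.unbounded (r / d)
    refine ⟨u / c, ?_⟩
    rw [mul_div_cancel₀ _ hc.ne', ← div_le_iff₀' hd]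
    exact hu

lemma IsGoodPath.pathInv_scale (hx : IsGoodPath x) {c d : ℝ≥0} (hc : 0 < c) (hd : 0 < d)
    (t : ℝ≥0) : pathInv (fun u => d * x (c * u)) t = c⁻¹ * pathInv x (d⁻¹ * t) := by
  refine eq_of_forall_ge_iff fun u => ?_
  rw [(hx.scale hc (by exact_mod_cast hd)).pathInv_le_iff, inv_mul_le_iff₀ hc, hx.pathInv_le_iff,
    NNReal.coe_mul, NNReal.coe_inv, inv_mul_le_iff₀ (by exact_mod_cast hd)]

end PathInverse

/-! ### Uniqueness of Laplace transforms -/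

section Laplace

/-- The function `exp (-x)` on `[0, ∞)` as a bounded continuous function. -/
def expNegBCF : BoundedContinuousFunction ℝ≥0 ℝ :=
  BoundedContinuousFunction.ofNormedAddCommGroup (fun x : ℝ≥0 => Real.exp (-(x : ℝ)))
    (by fun_prop) 1 (fun x => by simp)

/-- Polynomials in `exp (-x)` form a point-separating algebra of bounded continuous functions, and
such an algebra determines finite measures. -/
lemma ext_of_integral_exp_nat {μ ν : Measure ℝ≥0} [IsFiniteMeasure μ] [IsFiniteMeasure ν]
    (h : ∀ n : ℕ, ∫ x, Real.exp (-(x : ℝ)) ^ n ∂μ = ∫ x, Real.exp (-(x : ℝ)) ^ n ∂ν) : μ = ν := by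
  let A : StarSubalgebra ℝ (BoundedContinuousFunction ℝ≥0 ℝ) :=
    { Algebra.adjoin ℝ {expNegBCF} with
      star_mem' := fun {a} ha => by
        have : star a = a := by ext; simp
        rw [this]
        exact ha }
  refine ext_of_forall_mem_subalgebra_integral_eq_of_pseudoEMetric_complete_countable (𝕜 := ℝ)
    (A := A) ?_ ?_
  · intro x y hxy
    refine ⟨fun z => expNegBCF z, ⟨BoundedContinuousFunction.toContinuousMapStarₐ ℝ expNegBCF,
      ⟨expNegBCF, Algebra.subset_adjoin rfl, rfl⟩, rfl⟩, fun heq => hxy ?_⟩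
    have h1 := Real.exp_injective heq
    exact NNReal.coe_injective (neg_injective h1)
  · intro g hg
    have hg' : g ∈ Algebra.adjoin ℝ {expNegBCF} := hg
    rw [Algebra.adjoin_singleton_eq_range_aeval] at hg'
    obtain ⟨p, rfl⟩ := hg'
    induction p using Polynomial.induction_on' with
    | add p q hp hq =>
      have hp' := hp (by
        change _ ∈ Algebra.adjoin ℝ {expNegBCF}
        rw [Algebra.adjoin_singleton_eq_range_aeval]
        exact ⟨p, rfl⟩)
      have hq' := hq (by
        change _ ∈ Algebra.adjoin ℝ {expNegBCF}
        rw [Algebra.adjoin_singleton_eq_range_aeval]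
        exact ⟨q, rfl⟩)
      simp only [AlgHom.toRingHom_eq_coe, RingHom.coe_coe, map_add,
        BoundedContinuousFunction.coe_add, Pi.add_apply] at hp' hq' ⊢
      rw [integral_add (BoundedContinuousFunction.integrable _ _)
        (BoundedContinuousFunction.integrable _ _), integral_add
        (BoundedContinuousFunction.integrable _ _) (BoundedContinuousFunction.integrable _ _),
        hp', hq']
    | monomial n a =>
      have : ∀ x, (Polynomial.aeval expNegBCF (Polynomial.monomial n a)) x
          = a * Real.exp (-(x : ℝ)) ^ n := by
        intro x
        rw [Polynomial.aeval_monomial, BoundedContinuousFunction.mul_apply,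
          BoundedContinuousFunction.pow_apply]
        rfl
      simp only [AlgHom.toRingHom_eq_coe, RingHom.coe_coe, this]
      rw [integral_const_mul, integral_const_mul, h]

/-- A measure on `[0, ∞)` is determined by its Laplace transform on a half-line. -/
lemma ext_of_laplace {μ ν : Measure ℝ≥0} (a : ℝ)
    (h : ∀ q, a ≤ q → ∫⁻ x, ENNReal.ofReal (Real.exp (-(q * x))) ∂μ
      = ∫⁻ x, ENNReal.ofReal (Real.exp (-(q * x))) ∂ν)
    (hfin : ∫⁻ x, ENNReal.ofReal (Real.exp (-(a * x))) ∂μ ≠ ∞) : μ = ν := by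
  -- Weighting by `exp (-a x)` makes the possibly infinite measures finite; the weight is positive
  -- and can be divided out again. Only the transforms at `a + n` are then needed.
  let w : ℝ≥0 → ℝ≥0∞ := fun x => ENNReal.ofReal (Real.exp (-(a * x)))
  have hw : Measurable w := by fun_prop
  have hinv : ∀ ρ : Measure ℝ≥0, (ρ.withDensity w).withDensity w⁻¹ = ρ := fun ρ =>
    withDensity_inv_same hw (ae_of_all _ fun x => by simp [w, Real.exp_pos])
      (ae_of_all _ fun x => ENNReal.ofReal_ne_top)
  have hμ : IsFiniteMeasure (μ.withDensity w) := isFiniteMeasure_withDensity hfin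
  have hν : IsFiniteMeasure (ν.withDensity w) :=
    isFiniteMeasure_withDensity (by rw [← h a le_rfl]; exact hfin)
  have hI : ∀ (ρ : Measure ℝ≥0) [IsFiniteMeasure (ρ.withDensity w)] (n : ℕ),
      ∫ x, Real.exp (-(x : ℝ)) ^ n ∂(ρ.withDensity w)
      = (∫⁻ x, ENNReal.ofReal (Real.exp (-((a + n) * x))) ∂ρ).toReal := by
    intro ρ _ n
    rw [integral_eq_lintegral_of_nonneg_ae (ae_of_all _ fun x => by positivity)
      (Measurable.aestronglyMeasurable (by fun_prop)),
      lintegral_withDensity_eq_lintegral_mul _ hw (by fun_prop)]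
    congr 1
    refine lintegral_congr fun x => ?_
    rw [Pi.mul_apply, ← ENNReal.ofReal_mul (Real.exp_pos _).le, ← Real.exp_nat_mul, ← Real.exp_add]
    congr 2
    ring
  rw [← hinv μ, ← hinv ν]
  congr 1
  refine ext_of_integral_exp_nat fun n => ?_
  rw [hI, hI, h _ (by simp)]

end Laplace

/-! ### Paths and scaling of the stable subordinator -/

section Subordinator

variable {Ω : Type*} [MeasurableSpace Ω] {P : Measure Ω}
  {X : ℝ≥0 → Ω → ℝ} {β : ℝ}

/-- A non-integrable function would have integral `0` by convention, whereas the Laplace transform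
is positive. -/
lemma IsStableSubordinator.integrable_exp (hX : IsStableSubordinator β X P) (t : ℝ≥0) {θ : ℝ}
    (hθ : 0 ≤ θ) : Integrable (fun ω => Real.exp (-(θ * X t ω))) P := by
  by_contra h
  have := hX.laplace t θ hθ
  rw [integral_undef h] at this
  exact (Real.exp_pos _).ne this

lemma IsStableSubordinator.lintegral_exp (hX : IsStableSubordinator β X P) (t : ℝ≥0) {θ : ℝ}
    (hθ : 0 ≤ θ) : ∫⁻ ω, ENNReal.ofReal (Real.exp (-(θ * X t ω))) ∂P
      = ENNReal.ofReal (Real.exp (-((t : ℝ) * θ ^ β))) := by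
  rw [← ofReal_integral_eq_lintegral_ofReal (hX.integrable_exp t hθ)
    (ae_of_all _ fun ω => (Real.exp_pos _).le), hX.laplace t θ hθ]

/-- Markov's inequality for the Laplace transform. -/
lemma IsStableSubordinator.measureReal_le [IsProbabilityMeasure P]
    (hX : IsStableSubordinator β X P) (t : ℝ≥0) {θ : ℝ}
    (hθ : 0 ≤ θ) (K : ℝ) :
    P.real {ω | X t ω ≤ K} ≤ Real.exp (θ * K) * Real.exp (-((t : ℝ) * θ ^ β)) := by
  have h := mul_meas_ge_le_integral_of_nonneg (μ := P)
    (ae_of_all _ fun ω => (Real.exp_pos (-(θ * X t ω))).le) (hX.integrable_exp t hθ)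
    (Real.exp (-(θ * K)))
  rw [hX.laplace t θ hθ] at h
  have hsub : P.real {ω | X t ω ≤ K} ≤ P.real {ω | Real.exp (-(θ * K)) ≤ Real.exp (-(θ * X t ω))} := by
    refine measureReal_mono fun ω (hω : X t ω ≤ K) => ?_
    exact Real.exp_le_exp.2 (neg_le_neg (mul_le_mul_of_nonneg_left hω hθ))
  calc P.real {ω | X t ω ≤ K}
      = Real.exp (θ * K) * (Real.exp (-(θ * K)) * P.real {ω | X t ω ≤ K}) := by
        rw [← mul_assoc, ← Real.exp_add]; simp
    _ ≤ Real.exp (θ * K) * Real.exp (-((t : ℝ) * θ ^ β)) := by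
        gcongr
        exact (mul_le_mul_of_nonneg_left hsub (Real.exp_pos _).le).trans h

/-- Markov's bound at level `0` is `exp (-t θ^β)`, which vanishes as `θ → ∞`. -/
lemma IsStableSubordinator.ae_pos [IsProbabilityMeasure P]
    (hX : IsStableSubordinator β X P) (hβ : 0 < β) {t : ℝ≥0}
    (ht : 0 < t) : ∀ᵐ ω ∂P, 0 < X t ω := by
  have h1 : P.real {ω | X t ω ≤ 0} ≤ 0 := by
    have hlim : Tendsto (fun θ : ℝ => Real.exp (-((t : ℝ) * θ ^ β))) atTop (𝓝 0) :=
      Real.tendsto_exp_neg_atTop_nhds_zero.comp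
        ((tendsto_rpow_atTop hβ).const_mul_atTop (by exact_mod_cast ht))
    refine ge_of_tendsto hlim ?_
    filter_upwards [eventually_ge_atTop 0] with θ hθ
    simpa using hX.measureReal_le t hθ 0
  have h2 : P {ω | X t ω ≤ 0} = 0 :=
    (measureReal_eq_zero_iff (measure_ne_top _ _)).1 (le_antisymm h1 measureReal_nonneg)
  rw [ae_iff]
  simpa using h2

/-- Markov's bound with `θ = 1` gives probability at most `exp (K - n)` for staying below `K` up to
time `n`. -/
lemma IsStableSubordinator.ae_unbounded [IsProbabilityMeasure P]
    (hX : IsStableSubordinator β X P) :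
    ∀ᵐ ω ∂P, ∀ r : ℝ, ∃ u, r ≤ X u ω := by
  have h1 : ∀ K : ℕ, ∀ᵐ ω ∂P, ∃ n : ℕ, (K : ℝ) < X n ω := by
    intro K
    rw [ae_iff]
    simp only [not_exists, not_lt]
    refine (measureReal_eq_zero_iff (measure_ne_top _ _)).1 (le_antisymm ?_ measureReal_nonneg)
    have hlim : Tendsto (fun n : ℕ => Real.exp K * Real.exp (-(n : ℝ))) atTop (𝓝 0) := by
      simpa using (Real.tendsto_exp_neg_atTop_nhds_zero.comp
        tendsto_natCast_atTop_atTop).const_mul (Real.exp K)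
    refine ge_of_tendsto hlim (Eventually.of_forall fun n => ?_)
    have := hX.measureReal_le n zero_le_one K
    simp only [one_mul, Real.one_rpow, mul_one, NNReal.coe_natCast] at this
    have hsub : {ω | ∀ n : ℕ, X n ω ≤ K} ⊆ {ω | X n ω ≤ K} :=
      fun ω (hω : ∀ n : ℕ, X n ω ≤ K) => hω n
    exact (measureReal_mono hsub).trans this
  filter_upwards [ae_all_iff.2 h1] with ω hω r
  obtain ⟨K, hK⟩ := exists_nat_ge r
  obtain ⟨n, hn⟩ := hω K
  exact ⟨n, hK.trans hn.le⟩

/-- Almost all paths of a stable subordinator are strictly increasing, right-continuous and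
unbounded. -/
lemma IsStableSubordinator.ae_isGoodPath [IsProbabilityMeasure P]
    (hX : IsStableSubordinator β X P) (hβ : 0 < β) :
    ∀ᵐ ω ∂P, IsGoodPath fun t => X t ω := by
  -- Strictness is a countable condition on rational times; two rationals between `u` and `v` then
  -- extend it to all times by monotonicity.
  have hstrict : ∀ᵐ ω ∂P, ∀ p q : ℚ, Real.toNNReal p < Real.toNNReal q →
      X (Real.toNNReal p) ω < X (Real.toNNReal q) ω := by
    refine ae_all_iff.2 fun p => ae_all_iff.2 fun q => ?_
    by_cases hpq : Real.toNNReal p < Real.toNNReal q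
    · have h1 := hX.ae_pos hβ (tsub_pos_of_lt hpq)
      have h2 := (hX.levy.stationary (Real.toNNReal p)
        (Real.toNNReal q - Real.toNNReal p)).symm.ae_snd (p := fun x => 0 < x)
        measurableSet_Ioi h1
      rw [add_tsub_cancel_of_le hpq.le] at h2
      filter_upwards [h2] with ω hω _
      exact sub_pos.1 hω
    · exact ae_of_all _ fun ω h => absurd h hpq
  filter_upwards [hstrict, hX.ae_unbounded, hX.monotone, hX.levy.cadlag, hX.levy.zero]
    with ω h1 h2 h3 h4 h5
  refine ⟨fun u v huv => ?_, fun t => (h4 t).1, h5, h2⟩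
  obtain ⟨p, _, hp1, hp2⟩ := (NNReal.lt_iff_exists_rat_btwn u v).1 huv
  obtain ⟨q, _, hq1, hq2⟩ := (NNReal.lt_iff_exists_rat_btwn _ v).1 hp2
  exact (h3 hp1.le).trans_lt ((h1 p q hq1).trans_le (h3 hq2.le))

/-- Self-similarity of a stable subordinator. -/
lemma IsStableSubordinator.map_scale [IsProbabilityMeasure P]
    (hX : IsStableSubordinator β X P) (hβ : 0 < β)
    {c : ℝ≥0} (hc : 0 < c) :
    P.map (fun ω t => X (c ^ β * t) ω) = P.map (fun ω t => (c : ℝ) * X t ω) := by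
  refine hX.levy.map_scale fun t => ?_
  have hnn : ∀ s, ∀ᵐ ω ∂P, 0 ≤ X s ω := fun s => by
    filter_upwards [hX.ae_isGoodPath hβ] with ω hω using hω.nonneg s
  have hcoe : ∀ W : Ω → ℝ, Measurable W → (∀ᵐ ω ∂P, 0 ≤ W ω) →
      P.map W = (P.map fun ω => Real.toNNReal (W ω)).map (fun x : ℝ≥0 => (x : ℝ)) := by
    intro W hW hW0
    rw [Measure.map_map (by fun_prop) (by fun_prop)]
    refine Measure.map_congr ?_
    filter_upwards [hW0] with ω hω
    simp [hω]
  have hm := hX.levy.measurable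
  have hnn' : ∀ᵐ ω ∂P, 0 ≤ (c : ℝ) * X t ω := by
    filter_upwards [hnn t] with ω hω using by positivity
  rw [hcoe _ (hm _) (hnn _), hcoe _ ((hm t).const_mul _) hnn']
  congr 1
  have h1 : ∀ W : Ω → ℝ, Measurable W → (∀ᵐ ω ∂P, 0 ≤ W ω) → ∀ q : ℝ,
      ∫⁻ x, ENNReal.ofReal (Real.exp (-(q * x))) ∂(P.map fun ω => Real.toNNReal (W ω))
        = ∫⁻ ω, ENNReal.ofReal (Real.exp (-(q * W ω))) ∂P := by
    intro W hW hW0 q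
    rw [lintegral_map (by fun_prop) (by fun_prop)]
    refine lintegral_congr_ae ?_
    filter_upwards [hW0] with ω hω
    simp [hω]
  refine ext_of_laplace 0 (fun q hq => ?_) ?_
  · rw [h1 _ (hm _) (hnn _), h1 _ ((hm t).const_mul _) hnn', hX.lintegral_exp _ hq]
    simp only [← mul_assoc]
    rw [hX.lintegral_exp _ (by positivity), Real.mul_rpow hq (by positivity)]
    congr 3
    push_cast
    ring
  · rw [h1 _ (hm _) (hnn _), hX.lintegral_exp _ le_rfl]
    exact ENNReal.ofReal_ne_top

end Subordinator

/-! ### Integrating out an independent variable -/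

section Independence

variable {Ω A B : Type*} [MeasurableSpace Ω] [MeasurableSpace A] [MeasurableSpace B]
  {P : Measure Ω} [IsProbabilityMeasure P]

lemma lintegral_of_indepFun {U : Ω → A} {V : Ω → B} (h : IndepFun U V P) (hU : Measurable U)
    (hV : Measurable V) {F : A × B → ℝ≥0∞} (hF : Measurable F) :
    ∫⁻ ω, F (U ω, V ω) ∂P = ∫⁻ ω, ∫⁻ v, F (U ω, v) ∂(P.map V) ∂P := by
  have := Measure.isProbabilityMeasure_map (μ := P) hV.aemeasurable
  have h1 := (indepFun_iff_map_prod_eq_prod_map_map hU.aemeasurable hV.aemeasurable).1 h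
  rw [← lintegral_map (g := fun ω => (U ω, V ω)) hF (hU.prodMk hV), h1,
    lintegral_prod _ hF.aemeasurable, lintegral_map hF.lintegral_prod_right' hU]

end Independence

/-! ### Discretised passage times -/

section Grid

/-- The first point of the grid `ℕ / (n + 1)` that is at least `u`. -/
def gridCeil (n : ℕ) (u : ℝ≥0) : ℝ≥0 := (⌈((n : ℝ≥0) + 1) * u⌉₊ : ℝ≥0) / ((n : ℝ≥0) + 1)

lemma le_gridCeil (n : ℕ) (u : ℝ≥0) : u ≤ gridCeil n u := by
  rw [gridCeil, le_div_iff₀ (by positivity), mul_comm]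
  exact Nat.le_ceil _

lemma gridCeil_le (n : ℕ) (u : ℝ≥0) : gridCeil n u ≤ u + 1 / ((n : ℝ≥0) + 1) := by
  have h : u + 1 / ((n : ℝ≥0) + 1) = (((n : ℝ≥0) + 1) * u + 1) / ((n : ℝ≥0) + 1) := by
    rw [add_div, mul_div_cancel_left₀ _ (by positivity)]
  rw [gridCeil, h]
  gcongr
  exact (Nat.ceil_lt_add_one zero_le).le

lemma tendsto_gridCeil (u : ℝ≥0) : Tendsto (fun n => gridCeil n u) atTop (𝓝[≥] u) := by
  refine tendsto_nhdsWithin_iff.2 ⟨?_, Eventually.of_forall fun n => le_gridCeil n u⟩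
  have h : Tendsto (fun k : ℕ => u + 1 / ((k : ℝ≥0) + 1)) atTop (𝓝 u) := by
    simpa using tendsto_one_div_add_one.const_add u
  exact tendsto_of_tendsto_of_tendsto_of_le_of_le tendsto_const_nhds h
    (fun k => le_gridCeil k u) (fun k => gridCeil_le k u)

@[fun_prop]
lemma measurable_gridCeil (n : ℕ) : Measurable (gridCeil n) := by
  have h1 : Measurable fun u : ℝ≥0 => ⌈((n : ℝ≥0) + 1) * u⌉₊ :=
    Nat.measurable_ceil.comp (measurable_id.const_mul _)
  have h2 : Measurable fun k : ℕ => (k : ℝ≥0) / ((n : ℝ≥0) + 1) := measurable_from_top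
  exact h2.comp h1

@[fun_prop]
lemma measurable_eval_gridCeil (n : ℕ) :
    Measurable fun z : (ℝ≥0 → ℝ) × ℝ≥0 => z.1 (gridCeil n z.2) := by
  have h1 : Measurable fun z : (ℝ≥0 → ℝ) × ℕ => z.1 ((z.2 : ℝ≥0) / ((n : ℝ≥0) + 1)) :=
    measurable_from_prod_countable_left fun k => measurable_pi_apply ((k : ℝ≥0) / ((n : ℝ≥0) + 1))
  have h2 : Measurable fun z : (ℝ≥0 → ℝ) × ℝ≥0 => (z.1, ⌈((n : ℝ≥0) + 1) * z.2⌉₊) :=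
    measurable_fst.prodMk (Nat.measurable_ceil.comp (measurable_snd.const_mul _))
  exact h1.comp h2

/-- The first passage over `r` on the grid happens at `k / (n + 1)` iff the path passes `r`
between `(k - 1) / (n + 1)` and `k / (n + 1)`. -/
lemma IsGoodPath.ceil_eq_iff {x : ℝ≥0 → ℝ} (hx : IsGoodPath x) (n k : ℕ) (r : ℝ≥0) :
    ⌈((n : ℝ≥0) + 1) * pathInv x r⌉₊ = k ↔
      (r : ℝ) ≤ x ((k : ℝ≥0) / ((n : ℝ≥0) + 1)) ∧
        (k = 0 ∨ x (((k - 1 : ℕ) : ℝ≥0) / ((n : ℝ≥0) + 1)) < r) := by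
  have key : ∀ j : ℕ, ⌈((n : ℝ≥0) + 1) * pathInv x r⌉₊ ≤ j ↔
      (r : ℝ) ≤ x ((j : ℝ≥0) / ((n : ℝ≥0) + 1)) := by
    intro j
    rw [Nat.ceil_le, ← hx.pathInv_le_iff, le_div_iff₀ (by positivity), mul_comm]
  rw [← key k, ← not_le, ← key (k - 1)]
  omega

end Grid

/-! ### The overshoot over a level -/

section Overshoot

/-- The overshoot of a path over the level `r`. -/
def pathOver (p : ℝ≥0 → ℝ) (r : ℝ≥0) : ℝ≥0 := Real.toNNReal (pathEval p (pathInv p r) - r)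

lemma _root_.Measurable.pathOver {A : Type*} [MeasurableSpace A] {f : A → ℝ≥0 → ℝ} {g : A → ℝ≥0}
    (hf : Measurable f) (hg : Measurable g) : Measurable fun a => pathOver (f a) (g a) :=
  ((hf.pathEval (hf.pathInv hg)).sub hg.coe_nnreal_real).real_toNNReal

variable {x : ℝ≥0 → ℝ}

lemma IsGoodPath.pathOver_eq (hx : IsGoodPath x) (r : ℝ≥0) :
    pathOver x r = Real.toNNReal (x (pathInv x r) - r) := by
  rw [pathOver, pathEval_eq (hx.rightCont _)]

lemma IsGoodPath.pathOver_zero (hx : IsGoodPath x) : pathOver x 0 = 0 := by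
  rw [hx.pathOver_eq, hx.pathInv_zero, hx.zero]
  simp

attribute [irreducible] pathOver gridCeil

/-- Grid passage times approach the true passage time from the right, where the path is continuous.
-/
lemma IsGoodPath.tendsto_gridCeil (hx : IsGoodPath x) (r : ℝ≥0) :
    Tendsto (fun n => Real.toNNReal (x (gridCeil n (pathInv x r)) - r)) atTop
      (𝓝 (pathOver x r)) := by
  rw [hx.pathOver_eq]
  refine (continuous_real_toNNReal.tendsto _).comp ?_
  exact ((hx.rightCont _).tendsto.comp (StableProcess.tendsto_gridCeil _)).sub_const _

/-- The inverse is continuous and monotone, so levels decreasing to `r` have passage times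
approaching that of `r` from the right, where the path is continuous. -/
lemma IsGoodPath.continuousWithinAt_pathOver (hx : IsGoodPath x) (r : ℝ≥0) :
    ContinuousWithinAt (pathOver x) (Set.Ici r) r := by
  have h : pathOver x = fun r => Real.toNNReal (x (pathInv x r) - r) := by
    ext1 r; exact hx.pathOver_eq r
  rw [h]
  refine continuous_real_toNNReal.continuousAt.comp_continuousWithinAt ?_
  refine ContinuousWithinAt.sub ?_ (by fun_prop)
  exact (hx.rightCont (pathInv x r)).comp (f := pathInv x)
    hx.continuous_pathInv.continuousWithinAt (fun u hu => hx.pathInv_mono hu)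

end Overshoot

/-! ### The strong Markov property at first passage -/

section StrongMarkov

variable {Ω : Type*} [MeasurableSpace Ω] {P : Measure Ω} [IsProbabilityMeasure P]
  {X : ℝ≥0 → Ω → ℝ} {β : ℝ} {ι : Type*}

/-- The Markov property at the first passage time over `r` on a grid. -/
lemma IsStableSubordinator.lintegral_gridCeil (hX : IsStableSubordinator β X P) (hβ : 0 < β)
    (n : ℕ) (r : ℝ≥0) (t : ι → ℝ≥0) {G : (ι → ℝ≥0) → ℝ≥0∞} (hG : Measurable G) :
    ∫⁻ ω, G (fun i => pathInv (X · ω) (t i + r) - gridCeil n (pathInv (X · ω) r)) ∂P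
      = ∫⁻ ω₂, ∫⁻ ω₁, G (fun i => pathInv (X · ω₁)
          (t i - Real.toNNReal (X (gridCeil n (pathInv (X · ω₂) r)) ω₂ - r))) ∂P ∂P := by
  have hm : ∀ s, Measurable (X s) := hX.levy.measurable
  have hpath : Measurable fun ω s => X s ω := measurable_pi_lambda _ hm
  have hinv : ∀ s, Measurable fun ω => pathInv (X · ω) s := fun s =>
    hpath.pathInv measurable_const
  have hcont : Measurable fun z : (ℝ≥0 → ℝ) × ℝ≥0 => G fun i => pathInv z.1 (t i - z.2) :=
    hG.comp (measurable_pi_lambda _ fun i => measurable_fst.pathInv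
      (measurable_const.sub measurable_snd))
  let A : ℕ → Set Ω := fun k => {ω | ⌈((n : ℝ≥0) + 1) * pathInv (X · ω) r⌉₊ = k}
  have hA : ∀ k, MeasurableSet (A k) := fun k =>
    (Nat.measurable_ceil.comp ((hinv r).const_mul _)) (measurableSet_singleton k)
  have hAd : Pairwise (Function.onFun Disjoint A) := by
    intro i j hij
    rw [Function.onFun, Set.disjoint_left]
    intro ω (h1 : _ = i) (h2 : _ = j)
    exact hij (h1.symm.trans h2)
  have hAu : ⋃ k, A k = Set.univ := Set.eq_univ_of_forall fun ω => Set.mem_iUnion.2 ⟨_, rfl⟩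
  have hsplit : ∀ F : Ω → ℝ≥0∞, ∫⁻ ω, F ω ∂P = ∑' k, ∫⁻ ω in A k, F ω ∂P := by
    intro F
    rw [← lintegral_iUnion hA hAd, hAu, Measure.restrict_univ]
  rw [hsplit, hsplit]
  refine tsum_congr fun k => ?_
  set a : ℝ≥0 := ((k - 1 : ℕ) : ℝ≥0) / ((n : ℝ≥0) + 1) with ha
  set b : ℝ≥0 := (k : ℝ≥0) / ((n : ℝ≥0) + 1) with hb
  have hab : a ≤ b := by
    rw [ha, hb]
    gcongr
    exact Nat.sub_le k 1
  -- For good paths, passage at the grid time `b` is decided by the values at `a` and `b` alone,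
  -- hence is independent of the increments after `b`.
  let S : Set (ℝ × ℝ) := {z | (r : ℝ) ≤ z.2 ∧ (k = 0 ∨ z.1 < r)}
  have hS : MeasurableSet S := by
    have h1 : MeasurableSet {z : ℝ × ℝ | z.1 < r} := measurableSet_lt measurable_fst measurable_const
    exact (measurableSet_le measurable_const measurable_snd).inter
      ((MeasurableSet.const (k = 0)).union h1)
  have hmem : ∀ ω, IsGoodPath (X · ω) → (ω ∈ A k ↔ (X a ω, X b ω) ∈ S) := fun ω hω =>
    hω.ceil_eq_iff n k r
  have hgrid : ∀ ω, ω ∈ A k → gridCeil n (pathInv (X · ω) r) = b := fun ω hω => by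
    rw [gridCeil, (show _ = k from hω)]
  have hind := indepFun_future hm hX.levy.indep hX.levy.zero hab
  have hfut : Measurable fun ω s => X (b + s) ω - X b ω :=
    measurable_pi_lambda _ fun s => (hm _).sub (hm _)
  -- The second argument is the path restarted at `b`: having overshot `r` by `X b - r`, it has to
  -- climb only `t i` minus this overshoot.
  let F : (ℝ × ℝ) × (ℝ≥0 → ℝ) → ℝ≥0∞ := fun z =>
    S.indicator 1 z.1 * G fun i => pathInv z.2 (t i - Real.toNNReal (z.1.2 - r))
  have hF : Measurable F := by
    refine Measurable.mul ((measurable_one.indicator hS).comp measurable_fst) ?_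
    exact hcont.comp (measurable_snd.prodMk (by fun_prop))
  have hgood := hX.ae_isGoodPath hβ
  have e1 : ∫⁻ ω in A k, G (fun i => pathInv (X · ω) (t i + r) - gridCeil n (pathInv (X · ω) r)) ∂P
      = ∫⁻ ω, F ((X a ω, X b ω), fun s => X (b + s) ω - X b ω) ∂P := by
    rw [← lintegral_indicator (hA k)]
    refine lintegral_congr_ae ?_
    filter_upwards [hgood] with ω hω
    by_cases h : ω ∈ A k
    · have h' := (hmem ω hω).1 h
      rw [Set.indicator_of_mem h]
      simp only [F, Set.indicator_of_mem h', Pi.one_apply, one_mul]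
      congr 1
      ext1 i
      have h2 : gridCeil n (pathInv (X · ω) r) = b := hgrid ω h
      have h3 := hω.pathInv_shift b (t i + r)
      rw [h2, ← h3]
      congr 1
      have h4 : (r : ℝ) ≤ X b ω := h'.1
      rw [← NNReal.coe_inj, NNReal.coe_sub_def, Real.coe_toNNReal (X b ω - r) (by linarith),
        Real.coe_toNNReal', NNReal.coe_add]
      congr 1
      ring
    · have h' := fun h' => h ((hmem ω hω).2 h')
      rw [Set.indicator_of_notMem h]
      simp only [F, Set.indicator_of_notMem h', zero_mul]
  rw [e1, lintegral_of_indepFun hind ((hm a).prodMk (hm b)) hfut hF, hX.levy.map_shift b,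
    ← lintegral_indicator (hA k)]
  refine lintegral_congr_ae ?_
  filter_upwards [hgood] with ω hω
  have hF' : Measurable fun v => F ((X a ω, X b ω), v) := hF.comp (by fun_prop)
  rw [lintegral_map hF' hpath]
  by_cases h : ω ∈ A k
  · have h' := (hmem ω hω).1 h
    have h2 : gridCeil n (pathInv (X · ω) r) = b := hgrid ω h
    rw [Set.indicator_of_mem h]
    simp only [F, Set.indicator_of_mem h', Pi.one_apply, one_mul, h2]
  · have h' := fun h' => h ((hmem ω hω).2 h')
    rw [Set.indicator_of_notMem h]
    simp only [F, Set.indicator_of_notMem h', zero_mul, lintegral_zero]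

/-- The strong Markov property at the first passage time over `r`, stated for the inverse
process. -/
theorem IsStableSubordinator.lintegral_pathInv_add [Fintype ι]
    (hX : IsStableSubordinator β X P) (hβ : 0 < β) (r : ℝ≥0) (t : ι → ℝ≥0)
    {G : (ι → ℝ≥0) → ℝ≥0∞} (hG : Measurable G) :
    ∫⁻ ω, G (fun i => pathInv (X · ω) (t i + r) - pathInv (X · ω) r) ∂P
      = ∫⁻ ω₂, ∫⁻ ω₁, G (fun i => pathInv (X · ω₁) (t i - pathOver (X · ω₂) r)) ∂P ∂P := by
  have hm : ∀ s, Measurable (X s) := hX.levy.measurable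
  have hpath : Measurable fun ω s => X s ω := measurable_pi_lambda _ hm
  have hinv : ∀ s, Measurable fun ω => pathInv (X · ω) s := fun s =>
    hpath.pathInv measurable_const
  have hover : Measurable fun ω => pathOver (X · ω) r :=
    hpath.pathOver measurable_const
  have hm1 : Measurable fun ω i => pathInv (X · ω) (t i + r) - pathInv (X · ω) r :=
    measurable_pi_lambda _ fun i => (hinv _).sub (hinv _)
  have hm2 : Measurable fun z : Ω × Ω =>
      fun i => pathInv (X · z.2) (t i - pathOver (X · z.1) r) :=
    measurable_pi_lambda _ fun i => (hpath.comp measurable_snd).pathInv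
      (measurable_const.sub (hover.comp measurable_fst))
  have hgood := hX.ae_isGoodPath hβ
  -- Stated as equality of two laws, the claim can be tested on bounded continuous functions only;
  -- continuity is what lets the mesh of the grid tend to zero.
  suffices h : P.map (fun ω i => pathInv (X · ω) (t i + r) - pathInv (X · ω) r)
      = (P.prod P).map (fun z i => pathInv (X · z.2) (t i - pathOver (X · z.1) r)) by
    rw [← lintegral_map hG hm1, h, lintegral_map hG hm2,
      lintegral_prod (fun z : Ω × Ω => G _) (hG.comp hm2).aemeasurable]
  refine ext_of_forall_lintegral_eq_of_IsFiniteMeasure fun f => ?_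
  have hf : Measurable fun x => (f x : ℝ≥0∞) := f.continuous.measurable.coe_nnreal_ennreal
  have hfc : Continuous fun x => (f x : ℝ≥0∞) := ENNReal.continuous_coe.comp f.continuous
  obtain ⟨C, hC⟩ : ∃ C : ℝ≥0, ∀ x, f x ≤ C := ⟨nndist f 0, fun x => by
    have := f.dist_coe_le_dist (g := 0) x
    rw [← NNReal.coe_le_coe]
    simpa [NNReal.dist_eq] using this⟩
  rw [lintegral_map hf hm1, lintegral_map hf hm2,
    lintegral_prod (fun z : Ω × Ω => (f _ : ℝ≥0∞)) (hf.comp hm2).aemeasurable]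
  have hbound : ∀ x, (f x : ℝ≥0∞) ≤ C := fun x => by exact_mod_cast hC x
  have hCfin : ∫⁻ _, (C : ℝ≥0∞) ∂P ≠ ∞ := by simp
  have hlim1 : Tendsto (fun n => ∫⁻ ω, (f fun i => pathInv (X · ω) (t i + r)
      - gridCeil n (pathInv (X · ω) r) : ℝ≥0∞) ∂P) atTop
      (𝓝 (∫⁻ ω, (f fun i => pathInv (X · ω) (t i + r) - pathInv (X · ω) r : ℝ≥0∞) ∂P)) := by
    refine tendsto_lintegral_of_dominated_convergence (fun _ => C) (fun n => ?_)
      (fun n => ae_of_all _ fun ω => hbound _) hCfin (ae_of_all _ fun ω => ?_)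
    · exact hf.comp (measurable_pi_lambda _ fun i =>
        (hinv _).sub ((measurable_gridCeil n).comp (hinv _)))
    · refine (hfc.tendsto _).comp (tendsto_pi_nhds.2 fun i => ?_)
      exact ((tendsto_gridCeil _).mono_right nhdsWithin_le_nhds).const_sub _
  have hlim2 : Tendsto (fun n => ∫⁻ ω₂, ∫⁻ ω₁, (f fun i => pathInv (X · ω₁)
      (t i - Real.toNNReal (X (gridCeil n (pathInv (X · ω₂) r)) ω₂ - r)) : ℝ≥0∞) ∂P ∂P) atTop
      (𝓝 (∫⁻ ω₂, ∫⁻ ω₁, (f fun i => pathInv (X · ω₁)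
        (t i - pathOver (X · ω₂) r) : ℝ≥0∞) ∂P ∂P)) := by
    refine tendsto_lintegral_of_dominated_convergence (fun _ => C) (fun n => ?_)
      (fun n => ae_of_all _ fun ω => ?_) hCfin ?_
    · have h1 : Measurable fun ω => X (gridCeil n (pathInv (X · ω) r)) ω :=
        (measurable_eval_gridCeil n).comp (hpath.prodMk (hinv r))
      have h2 : Measurable fun z : Ω × Ω => fun i => pathInv (X · z.2)
          (t i - Real.toNNReal (X (gridCeil n (pathInv (X · z.1) r)) z.1 - r)) :=
        measurable_pi_lambda _ fun i => (hpath.comp measurable_snd).pathInv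
          (measurable_const.sub ((h1.sub_const _).real_toNNReal.comp measurable_fst))
      exact (hf.comp h2).lintegral_prod_right'
    · refine (lintegral_mono fun ω₁ => hbound _).trans ?_
      simp
    · filter_upwards [hgood] with ω₂ hω₂
      refine tendsto_lintegral_of_dominated_convergence (fun _ => C) (fun n => ?_)
        (fun n => ae_of_all _ fun ω => hbound _) hCfin ?_
      · exact hf.comp (measurable_pi_lambda _ fun i => hinv _)
      · filter_upwards [hgood] with ω₁ hω₁
        refine (hfc.tendsto _).comp (tendsto_pi_nhds.2 fun i => ?_)
        exact (hω₁.continuous_pathInv.tendsto _).comp ((hω₂.tendsto_gridCeil r).const_sub _)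
  refine tendsto_nhds_unique hlim1 (hlim2.congr fun n => ?_)
  exact (hX.lintegral_gridCeil hβ n r t hf).symm

end StrongMarkov

/-! ### Lebesgue measure and `ν_β` on the half-line -/

section HalfLine

/-- Lebesgue measure on `[0, ∞)`. -/
def leb : Measure ℝ≥0 := ((volume : Measure ℝ).restrict (Set.Ioi 0)).map Real.toNNReal

instance : SFinite leb := by unfold leb; infer_instance

lemma lintegral_leb {g : ℝ≥0 → ℝ≥0∞} (hg : Measurable g) :
    ∫⁻ x, g x ∂leb = ∫⁻ x in Set.Ioi (0 : ℝ), g (Real.toNNReal x) :=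
  lintegral_map hg measurable_real_toNNReal

lemma lintegral_leb_split {g : ℝ≥0 → ℝ≥0∞} (hg : Measurable g) (a : ℝ≥0) :
    ∫⁻ x, g x ∂leb
      = (∫⁻ x in Set.Ioc (0 : ℝ) a, g (Real.toNNReal x)) + ∫⁻ x, g (a + x) ∂leb := by
  have hu : Set.Ioi (0 : ℝ) = Set.Ioc 0 (a : ℝ) ∪ Set.Ioi (a : ℝ) :=
    (Set.Ioc_union_Ioi_eq_Ioi a.coe_nonneg).symm
  rw [lintegral_leb hg, lintegral_leb (g := fun x => g (a + x)) (hg.comp (measurable_const_add a))]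
  conv_lhs => rw [hu, lintegral_union measurableSet_Ioi
    (Set.disjoint_left.2 fun x hx hx' => not_lt.2 hx.2 hx')]
  congr 1
  rw [← lintegral_indicator measurableSet_Ioi, ← lintegral_indicator measurableSet_Ioi,
    ← lintegral_add_left_eq_self _ (a : ℝ)]
  refine lintegral_congr fun x => ?_
  by_cases hx : 0 < x
  · rw [Set.indicator_of_mem (by simpa using hx), Set.indicator_of_mem (by simpa using hx)]
    congr 1
    rw [Real.toNNReal_add a.coe_nonneg hx.le, Real.toNNReal_coe]
  · rw [Set.indicator_of_notMem (by simpa using hx), Set.indicator_of_notMem (by simpa using hx)]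

lemma lintegral_leb_mul {g : ℝ≥0 → ℝ≥0∞} (hg : Measurable g) {c : ℝ≥0} (hc : 0 < c) :
    ∫⁻ x, g x ∂leb = c * ∫⁻ x, g (c * x) ∂leb := by
  have hc' : (0 : ℝ) < c := by exact_mod_cast hc
  rw [lintegral_leb hg, lintegral_leb (g := fun x => g (c * x)) (hg.comp (measurable_const_mul c)),
    ← lintegral_indicator measurableSet_Ioi, ← lintegral_indicator measurableSet_Ioi]
  have hG : Measurable ((Set.Ioi (0 : ℝ)).indicator fun x => g (Real.toNNReal x)) :=
    (hg.comp measurable_real_toNNReal).indicator measurableSet_Ioi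
  have h1 := lintegral_map (μ := volume) hG (measurable_const_mul (c : ℝ))
  rw [Real.map_volume_mul_left hc'.ne', lintegral_smul_measure] at h1
  have h2 : ∀ x : ℝ, (Set.Ioi (0 : ℝ)).indicator (fun x => g (Real.toNNReal x)) (c * x)
      = (Set.Ioi (0 : ℝ)).indicator (fun x => g (c * Real.toNNReal x)) x := by
    intro x
    by_cases hx : 0 < x
    · rw [Set.indicator_of_mem (by simpa [hc] using hx), Set.indicator_of_mem (by simpa using hx),
        Real.toNNReal_mul hc'.le, Real.toNNReal_coe]
    · rw [Set.indicator_of_notMem (by simpa [hc] using hx),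
        Set.indicator_of_notMem (by simpa using hx)]
  simp only [h2] at h1
  rw [← h1, smul_eq_mul, ← mul_assoc, abs_of_pos (inv_pos.2 hc'), ← ENNReal.ofReal_coe_nnreal,
    ← ENNReal.ofReal_mul hc'.le, mul_inv_cancel₀ hc'.ne', ENNReal.ofReal_one, one_mul]

lemma lintegral_exp_leb {q : ℝ} (hq : 0 < q) :
    ∫⁻ x, ENNReal.ofReal (Real.exp (-(q * x))) ∂leb = ENNReal.ofReal q⁻¹ := by
  rw [lintegral_leb (by fun_prop)]
  have h1 : ∫⁻ x in Set.Ioi (0 : ℝ), ENNReal.ofReal (Real.exp (-(q * (Real.toNNReal x : ℝ))))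
      = ∫⁻ x in Set.Ioi (0 : ℝ), ENNReal.ofReal (Real.exp (-q * x)) := by
    refine setLIntegral_congr_fun measurableSet_Ioi fun x (hx : 0 < x) => ?_
    rw [Real.coe_toNNReal _ hx.le, neg_mul]
  rw [h1, ← ofReal_integral_eq_lintegral_ofReal (integrableOn_exp_mul_Ioi (by linarith) 0)
    (ae_of_all _ fun x => (Real.exp_pos _).le), integral_exp_mul_Ioi (by linarith) 0]
  congr 1
  simp

lemma leb_Ico_pos (s : ℝ≥0) {u : ℝ≥0} (h : s < u) : 0 < leb (Set.Ico s u) := by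
  rw [leb, Measure.map_apply measurable_real_toNNReal measurableSet_Ico,
    Measure.restrict_apply (measurable_real_toNNReal measurableSet_Ico)]
  refine lt_of_lt_of_le ?_ (measure_mono (s := Set.Ioo (s : ℝ) u) fun x hx => ?_)
  · simpa using h
  · have h0 : 0 < x := lt_of_le_of_lt s.2 hx.1
    refine ⟨⟨?_, ?_⟩, h0⟩
    · exact (Real.le_toNNReal_iff_coe_le h0.le).2 hx.1.le
    · exact (Real.toNNReal_lt_iff_lt_coe h0.le).2 hx.2

lemma lintegral_nu {β : ℝ} (hβ : β ≠ 1) {g : ℝ≥0 → ℝ≥0∞} (hg : Measurable g) :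
    ∫⁻ x, g x ∂(nu β) = ∫⁻ x, ENNReal.ofReal ((1 - β) * (x : ℝ) ^ (-β)) * g x ∂leb := by
  have hw : Measurable fun x : ℝ => ENNReal.ofReal ((1 - β) * x ^ (-β)) := by fun_prop
  rw [nu, if_neg hβ, lintegral_map hg measurable_real_toNNReal,
    lintegral_withDensity_eq_lintegral_mul _ hw (g := fun x => g (Real.toNNReal x))
      (hg.comp measurable_real_toNNReal),
    lintegral_leb (by fun_prop), restrict_Ioi_eq_restrict_Ici]
  refine setLIntegral_congr_fun measurableSet_Ici fun x (hx : 0 ≤ x) => ?_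
  simp only [Pi.mul_apply]
  rw [Real.coe_toNNReal _ hx]

instance (β : ℝ) : SFinite (nu β) := by
  unfold nu
  split_ifs <;> infer_instance

/-- The Laplace transform of `ν_β`. -/
lemma lintegral_exp_nu {β : ℝ} (hβ : β < 1) {q : ℝ} (hq : 0 < q) :
    ∫⁻ x, ENNReal.ofReal (Real.exp (-(q * x))) ∂(nu β)
      = ENNReal.ofReal ((1 - β) * Real.Gamma (1 - β) * q ^ (β - 1)) := by
  rw [lintegral_nu hβ.ne (by fun_prop), lintegral_leb (by fun_prop)]
  have hG := Real.integral_rpow_mul_exp_neg_mul_Ioi (a := 1 - β) (by linarith) hq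
  have hpos : 0 < (1 / q) ^ (1 - β) * Real.Gamma (1 - β) :=
    mul_pos (by positivity) (Real.Gamma_pos_of_pos (by linarith))
  -- The Gamma integral is positive, while a non-integrable function would have integral `0`.
  have hint : IntegrableOn (fun t : ℝ => t ^ (1 - β - 1) * Real.exp (-(q * t))) (Set.Ioi 0) := by
    by_contra h
    rw [integral_undef h] at hG
    exact hpos.ne hG
  have h1 : ∫⁻ x in Set.Ioi (0 : ℝ), ENNReal.ofReal ((1 - β) * ((Real.toNNReal x : ℝ≥0) : ℝ) ^ (-β))
        * ENNReal.ofReal (Real.exp (-(q * ((Real.toNNReal x : ℝ≥0) : ℝ))))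
      = ∫⁻ x in Set.Ioi (0 : ℝ),
        ENNReal.ofReal ((1 - β) * (x ^ (1 - β - 1) * Real.exp (-(q * x)))) := by
    refine setLIntegral_congr_fun measurableSet_Ioi fun x (hx : 0 < x) => ?_
    rw [Real.coe_toNNReal _ hx.le, ← ENNReal.ofReal_mul
      (mul_nonneg (by linarith) (by positivity)), mul_assoc]
    congr 4
    ring
  rw [h1, ← ofReal_integral_eq_lintegral_ofReal (hint.const_mul _), integral_const_mul, hG]
  · congr 1
    rw [one_div, Real.inv_rpow hq.le, ← Real.rpow_neg hq.le, neg_sub]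
    ring
  · filter_upwards [ae_restrict_mem measurableSet_Ioi] with x (hx : 0 < x)
    exact mul_nonneg (by linarith) (by positivity)

/-- The contribution of the levels `r` that the path crosses in one grid step from `a` to `b`:
discount `exp (-q r)` and overshoot `b - r`. -/
lemma lintegral_exp_Ioc {q l : ℝ} (hql : l < q) {a b : ℝ} (hab : a ≤ b) :
    ∫⁻ r in Set.Ioc a b, ENNReal.ofReal (Real.exp (-(q * r)) * Real.exp (-(l * (b - r))))
      = ENNReal.ofReal
        (Real.exp (-(q * a)) * ((Real.exp (-(l * (b - a))) - Real.exp (-(q * (b - a)))) / (q - l))) := by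
  have hne : q - l ≠ 0 := by linarith
  have hderiv : ∀ r ∈ Set.uIcc a b, HasDerivAt
      (fun r => -(Real.exp (-(q * r)) * Real.exp (-(l * (b - r))) / (q - l)))
      (Real.exp (-(q * r)) * Real.exp (-(l * (b - r)))) r := by
    intro r _
    have h1 : HasDerivAt (fun r => Real.exp (-(q * r))) (Real.exp (-(q * r)) * (-q)) r := by
      have := ((hasDerivAt_id r).const_mul q).neg.exp
      simpa using this
    have h2 : HasDerivAt (fun r => Real.exp (-(l * (b - r)))) (Real.exp (-(l * (b - r))) * l) r := by
      have := (((hasDerivAt_id r).const_sub b).const_mul l).neg.exp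
      simpa using this
    convert! ((h1.mul h2).div_const (q - l)).neg using 1
    field_simp
    ring
  have hcont : Continuous fun r => Real.exp (-(q * r)) * Real.exp (-(l * (b - r))) := by fun_prop
  have hint := intervalIntegral.integral_eq_sub_of_hasDerivAt hderiv
    (hcont.intervalIntegrable a b)
  rw [← ofReal_integral_eq_lintegral_ofReal (hcont.integrableOn_Ioc) (ae_of_all _ fun r => by
    positivity), ← intervalIntegral.integral_of_le hab, hint]
  congr 1
  have e1 : Real.exp (-(q * b)) = Real.exp (-(q * a)) * Real.exp (-(q * (b - a))) := by
    rw [← Real.exp_add]; congr 1; ring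
  simp only [sub_self, mul_zero, neg_zero, Real.exp_zero, mul_one, e1]
  ring

end HalfLine

/-! ### The double Laplace transform of the overshoot -/

section OvershootLaplace

lemma measurable_path_gridCeil (x : ℝ≥0 → ℝ) (n : ℕ) :
    Measurable fun r : ℝ≥0 => x (gridCeil n (pathInv x r)) := by
  have h : Measurable fun r : ℝ≥0 => (x, pathInv x r) :=
    measurable_const.prodMk (measurable_const.pathInv measurable_id)
  exact (measurable_eval_gridCeil n).comp h

lemma measurable_exp_toNNReal_sub {A : Type*} [MeasurableSpace A] {f : A → ℝ} {g : A → ℝ≥0}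
    (hf : Measurable f) (hg : Measurable g) (l : ℝ) :
    Measurable fun a => ENNReal.ofReal (Real.exp (-(l * (Real.toNNReal (f a - g a) : ℝ≥0)))) := by
  fun_prop

/-- The Laplace transform in the level of the overshoot on a grid. -/
lemma IsGoodPath.lintegral_gridCeil {x : ℝ≥0 → ℝ} (hx : IsGoodPath x) (n : ℕ) {q l : ℝ}
    (hql : l < q) :
    ∫⁻ r, ENNReal.ofReal (Real.exp (-(q * r))) * ENNReal.ofReal (Real.exp
        (-(l * (Real.toNNReal (x (gridCeil n (pathInv x r)) - r) : ℝ≥0)))) ∂leb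
      = ∑' k : ℕ, ENNReal.ofReal (Real.exp (-(q * x ((k : ℝ≥0) / ((n : ℝ≥0) + 1)))))
        * ENNReal.ofReal ((Real.exp (-(l * (x (((k + 1 : ℕ) : ℝ≥0) / ((n : ℝ≥0) + 1))
            - x ((k : ℝ≥0) / ((n : ℝ≥0) + 1)))))
          - Real.exp (-(q * (x (((k + 1 : ℕ) : ℝ≥0) / ((n : ℝ≥0) + 1))
            - x ((k : ℝ≥0) / ((n : ℝ≥0) + 1)))))) / (q - l)) := by
  set y : ℕ → ℝ := fun k => x ((k : ℝ≥0) / ((n : ℝ≥0) + 1)) with hy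
  have hmono : Monotone y := fun a b hab => hx.strictMono.monotone (by gcongr)
  have hmeas := measurable_path_gridCeil x n
  rw [lintegral_leb (by
    exact Measurable.mul (by fun_prop) (measurable_exp_toNNReal_sub hmeas measurable_id l))]
  -- The ranges of the grid steps tile the positive levels; levels in the `k`-th range are first
  -- passed on the grid at index `k + 1`, with overshoot `y (k + 1) - r`.
  have hU : Set.Ioi (0 : ℝ) = ⋃ k, Set.Ioc (y k) (y (k + 1)) := by
    ext r
    simp only [Set.mem_Ioi, Set.mem_iUnion, Set.mem_Ioc]
    constructor
    · intro hr
      have h := (hx.ceil_eq_iff n _ (Real.toNNReal r)).1 rfl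
      rw [Real.coe_toNNReal _ hr.le] at h
      set k := ⌈((n : ℝ≥0) + 1) * pathInv x (Real.toNNReal r)⌉₊
      have hk : k ≠ 0 := by
        intro hk
        rw [hk] at h
        have h1 := h.1
        simp only [Nat.cast_zero, zero_div, hx.zero] at h1
        linarith
      refine ⟨k - 1, ?_, ?_⟩
      · exact h.2.resolve_left hk
      · rw [Nat.sub_add_cancel (Nat.one_le_iff_ne_zero.2 hk)]
        exact h.1
    · rintro ⟨k, h1, -⟩
      exact (hx.nonneg _).trans_lt h1
  have hdisj : Pairwise (Function.onFun Disjoint fun k => Set.Ioc (y k) (y (k + 1))) :=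
    hmono.pairwise_disjoint_on_Ioc_succ
  rw [hU, lintegral_iUnion (fun k => measurableSet_Ioc) hdisj]
  refine tsum_congr fun k => ?_
  rw [← ENNReal.ofReal_mul (Real.exp_pos _).le]
  have h := lintegral_exp_Ioc hql (hmono k.le_succ)
  rw [← h]
  refine setLIntegral_congr_fun measurableSet_Ioc fun r hr => ?_
  have hr0 : 0 ≤ r := (hx.nonneg _).trans hr.1.le
  have hceil : ⌈((n : ℝ≥0) + 1) * pathInv x (Real.toNNReal r)⌉₊ = k + 1 := by
    rw [hx.ceil_eq_iff, Real.coe_toNNReal _ hr0]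
    exact ⟨hr.2, Or.inr hr.1⟩
  have hgrid : gridCeil n (pathInv x (Real.toNNReal r))
      = ((k + 1 : ℕ) : ℝ≥0) / ((n : ℝ≥0) + 1) := by
    rw [gridCeil, hceil]
  have hle : 0 ≤ y (k + 1) - r := by linarith [hr.2]
  rw [hgrid, ← ENNReal.ofReal_mul (Real.exp_pos _).le, Real.coe_toNNReal _ hr0]
  change ENNReal.ofReal (_ * Real.exp (-(l * (Real.toNNReal (y (k + 1) - r) : ℝ≥0)))) = _
  rw [Real.coe_toNNReal _ hle]

/-- With mesh `d → 0`, numerator and denominator divided by `d` tend to derivatives at `0`. -/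
lemma tendsto_overshoot_const {Q L c : ℝ} (hQ : 0 < Q) :
    Tendsto (fun n : ℕ => ENNReal.ofReal ((Real.exp (-(((1 / ((n : ℝ≥0) + 1) : ℝ≥0) : ℝ) * L))
      - Real.exp (-(((1 / ((n : ℝ≥0) + 1) : ℝ≥0) : ℝ) * Q))) / c
      / (1 - Real.exp (-(((1 / ((n : ℝ≥0) + 1) : ℝ≥0) : ℝ) * Q))))) atTop
      (𝓝 (ENNReal.ofReal ((Q - L) / c / Q))) := by
  refine ENNReal.tendsto_ofReal ?_
  have hslope : ∀ K : ℝ, Tendsto (fun d : ℝ => d⁻¹ * (1 - Real.exp (-(d * K)))) (𝓝[≠] 0)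
      (𝓝 K) := by
    intro K
    have h : HasDerivAt (fun d : ℝ => 1 - Real.exp (-(d * K))) K 0 := by
      have h1 : HasDerivAt (fun d : ℝ => -(d * K)) (-K) 0 := by
        have h0 := ((hasDerivAt_id' (0 : ℝ)).mul_const K).fun_neg
        rwa [one_mul] at h0
      simpa using (h1.exp).const_sub 1
    have := hasDerivAt_iff_tendsto_slope.1 h
    refine this.congr fun d => ?_
    simp [slope_def_field, div_eq_inv_mul]
  have hd : Tendsto (fun n : ℕ => ((1 / ((n : ℝ≥0) + 1) : ℝ≥0) : ℝ)) atTop (𝓝[≠] 0) := by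
    refine tendsto_nhdsWithin_iff.2 ⟨?_, Eventually.of_forall fun n => ?_⟩
    · simpa using NNReal.tendsto_coe.2 tendsto_one_div_add_one
    · have : (0 : ℝ≥0) < 1 / ((n : ℝ≥0) + 1) := by positivity
      exact (NNReal.coe_pos.2 this).ne'
  have h1 := (hslope Q).comp hd
  have h2 := (hslope L).comp hd
  have h3 := ((h1.sub h2).div_const c).div h1 hQ.ne'
  refine h3.congr fun n => ?_
  have hpos : (0 : ℝ) < ((1 / ((n : ℝ≥0) + 1) : ℝ≥0) : ℝ) := by
    have : (0 : ℝ≥0) < 1 / ((n : ℝ≥0) + 1) := by positivity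
    exact_mod_cast this
  simp only [Pi.div_apply, Function.comp]
  set d : ℝ := ((1 / ((n : ℝ≥0) + 1) : ℝ≥0) : ℝ)
  rw [show (d⁻¹ * (1 - Real.exp (-(d * Q))) - d⁻¹ * (1 - Real.exp (-(d * L)))) / c
      = d⁻¹ * ((Real.exp (-(d * L)) - Real.exp (-(d * Q))) / c) by ring,
    mul_div_mul_left _ _ (inv_ne_zero hpos.ne')]

variable {Ω : Type*} [MeasurableSpace Ω] {P : Measure Ω} [IsProbabilityMeasure P]
  {X : ℝ≥0 → Ω → ℝ} {β : ℝ}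

/-- In the sum over grid steps the value at the start of a step is independent of the increment. The
starts contribute the geometric series with ratio `exp (-d q^β)`, the increment a factor independent
of the step. -/
lemma IsStableSubordinator.lintegral_gridCeil_exp (hX : IsStableSubordinator β X P) (hβ : 0 < β)
    (n : ℕ) {q l : ℝ} (hl : 0 < l) (hql : l < q) :
    ∫⁻ r, ENNReal.ofReal (Real.exp (-(q * r))) * ∫⁻ ω, ENNReal.ofReal (Real.exp
        (-(l * (Real.toNNReal (X (gridCeil n (pathInv (X · ω) r)) ω - r) : ℝ≥0)))) ∂P ∂leb
      = ENNReal.ofReal ((Real.exp (-(((1 / ((n : ℝ≥0) + 1) : ℝ≥0) : ℝ) * l ^ β))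
        - Real.exp (-(((1 / ((n : ℝ≥0) + 1) : ℝ≥0) : ℝ) * q ^ β))) / (q - l)
        / (1 - Real.exp (-(((1 / ((n : ℝ≥0) + 1) : ℝ≥0) : ℝ) * q ^ β)))) := by
  have hq : 0 < q := hl.trans hql
  have hm : ∀ s, Measurable (X s) := hX.levy.measurable
  have hpath : Measurable fun ω s => X s ω := measurable_pi_lambda _ hm
  set d : ℝ≥0 := 1 / ((n : ℝ≥0) + 1) with hd
  have hdpos : (0 : ℝ) < d := NNReal.coe_pos.2 (by rw [hd]; positivity)
  have hjoint : Measurable fun z : ℝ≥0 × Ω =>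
      X (gridCeil n (pathInv (X · z.2) z.1)) z.2 := by
    have h : Measurable fun z : ℝ≥0 × Ω => ((X · z.2), pathInv (X · z.2) z.1) :=
      (hpath.comp measurable_snd).prodMk ((hpath.comp measurable_snd).pathInv measurable_fst)
    exact (measurable_eval_gridCeil n).comp h
  simp only [← lintegral_const_mul' _ _ ENNReal.ofReal_ne_top]
  rw [lintegral_lintegral_swap (by
    exact (Measurable.mul (by fun_prop)
      (measurable_exp_toNNReal_sub hjoint measurable_fst l)).aemeasurable)]
  have e1 : ∀ᵐ ω ∂P, ∫⁻ r, ENNReal.ofReal (Real.exp (-(q * r))) * ENNReal.ofReal (Real.exp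
        (-(l * (Real.toNNReal (X (gridCeil n (pathInv (X · ω) r)) ω - r) : ℝ≥0)))) ∂leb
      = ∑' k : ℕ, ENNReal.ofReal (Real.exp (-(q * X ((k : ℝ≥0) / ((n : ℝ≥0) + 1)) ω)))
        * ENNReal.ofReal ((Real.exp (-(l * (X (((k + 1 : ℕ) : ℝ≥0) / ((n : ℝ≥0) + 1)) ω
            - X ((k : ℝ≥0) / ((n : ℝ≥0) + 1)) ω)))
          - Real.exp (-(q * (X (((k + 1 : ℕ) : ℝ≥0) / ((n : ℝ≥0) + 1)) ω
            - X ((k : ℝ≥0) / ((n : ℝ≥0) + 1)) ω)))) / (q - l)) := by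
    filter_upwards [hX.ae_isGoodPath hβ] with ω hω
    exact hω.lintegral_gridCeil n hql
  rw [lintegral_congr_ae e1, lintegral_tsum (fun k => by
    have := hm ((k : ℝ≥0) / ((n : ℝ≥0) + 1))
    have := hm (((k + 1 : ℕ) : ℝ≥0) / ((n : ℝ≥0) + 1))
    fun_prop)]
  have hQ : 0 < q ^ β := by positivity
  have hLQ : l ^ β ≤ q ^ β := Real.rpow_le_rpow hl.le hql.le hβ.le
  have hterm : ∀ k : ℕ, ∫⁻ ω, ENNReal.ofReal (Real.exp (-(q * X ((k : ℝ≥0) / ((n : ℝ≥0) + 1)) ω)))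
        * ENNReal.ofReal ((Real.exp (-(l * (X (((k + 1 : ℕ) : ℝ≥0) / ((n : ℝ≥0) + 1)) ω
            - X ((k : ℝ≥0) / ((n : ℝ≥0) + 1)) ω)))
          - Real.exp (-(q * (X (((k + 1 : ℕ) : ℝ≥0) / ((n : ℝ≥0) + 1)) ω
            - X ((k : ℝ≥0) / ((n : ℝ≥0) + 1)) ω)))) / (q - l)) ∂P
      = ENNReal.ofReal (Real.exp (-(d * q ^ β))) ^ k * ENNReal.ofReal
        ((Real.exp (-(d * l ^ β)) - Real.exp (-(d * q ^ β))) / (q - l)) := by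
    intro k
    set a : ℝ≥0 := (k : ℝ≥0) / ((n : ℝ≥0) + 1) with ha
    set b : ℝ≥0 := ((k + 1 : ℕ) : ℝ≥0) / ((n : ℝ≥0) + 1) with hb
    have hab : a ≤ b := by rw [ha, hb]; gcongr; simp
    have hba : b - a = d := by
      rw [ha, hb, hd]
      refine tsub_eq_of_eq_add ?_
      push_cast
      ring
    have hind := hX.levy.indep.indepFun_eval_sub zero_le hab hX.levy.zero
    have hma := hm a
    have hmb := hm b
    have hφ : Measurable fun x : ℝ => ENNReal.ofReal (Real.exp (-(q * x))) := by fun_prop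
    have hψ : Measurable fun x : ℝ => ENNReal.ofReal
      ((Real.exp (-(l * x)) - Real.exp (-(q * x))) / (q - l)) := by fun_prop
    have hprod := lintegral_mul_eq_lintegral_mul_lintegral_of_indepFun
      (hφ.comp hma) (hψ.comp (hmb.sub hma)) (hind.comp hφ hψ)
    simp only [Pi.mul_apply, Function.comp, Pi.sub_apply] at hprod
    rw [hprod, hX.lintegral_exp a hq.le]
    congr 1
    · rw [← ENNReal.ofReal_pow (Real.exp_pos _).le, ← Real.exp_nat_mul, ha, hd]
      congr 2
      push_cast
      ring
    · have hlaw := hX.levy.map_sub hab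
      rw [hba] at hlaw
      have h1 := lintegral_map (μ := P) hψ (hmb.sub hma)
      have h2 := lintegral_map (μ := P) hψ (hm d)
      have hlaw' : P.map (X b - X a) = P.map (X d) := hlaw
      rw [hlaw'] at h1
      simp only [Pi.sub_apply] at h1
      rw [← h1, h2, ← ofReal_integral_eq_lintegral_ofReal, integral_div, integral_sub
        (hX.integrable_exp d hl.le) (hX.integrable_exp d hq.le), hX.laplace d l hl.le,
        hX.laplace d q hq.le]
      · exact ((hX.integrable_exp d hl.le).sub (hX.integrable_exp d hq.le)).div_const _
      · filter_upwards [hX.ae_isGoodPath hβ] with ω hω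
        have h0 : 0 ≤ X d ω := hω.nonneg d
        refine div_nonneg (sub_nonneg.2 (Real.exp_le_exp.2 ?_)) (by linarith)
        nlinarith
  simp only [hterm]
  rw [ENNReal.tsum_mul_right, ENNReal.tsum_geometric]
  have hlt : Real.exp (-(d * q ^ β)) < 1 := by
    rw [Real.exp_lt_one_iff]
    have := mul_pos hdpos hQ
    linarith
  rw [show (1 : ℝ≥0∞) = ENNReal.ofReal 1 by simp, ← ENNReal.ofReal_sub _ (Real.exp_pos _).le,
    ← ENNReal.ofReal_inv_of_pos (by linarith), ← ENNReal.ofReal_mul (by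
      rw [inv_nonneg]; linarith)]
  congr 1
  rw [mul_comm, div_eq_mul_inv _ (1 - Real.exp (-(d * q ^ β)))]

/-- The double Laplace transform of the overshoot of a stable subordinator. -/
lemma IsStableSubordinator.lintegral_pathOver_exp (hX : IsStableSubordinator β X P) (hβ : 0 < β)
    {q l : ℝ} (hl : 0 < l) (hql : l < q) :
    ∫⁻ r, ENNReal.ofReal (Real.exp (-(q * r))) * ∫⁻ ω, ENNReal.ofReal (Real.exp
        (-(l * pathOver (X · ω) r))) ∂P ∂leb
      = ENNReal.ofReal ((q ^ β - l ^ β) / (q - l) / q ^ β) := by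
  have hq : 0 < q := hl.trans hql
  have hm : ∀ s, Measurable (X s) := hX.levy.measurable
  have hpath : Measurable fun ω s => X s ω := measurable_pi_lambda _ hm
  have hlim := tendsto_overshoot_const (Q := q ^ β) (L := l ^ β) (c := q - l) (by positivity)
  refine tendsto_nhds_unique ?_ hlim
  simp only [← hX.lintegral_gridCeil_exp hβ _ hl hql]
  have hle : ∀ y : ℝ≥0, ENNReal.ofReal (Real.exp (-(l * y))) ≤ 1 := fun y => by
    rw [ENNReal.ofReal_le_one, Real.exp_le_one_iff]
    have : 0 ≤ l * y := by positivity
    linarith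
  refine tendsto_lintegral_of_dominated_convergence
    (fun r => ENNReal.ofReal (Real.exp (-(q * r)))) (fun n => ?_)
    (fun n => ae_of_all _ fun r => ?_) ?_ (ae_of_all _ fun r => ?_)
  · have hjoint : Measurable fun z : ℝ≥0 × Ω =>
        X (gridCeil n (pathInv (X · z.2) z.1)) z.2 := by
      have h : Measurable fun z : ℝ≥0 × Ω => ((X · z.2), pathInv (X · z.2) z.1) :=
        (hpath.comp measurable_snd).prodMk ((hpath.comp measurable_snd).pathInv measurable_fst)
      exact (measurable_eval_gridCeil n).comp h
    refine Measurable.mul (by fun_prop) ?_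
    have h2 : Measurable fun z : ℝ≥0 × Ω => ENNReal.ofReal (Real.exp
        (-(l * (Real.toNNReal (X (gridCeil n (pathInv (X · z.2) z.1)) z.2 - z.1) : ℝ≥0)))) :=
      measurable_exp_toNNReal_sub hjoint measurable_fst l
    exact h2.lintegral_prod_right'
  · refine mul_le_of_le_one_right' ?_
    refine (lintegral_mono fun ω => hle _).trans ?_
    simp
  · rw [lintegral_exp_leb hq]
    exact ENNReal.ofReal_ne_top
  · refine ENNReal.Tendsto.const_mul ?_ (Or.inr ENNReal.ofReal_ne_top)
    refine tendsto_lintegral_of_dominated_convergence (fun _ => 1) (fun n => ?_)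
      (fun n => ae_of_all _ fun ω => hle _) (by simp) ?_
    · have h1 : Measurable fun ω => X (gridCeil n (pathInv (X · ω) r)) ω :=
        (measurable_eval_gridCeil n).comp (hpath.prodMk (hpath.pathInv measurable_const))
      exact measurable_exp_toNNReal_sub h1 measurable_const l
    · filter_upwards [hX.ae_isGoodPath hβ] with ω hω
      have hc : Continuous fun y : ℝ≥0 => ENNReal.ofReal (Real.exp (-(l * y))) :=
        ENNReal.continuous_ofReal.comp (by fun_prop)
      exact (hc.tendsto _).comp (hω.tendsto_gridCeil r)

end OvershootLaplace

/-! ### Invariance of `ν_β` for the residual time -/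

section Invariance

lemma ae_eq_of_laplace {f g : ℝ≥0 → ℝ≥0∞} (hf : Measurable f) (hg : Measurable g) (a : ℝ)
    (h : ∀ q, a ≤ q → ∫⁻ x, ENNReal.ofReal (Real.exp (-(q * x))) * f x ∂leb
      = ∫⁻ x, ENNReal.ofReal (Real.exp (-(q * x))) * g x ∂leb)
    (hfin : ∫⁻ x, ENNReal.ofReal (Real.exp (-(a * x))) * f x ∂leb ≠ ∞) : f =ᵐ[leb] g := by
  have hw : Measurable fun x : ℝ≥0 => ENNReal.ofReal (Real.exp (-(a * x))) := by fun_prop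
  have hI : ∀ (k : ℝ≥0 → ℝ≥0∞), Measurable k → ∀ q : ℝ,
      ∫⁻ x, ENNReal.ofReal (Real.exp (-(q * x))) ∂(leb.withDensity fun x =>
        ENNReal.ofReal (Real.exp (-(a * x))) * k x)
      = ∫⁻ x, ENNReal.ofReal (Real.exp (-((q + a) * x))) * k x ∂leb := by
    intro k hk q
    rw [lintegral_withDensity_eq_lintegral_mul _ (by exact hw.mul hk) (by fun_prop)]
    refine lintegral_congr fun x => ?_
    simp only [Pi.mul_apply]
    rw [mul_right_comm, ← ENNReal.ofReal_mul (Real.exp_pos _).le, ← Real.exp_add]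
    congr 3
    ring
  have hd := ext_of_laplace (μ := leb.withDensity fun x =>
      ENNReal.ofReal (Real.exp (-(a * x))) * f x) (ν := leb.withDensity fun x =>
      ENNReal.ofReal (Real.exp (-(a * x))) * g x) 0
    (fun q hq => by rw [hI f hf, hI g hg]; exact h _ (by linarith))
    (by rw [hI f hf, zero_add]; exact hfin)
  have hd' := (withDensity_eq_iff (hw.mul hf).aemeasurable (hw.mul hg).aemeasurable hfin).1 hd
  filter_upwards [hd'] with x hx
  exact (ENNReal.mul_right_inj (by simp [Real.exp_pos]) ENNReal.ofReal_ne_top).1 hx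

/-- Otherwise right-continuity would give an interval `[s, u)`, of positive measure, on which `f`
differs from `c`. -/
lemma eq_of_ae_eq_const {f : ℝ≥0 → ℝ≥0∞} {c : ℝ≥0∞} (h : ∀ᵐ s ∂leb, f s = c) {s : ℝ≥0}
    (hs : ContinuousWithinAt f (Set.Ici s) s) : f s = c := by
  by_contra hne
  have h1 : {u | f u ≠ c} ∈ 𝓝[≥] s := hs (isOpen_ne.mem_nhds hne)
  obtain ⟨u, hu, hsub⟩ := (mem_nhdsGE_iff_exists_Ico_subset' (lt_add_one s)).1 h1
  exact (leb_Ico_pos s hu).ne' (measure_mono_null hsub (by simpa [ae_iff] using h))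

/-- For a fixed delay `x` the residual time at `s ≤ x` is `x - s`, and from `x` on it is the
overshoot of the started process. Integrating the two pieces gives `(exp (-l x) - exp (-q x)) / (q -
l) + c exp (-q x)`. The negative part is moved across, so that both sides can be integrated over `x`
in `ℝ≥0∞`. -/
lemma lintegral_exp_delayed {q l c : ℝ} (hql : l < q) (hc0 : 0 ≤ c) (hc : c ≤ 1 / (q - l))
    {f R : ℝ≥0 → ℝ≥0∞} (hf : Measurable f) (x : ℝ≥0)
    (h₁ : ∀ s ≤ x, f s = ENNReal.ofReal (Real.exp (-(l * (x - s))))) (h₂ : ∀ s, f (x + s) = R s)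
    (hR : ∫⁻ s, ENNReal.ofReal (Real.exp (-(q * s))) * R s ∂leb = ENNReal.ofReal c) :
    (∫⁻ s, ENNReal.ofReal (Real.exp (-(q * s))) * f s ∂leb)
      + ENNReal.ofReal (1 / (q - l) - c) * ENNReal.ofReal (Real.exp (-(q * x)))
      = ENNReal.ofReal (1 / (q - l)) * ENNReal.ofReal (Real.exp (-(l * x))) := by
  rw [lintegral_leb_split (by exact Measurable.mul (by fun_prop) hf) x]
  have p1 : ∫⁻ s in Set.Ioc (0 : ℝ) x, ENNReal.ofReal (Real.exp (-(q * (Real.toNNReal s : ℝ≥0))))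
      * f (Real.toNNReal s) = ENNReal.ofReal (Real.exp (-(q * 0)) *
        ((Real.exp (-(l * (x - 0))) - Real.exp (-(q * (x - 0)))) / (q - l))) := by
    rw [← lintegral_exp_Ioc hql x.coe_nonneg]
    refine setLIntegral_congr_fun measurableSet_Ioc fun s hs => ?_
    have hs' : Real.toNNReal s ≤ x := Real.toNNReal_le_iff_le_coe.2 hs.2
    rw [h₁ _ hs', Real.coe_toNNReal _ hs.1.le, ENNReal.ofReal_mul (Real.exp_pos _).le]
  have p2 : ∫⁻ s, ENNReal.ofReal (Real.exp (-(q * (x + s : ℝ≥0)))) * f (x + s) ∂leb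
      = ENNReal.ofReal (Real.exp (-(q * x))) * ENNReal.ofReal c := by
    rw [← hR, ← lintegral_const_mul' _ _ ENNReal.ofReal_ne_top]
    refine lintegral_congr fun s => ?_
    rw [← mul_assoc, ← ENNReal.ofReal_mul (Real.exp_pos _).le, ← Real.exp_add, h₂]
    congr 3
    push_cast
    ring
  rw [p1, p2]
  have hql' : 0 < q - l := by linarith
  have hexp : 0 ≤ Real.exp (-(l * x)) - Real.exp (-(q * x)) := by
    rw [sub_nonneg, Real.exp_le_exp]
    have := x.2
    nlinarith
  simp only [mul_zero, neg_zero, Real.exp_zero, one_mul, sub_zero]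
  have n1 : 0 ≤ (Real.exp (-(l * x)) - Real.exp (-(q * x))) / (q - l) := div_nonneg hexp hql'.le
  have n2 : 0 ≤ Real.exp (-(q * x)) * c := mul_nonneg (Real.exp_pos _).le hc0
  have n3 : 0 ≤ 1 / (q - l) - c := by linarith
  rw [← ENNReal.ofReal_mul (Real.exp_pos _).le, ← ENNReal.ofReal_mul n3,
    ← ENNReal.ofReal_mul (by positivity), ← ENNReal.ofReal_add n1 n2,
    ← ENNReal.ofReal_add (add_nonneg n1 n2) (mul_nonneg n3 (Real.exp_pos _).le)]
  congr 1
  ring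

/-- The Laplace transform of the residual time after a delay with law `ν_β`, in terms of the
double Laplace transform of the overshoot. -/
lemma lintegral_exp_delayed_nu {β q l : ℝ} (hβ : 0 < β) (hβ1 : β < 1) (hl : 0 < l) (hql : l < q)
    {F : ℝ≥0 → ℝ≥0 → ℝ≥0∞} {R : ℝ≥0 → ℝ≥0∞} (hF : Measurable fun z : ℝ≥0 × ℝ≥0 => F z.1 z.2)
    (h₁ : ∀ x, ∀ s ≤ x, F s x = ENNReal.ofReal (Real.exp (-(l * (x - s)))))
    (h₂ : ∀ x s, F (x + s) x = R s)
    (hR : ∫⁻ s, ENNReal.ofReal (Real.exp (-(q * s))) * R s ∂leb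
      = ENNReal.ofReal ((q ^ β - l ^ β) / (q - l) / q ^ β)) :
    ∫⁻ s, ENNReal.ofReal (Real.exp (-(q * s))) * ∫⁻ x, F s x ∂(nu β) ∂leb
      = ENNReal.ofReal ((1 - β) * Real.Gamma (1 - β) * l ^ (β - 1) * q⁻¹) := by
  have hq : 0 < q := hl.trans hql
  simp only [← lintegral_const_mul' _ _ ENNReal.ofReal_ne_top]
  rw [lintegral_lintegral_swap (by exact (Measurable.mul (by fun_prop) hF).aemeasurable)]
  have hql' : 0 < q - l := by linarith
  have hQ : 0 < q ^ β := by positivity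
  have hL : 0 < l ^ β := by positivity
  have hc0 : 0 ≤ (q ^ β - l ^ β) / (q - l) / q ^ β := by
    have := Real.rpow_le_rpow hl.le hql.le hβ.le
    exact div_nonneg (div_nonneg (by linarith) (by linarith)) (by positivity)
  -- The coefficient `l^β q^(-β) / (q - l)` meets the transform `q^(β - 1)` of `ν_β` and leaves `l^β
  -- / q`; the difference `(l^(β - 1) - l^β / q) / (q - l)` is `l^(β - 1) / q`.
  have hcs : 1 / (q - l) - (q ^ β - l ^ β) / (q - l) / q ^ β = l ^ β / q ^ β / (q - l) := by
    field_simp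
    ring
  have hc1 : (q ^ β - l ^ β) / (q - l) / q ^ β ≤ 1 / (q - l) := by
    have : 0 < l ^ β / q ^ β / (q - l) := by positivity
    linarith
  have e3 := lintegral_congr (μ := nu β) fun x => lintegral_exp_delayed (f := fun s => F s x)
    hql hc0 hc1 (hF.comp (measurable_id.prodMk measurable_const)) x (h₁ x) (h₂ x) hR
  rw [hcs, lintegral_add_right _ (by fun_prop), lintegral_const_mul _ (by fun_prop),
    lintegral_const_mul _ (by fun_prop), lintegral_exp_nu hβ1 hq, lintegral_exp_nu hβ1 hl] at e3
  have hΓ : 0 < Real.Gamma (1 - β) := Real.Gamma_pos_of_pos (by linarith)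
  have hβ' : 0 < 1 - β := by linarith
  refine (ENNReal.add_left_inj (ENNReal.mul_ne_top ENNReal.ofReal_ne_top
    ENNReal.ofReal_ne_top)).1 (e3.trans ?_)
  rw [← ENNReal.ofReal_mul (by positivity), ← ENNReal.ofReal_mul (by positivity),
    ← ENNReal.ofReal_add (by positivity) (by positivity)]
  congr 1
  rw [Real.rpow_sub_one hl.ne', Real.rpow_sub_one hq.ne']
  field_simp
  ring

variable {Ω : Type*} [MeasurableSpace Ω] {P : Measure Ω} {X : ℝ≥0 → Ω → ℝ} {β : ℝ}

lemma IsStableSubordinator.measurable_pathOver_add (hX : IsStableSubordinator β X P) :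
    Measurable fun z : ℝ≥0 × (Ω × ℝ≥0) =>
      pathOver (X · z.2.1) (z.1 - z.2.2) + (z.2.2 - z.1) := by
  have hpath : Measurable fun ω s => X s ω := measurable_pi_lambda _ hX.levy.measurable
  exact ((hpath.comp (measurable_fst.comp measurable_snd)).pathOver (by fun_prop)).add
    (by fun_prop)

variable [IsProbabilityMeasure P]

/-- The Laplace transform in `s` of the residual time at `s` after a delay with law `ν_β`. -/
lemma IsStableSubordinator.lintegral_exp_residual (hX : IsStableSubordinator β X P) (hβ : 0 < β)
    (hβ1 : β < 1) {q l : ℝ} (hl : 0 < l) (hql : l < q) :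
    ∫⁻ s, ENNReal.ofReal (Real.exp (-(q * s))) * ∫⁻ z, ENNReal.ofReal (Real.exp
        (-(l * (pathOver (X · z.1) (s - z.2) + (z.2 - s) : ℝ≥0)))) ∂(P.prod (nu β)) ∂leb
      = ENNReal.ofReal ((1 - β) * Real.Gamma (1 - β) * l ^ (β - 1) * q⁻¹) := by
  have hΦ : Measurable fun y : ℝ≥0 => ENNReal.ofReal (Real.exp (-(l * y))) := by fun_prop
  have hjoint := hΦ.comp hX.measurable_pathOver_add
  simp only [Function.comp_def] at hjoint
  set F : ℝ≥0 → ℝ≥0 → ℝ≥0∞ := fun s x => ∫⁻ ω, ENNReal.ofReal (Real.exp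
        (-(l * (pathOver (X · ω) (s - x) + (x - s) : ℝ≥0)))) ∂P with hF
  have hFm : Measurable fun z : ℝ≥0 × ℝ≥0 => F z.1 z.2 := by
    have h1 : Measurable fun z : (ℝ≥0 × ℝ≥0) × Ω => ENNReal.ofReal (Real.exp
        (-(l * (pathOver (X · z.2) (z.1.1 - z.1.2) + (z.1.2 - z.1.1) : ℝ≥0)))) :=
      hjoint.comp (by fun_prop : Measurable fun z : (ℝ≥0 × ℝ≥0) × Ω => (z.1.1, (z.2, z.1.2)))
    exact h1.lintegral_prod_right'
  have e1 : ∀ s, ∫⁻ z, ENNReal.ofReal (Real.exp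
        (-(l * (pathOver (X · z.1) (s - z.2) + (z.2 - s) : ℝ≥0)))) ∂(P.prod (nu β))
      = ∫⁻ x, F s x ∂(nu β) := fun s =>
    lintegral_prod_symm _ (hjoint.comp measurable_prodMk_left).aemeasurable
  simp only [e1]
  have hgood := hX.ae_isGoodPath hβ
  refine lintegral_exp_delayed_nu hβ hβ1 hl hql hFm (fun x s hs => ?_) (fun x s => ?_)
    (hX.lintegral_pathOver_exp hβ hl hql)
  · have : ∀ᵐ ω ∂P, ENNReal.ofReal (Real.exp (-(l * (pathOver (X · ω) (s - x)
        + (x - s) : ℝ≥0)))) = ENNReal.ofReal (Real.exp (-(l * (x - s)))) := by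
      filter_upwards [hgood] with ω hω
      rw [tsub_eq_zero_of_le hs, hω.pathOver_zero, zero_add, NNReal.coe_sub hs]
    rw [hF]
    dsimp only
    rw [lintegral_congr_ae this]
    simp
  · rw [hF]
    simp only [add_tsub_cancel_left, tsub_eq_zero_of_le (le_self_add : x ≤ x + s), add_zero]

/-- The transform in `s` is a constant divided by `q`, which is the transform of a constant
function. Uniqueness gives the value for almost every `s`, right-continuity in `s` for every `s`. -/
lemma IsStableSubordinator.lintegral_exp_residual_eq (hX : IsStableSubordinator β X P) (hβ : 0 < β)
    (hβ1 : β < 1) (s : ℝ≥0) {l : ℝ} (hl : 0 < l) :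
    ∫⁻ z, ENNReal.ofReal (Real.exp
        (-(l * (pathOver (X · z.1) (s - z.2) + (z.2 - s) : ℝ≥0)))) ∂(P.prod (nu β))
      = ∫⁻ x, ENNReal.ofReal (Real.exp (-(l * x))) ∂(nu β) := by
  have hΦ : Measurable fun y : ℝ≥0 => ENNReal.ofReal (Real.exp (-(l * y))) := by fun_prop
  have hjoint := hΦ.comp hX.measurable_pathOver_add
  simp only [Function.comp_def] at hjoint
  rw [lintegral_exp_nu hβ1 hl]
  have hC : 0 ≤ (1 - β) * Real.Gamma (1 - β) * l ^ (β - 1) := by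
    have hΓ : 0 < Real.Gamma (1 - β) := Real.Gamma_pos_of_pos (by linarith)
    have hβ' : 0 < 1 - β := by linarith
    positivity
  refine eq_of_ae_eq_const (f := fun s => ∫⁻ z, ENNReal.ofReal (Real.exp
        (-(l * (pathOver (X · z.1) (s - z.2) + (z.2 - s) : ℝ≥0)))) ∂(P.prod (nu β)))
    (ae_eq_of_laplace hjoint.lintegral_prod_right' measurable_const (l + 1)
      (fun q hq => ?_) ?_) ?_
  · rw [hX.lintegral_exp_residual hβ hβ1 hl (by linarith), lintegral_mul_const' _ _
      ENNReal.ofReal_ne_top, lintegral_exp_leb (by linarith), ENNReal.ofReal_mul hC]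
    exact mul_comm _ _
  · rw [hX.lintegral_exp_residual hβ hβ1 hl (by linarith)]
    exact ENNReal.ofReal_ne_top
  -- For `u ≤ s + 1` the delay is at most `s + 1` plus the residual time at `u`, so the integrand is
  -- at most `exp (l (s + 1)) exp (-l x)`, which is integrable for `ν_β`.
  · refine tendsto_lintegral_filter_of_dominated_convergence
      (fun z => ENNReal.ofReal (Real.exp (l * (s + 1)))
        * ENNReal.ofReal (Real.exp (-(l * (z.2 : ℝ)))))
      (Eventually.of_forall fun u => hjoint.comp measurable_prodMk_left) ?_ ?_ ?_
    · have h1 : ∀ᶠ u in 𝓝[≥] s, u ≤ s + 1 :=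
        nhdsWithin_le_nhds (Iic_mem_nhds (lt_add_one s))
      filter_upwards [h1] with u hu
      refine ae_of_all _ fun z => ?_
      rw [← ENNReal.ofReal_mul (Real.exp_pos _).le, ← Real.exp_add]
      refine ENNReal.ofReal_le_ofReal (Real.exp_le_exp.2 ?_)
      have h2 : (z.2 : ℝ) ≤ (s + 1) + (pathOver (X · z.1) (u - z.2) + (z.2 - u) : ℝ≥0) := by
        have : z.2 ≤ (s + 1) + (pathOver (X · z.1) (u - z.2) + (z.2 - u)) := by
          calc z.2 ≤ u + (z.2 - u) := le_add_tsub
            _ ≤ _ := add_le_add hu le_add_self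
        exact_mod_cast this
      nlinarith
    · rw [lintegral_prod_symm _ (by fun_prop)]
      simp only [lintegral_const, measure_univ, mul_one]
      rw [lintegral_const_mul _ (by fun_prop), lintegral_exp_nu hβ1 hl]
      exact ENNReal.mul_ne_top ENNReal.ofReal_ne_top ENNReal.ofReal_ne_top
    · have hgood := hX.ae_isGoodPath hβ
      have hgood' : ∀ᵐ z ∂(P.prod (nu β)), IsGoodPath (X · z.1) :=
        Measure.quasiMeasurePreserving_fst.ae hgood
      filter_upwards [hgood'] with z hz
      have hc : Continuous fun y : ℝ≥0 => ENNReal.ofReal (Real.exp (-(l * y))) :=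
        ENNReal.continuous_ofReal.comp (by fun_prop)
      refine (hc.tendsto _).comp (Tendsto.add ?_ ?_)
      · have h1 : ContinuousWithinAt (fun u : ℝ≥0 => u - z.2) (Set.Ici s) s :=
          (continuous_id.sub continuous_const).continuousWithinAt
        exact (hz.continuousWithinAt_pathOver (s - z.2)).comp (f := fun u : ℝ≥0 => u - z.2) h1
          fun u hu => tsub_le_tsub_right (Set.mem_Ici.1 hu) _
      · exact ((continuous_const.sub continuous_id).tendsto s).mono_left nhdsWithin_le_nhds

/-- The measure `ν_β` is invariant for the residual time of the range of a `β`-stable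
subordinator. -/
lemma IsStableSubordinator.map_residual (hX : IsStableSubordinator β X P) (hβ : 0 < β)
    (hβ1 : β < 1) (s : ℝ≥0) :
    (P.prod (nu β)).map (fun z => pathOver (X · z.1) (s - z.2) + (z.2 - s)) = nu β := by
  have hm : Measurable fun z : Ω × ℝ≥0 => pathOver (X · z.1) (s - z.2) + (z.2 - s) :=
    hX.measurable_pathOver_add.comp measurable_prodMk_left
  refine ext_of_laplace 1 (fun q hq => ?_) ?_
  · rw [lintegral_map (by fun_prop) hm, hX.lintegral_exp_residual_eq hβ hβ1 s (by linarith)]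
  · rw [lintegral_map (by fun_prop) hm, hX.lintegral_exp_residual_eq hβ hβ1 s one_pos,
      lintegral_exp_nu hβ1 one_pos]
    exact ENNReal.ofReal_ne_top

end Invariance

/-! ### Mittag-Leffler processes: tails, scaling, increments after a delay -/

section MittagLeffler

variable {Ω : Type*} [MeasurableSpace Ω]

/-- The properties of a jointly measurable version of a Mittag-Leffler process that are used to
analyse the process `Y`: a tail bound, self-similarity, and stationarity of the increments after a
delay distributed according to `ν_β`. -/
structure IsMittagLefflerVersion (β : ℝ) (N : Ω → ℝ≥0 → ℝ≥0) (P : Measure Ω) : Prop where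
  measurable : Measurable fun z : Ω × ℝ≥0 => N z.1 z.2
  zero : ∀ᵐ ω ∂P, N ω 0 = 0
  mono : ∀ᵐ ω ∂P, Monotone (N ω)
  tail : ∀ t u : ℝ≥0, P {ω | u < N ω t} ≤ ENNReal.ofReal (Real.exp (t - u))
  scale : ∀ c : ℝ≥0, 0 < c → ∀ (I : Finset ℝ≥0) (τ : I → ℝ≥0) (G : (I → ℝ≥0) → ℝ≥0∞),
    Measurable G →
    ∫⁻ ω, G (fun t => N ω (c * τ t)) ∂P = ∫⁻ ω, G (fun t => c ^ β * N ω (τ t)) ∂P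
  shift : ∀ (s : ℝ≥0) (I : Finset ℝ≥0) (G : (I → ℝ≥0) → ℝ≥0∞), Measurable G → G 0 = 0 →
    ∫⁻ z, G (fun t => N z.1 (t + s - z.2) - N z.1 (s - z.2)) ∂(P.prod (nu β))
      = ∫⁻ z, G (fun t => N z.1 (t - z.2)) ∂(P.prod (nu β))

variable {P : Measure Ω} [IsProbabilityMeasure P]

section Stable

variable {X : ℝ≥0 → Ω → ℝ} {β : ℝ}

/-- If level `t` is reached only after time `u`, then `X u ≤ t`; Markov's bound with `θ = 1`
applies. -/
lemma IsStableSubordinator.pathInv_tail (hX : IsStableSubordinator β X P) (hβ : 0 < β)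
    (t u : ℝ≥0) : P {ω | u < pathInv (X · ω) t} ≤ ENNReal.ofReal (Real.exp (t - u)) := by
  have h1 : P {ω | u < pathInv (X · ω) t} ≤ P {ω | X u ω ≤ t} := by
    refine measure_mono_ae ?_
    filter_upwards [hX.ae_isGoodPath hβ] with ω hω (h : u < pathInv (X · ω) t)
    have := mt hω.pathInv_le_iff.2 (not_le.2 h)
    exact (not_le.1 this).le
  refine h1.trans ?_
  rw [← ENNReal.ofReal_toReal (measure_ne_top P {ω | X u ω ≤ t})]
  refine ENNReal.ofReal_le_ofReal ((hX.measureReal_le u zero_le_one t).trans_eq ?_)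
  rw [← Real.exp_add, Real.one_rpow]
  congr 1
  ring

lemma IsStableSubordinator.lintegral_pathInv_scale {ι : Type*} (hX : IsStableSubordinator β X P)
    (hβ : 0 < β) {c : ℝ≥0} (hc : 0 < c) (t : ι → ℝ≥0) {G : (ι → ℝ≥0) → ℝ≥0∞} (hG : Measurable G) :
    ∫⁻ ω, G (fun i => pathInv (X · ω) (c * t i)) ∂P
      = ∫⁻ ω, G (fun i => c ^ β * pathInv (X · ω) (t i)) ∂P := by
  have hcβ : 0 < c ^ β := NNReal.rpow_pos hc
  have hΨ : Measurable fun p : ℝ≥0 → ℝ => G (fun i => c ^ β * pathInv p (c * t i)) :=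
    hG.comp (measurable_pi_lambda _ fun i =>
      (measurable_id.pathInv measurable_const).const_mul _)
  have hm1 : Measurable fun ω s => X (c ^ β * s) ω :=
    measurable_pi_lambda _ fun s => hX.levy.measurable _
  have hm2 : Measurable fun ω s => (c : ℝ) * X s ω :=
    measurable_pi_lambda _ fun s => (hX.levy.measurable s).const_mul _
  -- This functional, applied to the two equal laws, undoes the scaling on either side: stretching
  -- time cancels the factor `c ^ β`, stretching space cancels the `c` in the level.
  have h := congrArg (fun μ => ∫⁻ p, G (fun i => c ^ β * pathInv p (c * t i)) ∂μ)
    (hX.map_scale hβ hc)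
  rw [lintegral_map hΨ hm1, lintegral_map hΨ hm2] at h
  refine Eq.trans (lintegral_congr_ae ?_) (h.trans (lintegral_congr_ae ?_))
  · filter_upwards [hX.ae_isGoodPath hβ] with ω hω
    congr 1
    ext1 i
    have := hω.pathInv_scale hcβ one_pos (c * t i)
    simp only [NNReal.coe_one, one_mul, inv_one] at this
    rw [this, mul_inv_cancel_left₀ hcβ.ne']
  · filter_upwards [hX.ae_isGoodPath hβ] with ω hω
    congr 1
    ext1 i
    have := hω.pathInv_scale one_pos hc (c * t i)
    simp only [one_mul, inv_one] at this
    rw [this, inv_mul_cancel_left₀ hc.ne']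

/-- If `x ≤ s`, the strong Markov property at level `s - x` restarts the inverse after the
overshoot; if `x ≥ s`, it starts after `x - s`. In both cases it is delayed by an independent
residual time, whose law is again `ν_β`. -/
lemma IsStableSubordinator.lintegral_pathInv_shift {ι : Type*} [Fintype ι]
    (hX : IsStableSubordinator β X P) (hβ : 0 < β) (hβ1 : β < 1) (s : ℝ≥0) (t : ι → ℝ≥0)
    {G : (ι → ℝ≥0) → ℝ≥0∞} (hG : Measurable G) :
    ∫⁻ z, G (fun i => pathInv (X · z.1) (t i + s - z.2) - pathInv (X · z.1) (s - z.2))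
        ∂(P.prod (nu β))
      = ∫⁻ z, G (fun i => pathInv (X · z.1) (t i - z.2)) ∂(P.prod (nu β)) := by
  have hpath : Measurable fun ω s => X s ω := measurable_pi_lambda _ hX.levy.measurable
  have hp1 : Measurable fun z : Ω × ℝ≥0 => (X · z.1) := hpath.comp measurable_fst
  have hm : Measurable fun z : Ω × ℝ≥0 => G (fun i => pathInv (X · z.1) (t i - z.2)) :=
    hG.comp (measurable_pi_lambda _ fun i => hp1.pathInv (by fun_prop))
  have hm' : Measurable fun z : Ω × ℝ≥0 =>
      G (fun i => pathInv (X · z.1) (t i + s - z.2) - pathInv (X · z.1) (s - z.2)) :=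
    hG.comp (measurable_pi_lambda _ fun i =>
      (hp1.pathInv (by fun_prop)).sub (hp1.pathInv (by fun_prop)))
  have hΦ : Measurable fun y => ∫⁻ ω, G (fun i => pathInv (X · ω) (t i - y)) ∂P :=
    hm.lintegral_prod_left'
  have hres : Measurable fun z : Ω × ℝ≥0 => pathOver (X · z.1) (s - z.2) + (z.2 - s) :=
    hX.measurable_pathOver_add.comp measurable_prodMk_left
  rw [lintegral_prod_symm _ hm'.aemeasurable, lintegral_prod_symm _ hm.aemeasurable]
  conv_rhs => rw [← hX.map_residual hβ hβ1 s, lintegral_map hΦ hres]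
  rw [lintegral_prod_symm _ (by exact (hΦ.comp hres).aemeasurable)]
  refine lintegral_congr fun x => ?_
  have hgood := hX.ae_isGoodPath hβ
  rcases le_total x s with h | h
  · have h1 := hX.lintegral_pathInv_add hβ (s - x) t hG
    simp only [tsub_eq_zero_of_le h, add_zero, add_tsub_assoc_of_le h]
    exact h1
  · have e1 : ∀ᵐ ω₂ ∂P, ∫⁻ ω, G (fun i => pathInv (X · ω)
          (t i - (pathOver (X · ω₂) (s - x) + (x - s)))) ∂P
        = ∫⁻ ω, G (fun i => pathInv (X · ω) (t i - (x - s))) ∂P := by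
      filter_upwards [hgood] with ω₂ hω₂
      simp only [tsub_eq_zero_of_le h, hω₂.pathOver_zero, zero_add]
    rw [lintegral_congr_ae e1, lintegral_const, measure_univ, mul_one]
    refine lintegral_congr_ae ?_
    filter_upwards [hgood] with ω hω
    simp only [tsub_eq_zero_of_le h, hω.pathInv_zero, tsub_zero, tsub_tsub_eq_add_tsub_of_le h]

lemma IsStableSubordinator.isMittagLefflerVersion (hX : IsStableSubordinator β X P) (hβ : 0 < β)
    (hβ1 : β < 1) : IsMittagLefflerVersion β (fun ω t => pathInv (X · ω) t) P where
  measurable := ((measurable_pi_lambda _ hX.levy.measurable).comp measurable_fst).pathInv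
    measurable_snd
  zero := (hX.ae_isGoodPath hβ).mono fun _ h => h.pathInv_zero
  mono := (hX.ae_isGoodPath hβ).mono fun _ h => h.pathInv_mono
  tail := hX.pathInv_tail hβ
  scale _ hc _ _ _ hG := hX.lintegral_pathInv_scale hβ hc _ hG
  shift s _ _ hG _ := hX.lintegral_pathInv_shift hβ hβ1 s _ hG

end Stable

lemma isMittagLefflerVersion_one : IsMittagLefflerVersion 1 (fun (_ : Ω) t => t) P where
  measurable := measurable_snd
  zero := ae_of_all _ fun _ => rfl
  mono := ae_of_all _ fun _ => monotone_id
  tail t u := by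
    by_cases h : u < t
    · simp only [h, Set.ofPred_true, measure_univ]
      rw [← ENNReal.ofReal_one]
      refine ENNReal.ofReal_le_ofReal ?_
      rw [← Real.exp_zero, Real.exp_le_exp, sub_nonneg]
      exact_mod_cast h.le
    · simp [h]
  scale c _ I τ G _ := by simp
  shift s I G hG _ := by
    have hν : nu 1 = Measure.dirac 0 := if_pos rfl
    rw [hν, lintegral_prod_symm _ (by
        exact (hG.comp (by fun_prop : Measurable fun z : Ω × ℝ≥0 => fun t : I =>
          (t : ℝ≥0) + s - z.2 - (s - z.2))).aemeasurable), lintegral_prod_symm _ (by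
        exact (hG.comp (by fun_prop : Measurable fun z : Ω × ℝ≥0 => fun t : I =>
          (t : ℝ≥0) - z.2)).aemeasurable)]
    simp

lemma nu_zero : nu 0 = leb := by
  ext A hA
  have := lintegral_nu (β := 0) zero_ne_one (g := A.indicator 1) (measurable_one.indicator hA)
  simpa [hA] using this

lemma isMittagLefflerVersion_zero {E : Ω → ℝ≥0} (hE : Measurable E)
    (hlaw : HasLaw (fun ω => (E ω : ℝ)) (expMeasure 1) P) :
    IsMittagLefflerVersion 0 (fun ω t => if t = 0 then 0 else E ω) P where
  measurable := Measurable.ite (measurable_snd (measurableSet_singleton 0)) measurable_const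
    (hE.comp measurable_fst)
  zero := ae_of_all _ fun _ => if_pos rfl
  mono := ae_of_all _ fun ω s t h => by
    by_cases ht : t = 0
    · have hs : s = 0 := le_antisymm (h.trans_eq ht) zero_le
      simp [hs, ht]
    · by_cases hs : s = 0 <;> simp [hs, ht]
  tail t u := by
    have h1 : P {ω | u < if t = 0 then 0 else E ω} ≤ P {ω | (u : ℝ) < (E ω : ℝ)} := by
      refine measure_mono fun ω h => ?_
      by_cases ht : t = 0
      · simp [ht] at h
      · simpa [ht] using h
    have h2 : P {ω | (u : ℝ) < (E ω : ℝ)} = ENNReal.ofReal (Real.exp (-u)) := by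
      have : IsProbabilityMeasure (expMeasure 1) := isProbabilityMeasure_expMeasure one_pos
      rw [hlaw.measure_eq (p := fun x => (u : ℝ) < x) measurableSet_Ioi]
      have h3 := cdf_expMeasure_eq one_pos (u : ℝ)
      rw [if_pos u.coe_nonneg, cdf_eq_real, one_mul] at h3
      have h4 := measureReal_compl (μ := expMeasure 1) (measurableSet_Iic (a := (u : ℝ)))
      rw [h3, probReal_univ, sub_sub_cancel, Set.compl_Iic] at h4
      rw [← h4]
      exact (ENNReal.ofReal_toReal (measure_ne_top _ _)).symm
    refine h1.trans (h2.trans_le (ENNReal.ofReal_le_ofReal (Real.exp_le_exp.2 ?_)))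
    have := t.coe_nonneg
    linarith
  scale c hc I τ G hG := by simp [hc.ne']
  shift s I G hG hG0 := by
    have hN : Measurable fun z : Ω × ℝ≥0 => if z.2 = 0 then 0 else E z.1 :=
      Measurable.ite (measurable_snd (measurableSet_singleton 0)) measurable_const
        (hE.comp measurable_fst)
    have hm : ∀ u : ℝ≥0, Measurable fun z : Ω × ℝ≥0 => if u - z.2 = 0 then 0 else E z.1 :=
      fun u => hN.comp (measurable_fst.prodMk (by fun_prop))
    have hm1 : Measurable fun z : Ω × ℝ≥0 => G fun t : I =>
        (if (t : ℝ≥0) + s - z.2 = 0 then 0 else E z.1) - (if s - z.2 = 0 then 0 else E z.1) :=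
      hG.comp (measurable_pi_lambda _ fun t => (hm _).sub (hm _))
    have hm2 : Measurable fun z : Ω × ℝ≥0 => G fun t : I =>
        (if (t : ℝ≥0) - z.2 = 0 then 0 else E z.1) :=
      hG.comp (measurable_pi_lambda _ fun t => hm _)
    rw [nu_zero, lintegral_prod_symm _ hm1.aemeasurable, lintegral_prod_symm _ hm2.aemeasurable,
      lintegral_leb_split hm1.lintegral_prod_left' s]
    -- For a delay `x < s` the single jump is already over at time `s`, so all increments vanish and
    -- `G 0 = 0` is used. Delays beyond `s` are handled by translating Lebesgue measure.
    have h0 : ∫⁻ x in Set.Ioc (0 : ℝ) s, ∫⁻ ω, G (fun t : I =>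
        (if (t : ℝ≥0) + s - Real.toNNReal x = 0 then 0 else E ω)
          - (if s - Real.toNNReal x = 0 then 0 else E ω)) ∂P = 0 := by
      rw [← setLIntegral_congr (Ioo_ae_eq_Ioc (a := (0 : ℝ)) (b := s)),
        setLIntegral_congr_fun (g := fun _ => 0) measurableSet_Ioo fun x hx => ?_]
      · simp
      · have hxs : Real.toNNReal x < s := (Real.toNNReal_lt_iff_lt_coe hx.1.le).2 hx.2
        have h1 : s - Real.toNNReal x ≠ 0 := (tsub_pos_of_lt hxs).ne'
        have h2 : ∀ t : I, (t : ℝ≥0) + s - Real.toNNReal x ≠ 0 := fun t =>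
          (tsub_pos_of_lt (hxs.trans_le le_add_self)).ne'
        simp only [h1, h2, if_false, tsub_self]
        have : G (fun _ => 0) = 0 := hG0
        simp [this]
    rw [h0, zero_add]
    refine lintegral_congr fun x => lintegral_congr fun ω => ?_
    congr 1
    ext1 t
    rw [tsub_eq_zero_of_le (le_self_add : s ≤ s + x), if_pos rfl, tsub_zero, add_comm s x,
      add_tsub_add_eq_tsub_right]

/-- Every Mittag-Leffler process has a jointly measurable version with the right properties. -/
lemma IsMittagLefflerProcess.exists_version {β : ℝ} {M : ℝ≥0 → Ω → ℝ≥0}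
    (hM : IsMittagLefflerProcess β M P) (hβ0 : 0 ≤ β) (hβ1 : β ≤ 1) :
    ∃ N : Ω → ℝ≥0 → ℝ≥0, IsMittagLefflerVersion β N P ∧ ∀ᵐ ω ∂P, ∀ t, M t ω = N ω t := by
  rcases hβ0.eq_or_lt with h0 | h0
  · obtain ⟨E, hE, hlaw, h⟩ := hM.eq_zero_case h0.symm
    subst h0
    refine ⟨_, isMittagLefflerVersion_zero hE hlaw, ?_⟩
    filter_upwards [h] with ω hω t
    by_cases ht : t = 0
    · rw [if_pos ht, ht, hω.1]
    · rw [if_neg ht, hω.2 t (pos_iff_ne_zero.2 ht)]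
  rcases hβ1.eq_or_lt with h1 | h1
  · have h := hM.eq_one_case h1
    subst h1
    exact ⟨_, isMittagLefflerVersion_one, h⟩
  · obtain ⟨X, hX, h⟩ := hM.inverse_case h0 h1
    refine ⟨_, hX.isMittagLefflerVersion h0 h1, ?_⟩
    filter_upwards [h, hX.ae_isGoodPath h0] with ω hω hg t
    rw [hω t, hg.sInf_eq]

end MittagLeffler

/-! ### Moments of the stable Lévy motion -/

section Moments

/-- A law whose characteristic function is that of a symmetric `γ`-stable law has finite absolute
moments of all orders `α < γ`. -/
lemma lintegral_rpow_enorm_lt_top_of_charFun {μ : Measure ℝ} [IsProbabilityMeasure μ] {K α γ : ℝ}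
    (hK : 0 ≤ K) (hα : 0 < α) (hαγ : α < γ)
    (h : ∀ t, charFun μ t = ((Real.exp (-(K * |t| ^ γ)) : ℝ) : ℂ)) :
    ∫⁻ x, ‖x‖ₑ ^ α ∂μ < ∞ := by
  have hγ : 0 < γ := hα.trans hαγ
  have e1 : ∫⁻ x, ‖x‖ₑ ^ α ∂μ = ∫⁻ x, ENNReal.ofReal (|x| ^ α) ∂μ := by
    refine lintegral_congr fun x => ?_
    rw [Real.enorm_eq_ofReal_abs, ENNReal.ofReal_rpow_of_nonneg (abs_nonneg x) hα.le]
  rw [e1, lintegral_rpow_eq_lintegral_meas_lt_mul μ (ae_of_all _ fun x => abs_nonneg x)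
    (by fun_prop) hα]
  refine ENNReal.mul_lt_top ENNReal.ofReal_lt_top ?_
  -- Near `0` the factor `t^(α - 1)` is integrable as `α > 0`; beyond `1` the tail of order `t^(-γ)`
  -- suffices as `α < γ`.
  rw [← Set.Ioc_union_Ioi_eq_Ioi zero_le_one]
  refine (lintegral_union_le _ _ _).trans_lt (ENNReal.add_lt_top.2 ⟨?_, ?_⟩)
  · have hi : IntegrableOn (fun t : ℝ => t ^ (α - 1)) (Set.Ioc 0 1) volume :=
      (intervalIntegrable_iff_integrableOn_Ioc_of_le zero_le_one).1
        (intervalIntegral.intervalIntegrable_rpow' (by linarith))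
    refine (lintegral_mono fun t => ?_).trans_lt hi.setLIntegral_lt_top
    exact mul_le_of_le_one_left' prob_le_one
  · have hi : IntegrableOn (fun t : ℝ => 2 * K * 2 ^ γ * t ^ (α - 1 - γ)) (Set.Ioi 1) volume :=
      (integrableOn_Ioi_rpow_of_lt (by linarith) one_pos).const_mul _
    refine (setLIntegral_mono' measurableSet_Ioi fun t (ht : 1 < t) => ?_).trans_lt
      hi.setLIntegral_lt_top
    have ht0 : 0 < t := one_pos.trans ht
    have h1 : μ {a | t < |a|} ≤ ENNReal.ofReal (2 * K * (2 / t) ^ γ) := by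
      rw [← ENNReal.ofReal_toReal (measure_ne_top μ {a | t < |a|})]
      exact ENNReal.ofReal_le_ofReal (measureReal_abs_gt_le_of_charFun hK hγ h ht0)
    refine (mul_le_mul_left h1 _).trans_eq ?_
    rw [← ENNReal.ofReal_mul (by positivity)]
    congr 1
    rw [Real.div_rpow two_pos.le ht0.le, Real.rpow_sub ht0 (α - 1) γ]
    ring

variable {Ω : Type*} [MeasurableSpace Ω] {P : Measure Ω} {S : ℝ≥0 → Ω → ℝ} {α γ : ℝ}

lemma ae_pathEval_eq (hS : IsLevyProcess S P) : ∀ᵐ ω ∂P, ∀ u, pathEval (S · ω) u = S u ω := by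
  filter_upwards [hS.cadlag] with ω hω u
  exact pathEval_eq (hω u).1


lemma IsSymmStableLevyMotion.lintegral_one_lt_top [IsProbabilityMeasure P]
    (hS : IsSymmStableLevyMotion γ S P) (hα : 0 < α) (hαγ : α < γ) : ∫⁻ ω, ‖S 1 ω‖ₑ ^ α ∂P < ∞ := by
  obtain ⟨σ, hσ, h⟩ := hS.charFun_eq
  have hm := hS.levy.measurable 1
  have := Measure.isProbabilityMeasure_map (μ := P) hm.aemeasurable
  have h1 := lintegral_rpow_enorm_lt_top_of_charFun (μ := P.map (S 1)) (K := σ ^ γ) (by positivity)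
    hα hαγ (fun u => by simpa using h 1 u)
  rwa [lintegral_map (by fun_prop) hm] at h1

lemma IsSymmStableLevyMotion.map_scale [IsProbabilityMeasure P]
    (hS : IsSymmStableLevyMotion γ S P) (hγ : 0 < γ) (c : ℝ≥0) :
    P.map (fun ω t => S (c * t) ω) = P.map (fun ω t => (c : ℝ) ^ (1 / γ) * S t ω) := by
  obtain ⟨σ, hσ, h⟩ := hS.charFun_eq
  refine hS.levy.map_scale fun t => ?_
  have hm := hS.levy.measurable t
  have e : P.map (fun ω => (c : ℝ) ^ (1 / γ) * S t ω)
      = (P.map (S t)).map (fun x => (c : ℝ) ^ (1 / γ) * x) :=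
    (Measure.map_map (measurable_const_mul _) hm).symm
  rw [e]
  have := Measure.isProbabilityMeasure_map (μ := P) hm.aemeasurable
  have := Measure.isProbabilityMeasure_map (μ := P) (hS.levy.measurable (c * t)).aemeasurable
  have := Measure.isProbabilityMeasure_map (μ := P.map (S t))
    (measurable_const_mul ((c : ℝ) ^ (1 / γ))).aemeasurable
  refine Measure.ext_of_charFun (funext fun u => ?_)
  rw [charFun_map_mul, h, h, abs_mul, Real.mul_rpow (abs_nonneg _) (abs_nonneg _),
    abs_of_nonneg (Real.rpow_nonneg c.coe_nonneg _), ← Real.rpow_mul c.coe_nonneg,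
    one_div_mul_cancel hγ.ne', Real.rpow_one]
  congr 3
  push_cast
  ring

variable {ι : Type*} [Fintype ι]

/-- The absolute moment of order `α` of a linear combination of the values of a random path at
the times `u`. -/
def pathMoment (α : ℝ) (θ : ι → ℝ) (μ : Measure (ℝ≥0 → ℝ)) (u : ι → ℝ≥0) : ℝ≥0∞ :=
  ∫⁻ p, ‖∑ i, θ i * pathEval p (u i)‖ₑ ^ α ∂μ

lemma measurable_sum_pathEval (α : ℝ) (θ : ι → ℝ) :
    Measurable fun z : (ι → ℝ≥0) × (ℝ≥0 → ℝ) => ‖∑ i, θ i * pathEval z.2 (z.1 i)‖ₑ ^ α := by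
  refine Measurable.pow_const (Measurable.enorm (Finset.measurable_fun_sum _ fun i _ => ?_)) _
  exact (measurable_snd.pathEval ((measurable_pi_apply i).comp measurable_fst)).const_mul _

lemma measurable_pathMoment (α : ℝ) (θ : ι → ℝ) (μ : Measure (ℝ≥0 → ℝ)) [SFinite μ] :
    Measurable (pathMoment α θ μ) :=
  (measurable_sum_pathEval α θ).lintegral_prod_right'

lemma pathMoment_eq (hS : IsLevyProcess S P) (α : ℝ) (θ : ι → ℝ) (u : ι → ℝ≥0) :
    pathMoment α θ (P.map fun ω t => S t ω) u = ∫⁻ ω, ‖∑ i, θ i * S (u i) ω‖ₑ ^ α ∂P := by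
  have hpath : Measurable fun ω t => S t ω := measurable_pi_lambda _ hS.measurable
  have hF : Measurable fun p : ℝ≥0 → ℝ => ‖∑ i, θ i * pathEval p (u i)‖ₑ ^ α :=
    (Finset.measurable_fun_sum _ fun i _ =>
      (measurable_id.pathEval measurable_const).const_mul (θ i)).enorm.pow_const α
  rw [pathMoment, lintegral_map hF hpath]
  refine lintegral_congr_ae ?_
  filter_upwards [ae_pathEval_eq hS] with ω hω
  simp only [hω]

lemma measurable_sum_eval (α : ℝ) (θ : ι → ℝ) (u : ι → ℝ≥0) :
    Measurable fun p : ℝ≥0 → ℝ => ‖∑ i, θ i * p (u i)‖ₑ ^ α := by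
  fun_prop

lemma pathMoment_zero (hS : IsLevyProcess S P) (hα : 0 < α) (θ : ι → ℝ) :
    pathMoment α θ (P.map fun ω t => S t ω) 0 = 0 := by
  rw [pathMoment_eq hS, lintegral_congr_ae (g := fun _ => 0)]
  · simp
  · filter_upwards [hS.zero] with ω hω
    simp [hω, hα]

lemma pathMoment_shift [IsProbabilityMeasure P] (hS : IsLevyProcess S P) (α : ℝ) (θ : ι → ℝ)
    {u : ι → ℝ≥0} {b : ℝ≥0} (hu : ∀ i, b ≤ u i) :
    ∫⁻ ω, ‖∑ i, θ i * (S (u i) ω - S b ω)‖ₑ ^ α ∂P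
      = pathMoment α θ (P.map fun ω t => S t ω) (fun i => u i - b) := by
  have hm1 : Measurable fun ω t => S (b + t) ω - S b ω :=
    measurable_pi_lambda _ fun t => (hS.measurable _).sub (hS.measurable _)
  have hm2 : Measurable fun ω t => S t ω := measurable_pi_lambda _ hS.measurable
  have hF := measurable_sum_eval α θ (fun i => u i - b)
  rw [pathMoment_eq hS, ← lintegral_map hF hm2, ← hS.map_shift b, lintegral_map hF hm1]
  simp only [add_tsub_cancel_of_le (hu _)]

lemma pathMoment_scale [IsProbabilityMeasure P] (hS : IsSymmStableLevyMotion γ S P)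
    (hα : 0 < α) (hγ : 0 < γ) (θ : ι → ℝ) (c : ℝ≥0) (u : ι → ℝ≥0) :
    pathMoment α θ (P.map fun ω t => S t ω) (fun i => c * u i)
      = ENNReal.ofReal ((c : ℝ) ^ (α / γ)) * pathMoment α θ (P.map fun ω t => S t ω) u := by
  have hm1 : Measurable fun ω t => S (c * t) ω :=
    measurable_pi_lambda _ fun t => hS.levy.measurable _
  have hm2 : Measurable fun ω t => (c : ℝ) ^ (1 / γ) * S t ω :=
    measurable_pi_lambda _ fun t => (hS.levy.measurable _).const_mul _
  have hF := measurable_sum_eval α θ u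
  have e1 : ∫⁻ ω, ‖∑ i, θ i * S (c * u i) ω‖ₑ ^ α ∂P
      = ∫⁻ ω, ‖∑ i, θ i * ((c : ℝ) ^ (1 / γ) * S (u i) ω)‖ₑ ^ α ∂P := by
    rw [← lintegral_map hF hm1, hS.map_scale hγ c, lintegral_map hF hm2]
  rw [pathMoment_eq hS.levy, pathMoment_eq hS.levy, e1]
  simp only [mul_left_comm _ ((c : ℝ) ^ (1 / γ)), ← Finset.mul_sum]
  rw [lintegral_const_mul_rpow hα, abs_of_nonneg (Real.rpow_nonneg c.coe_nonneg _),
    ← Real.rpow_mul c.coe_nonneg, one_div_mul_eq_div]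

end Moments

/-! ### Scaling and local finiteness of `ν_β` -/

section Nu

/-- The density contributes `c^(-β)` and the change of variables `c`; for `β = 1` the point mass at
`0` is unchanged. -/
lemma lintegral_nu_scale {β : ℝ} {g : ℝ≥0 → ℝ≥0∞} (hg : Measurable g) {c : ℝ≥0} (hc : 0 < c) :
    ∫⁻ x, g x ∂(nu β) = ENNReal.ofReal ((c : ℝ) ^ (1 - β)) * ∫⁻ x, g (c * x) ∂(nu β) := by
  by_cases hβ : β = 1
  · have hν : nu 1 = Measure.dirac 0 := if_pos rfl
    subst hβ
    simp [hν]
  · have hg' : Measurable fun x => g (c * x) := hg.comp (measurable_const_mul c)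
    have hc' : (0 : ℝ) < c := by exact_mod_cast hc
    rw [lintegral_nu hβ hg, lintegral_nu hβ hg', lintegral_leb_mul (by fun_prop) hc,
      ← lintegral_const_mul' _ _ ENNReal.ofReal_ne_top,
      ← lintegral_const_mul' _ _ ENNReal.coe_ne_top]
    refine lintegral_congr fun x => ?_
    rw [← ENNReal.ofReal_coe_nnreal, ← mul_assoc, ← mul_assoc,
      ← ENNReal.ofReal_mul c.coe_nonneg, ← ENNReal.ofReal_mul (by positivity)]
    congr 2
    rw [NNReal.coe_mul, Real.mul_rpow c.coe_nonneg x.coe_nonneg, sub_eq_add_neg,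
      Real.rpow_add hc', Real.rpow_one]
    ring

lemma nu_Iic_lt_top {β : ℝ} (hβ : β ≤ 1) (t : ℝ≥0) : nu β (Set.Iic t) < ∞ := by
  rcases hβ.eq_or_lt with h | h
  · have hν : nu 1 = Measure.dirac 0 := if_pos rfl
    rw [h, hν]
    exact measure_lt_top _ _
  · have h1 : nu β (Set.Iic t) ≤ ∫⁻ x, ENNReal.ofReal (Real.exp t)
        * ENNReal.ofReal (Real.exp (-(1 * (x : ℝ)))) ∂(nu β) := by
      rw [← lintegral_indicator_one measurableSet_Iic]
      refine lintegral_mono (Set.indicator_le' (fun x hx => ?_) (fun _ _ => zero_le))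
      rw [← ENNReal.ofReal_mul (Real.exp_pos _).le, ← Real.exp_add, Pi.one_apply,
        ENNReal.one_le_ofReal, Real.one_le_exp_iff]
      have : (x : ℝ) ≤ t := by exact_mod_cast hx
      linarith
    refine h1.trans_lt ?_
    rw [lintegral_const_mul _ (by fun_prop), lintegral_exp_nu h one_pos]
    exact ENNReal.mul_lt_top ENNReal.ofReal_lt_top ENNReal.ofReal_lt_top

end Nu

/-! ### Integrals of the kernel -/

section Kernel

variable {Ω : Type*} [MeasurableSpace Ω] {P : Measure Ω} {α β γ : ℝ}
  {S : ℝ≥0 → Ω → ℝ} {M : ℝ≥0 → Ω → ℝ≥0} {N : Ω → ℝ≥0 → ℝ≥0}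

lemma IsMittagLefflerVersion.measurable_comp {A : Type*} [MeasurableSpace A]
    (hN : IsMittagLefflerVersion β N P) {f : A → Ω} {g : A → ℝ≥0} (hf : Measurable f)
    (hg : Measurable g) : Measurable fun a => N (f a) (g a) :=
  hN.measurable.comp (hf.prodMk hg)

/-- Supplies joint measurability: measurability of `S` and `M` at fixed times alone does not give it
for the composition. -/
lemma ae_kernel_eq (hS : IsLevyProcess S P) (hMN : ∀ᵐ ω ∂P, ∀ t, M t ω = N ω t)
    (ν : Measure ℝ≥0) [SFinite ν] :
    ∀ᵐ z ∂(P.prod ν), ∀ t, kernel S M t z = pathEval (fun u => S u z.1) (N z.1 (t - z.2)) := by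
  have h1 : ∀ᵐ ω ∂P, ∀ t, S (M t ω) ω = pathEval (fun u => S u ω) (N ω t) := by
    filter_upwards [ae_pathEval_eq hS, hMN] with ω h1 h2 t
    rw [h1, h2]
  filter_upwards [Measure.quasiMeasurePreserving_fst.ae h1] with z hz t
  exact hz _

lemma ae_kernel_zero (hS : IsLevyProcess S P) (hN : IsMittagLefflerVersion β N P)
    (hMN : ∀ᵐ ω ∂P, ∀ t, M t ω = N ω t) (ν : Measure ℝ≥0) [SFinite ν] :
    ∀ᵐ z ∂(P.prod ν), kernel S M 0 z = 0 := by
  have h : ∀ᵐ ω ∂P, S (M 0 ω) ω = 0 := by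
    filter_upwards [hMN, hN.zero, hS.zero] with ω h1 h2 h3
    rw [h1, h2, h3]
  filter_upwards [Measure.quasiMeasurePreserving_fst.ae h] with z hz
  rw [kernel, zero_tsub, hz]

lemma aestronglyMeasurable_kernel (hS : IsLevyProcess S P) (hN : IsMittagLefflerVersion β N P)
    (hMN : ∀ᵐ ω ∂P, ∀ t, M t ω = N ω t) (ν : Measure ℝ≥0) [SFinite ν] (t : ℝ≥0) :
    AEStronglyMeasurable (kernel S M t) (P.prod ν) := by
  have hpath : Measurable fun ω t => S t ω := measurable_pi_lambda _ hS.measurable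
  have hm : Measurable fun z : Ω × ℝ≥0 => pathEval (fun u => S u z.1) (N z.1 (t - z.2)) :=
    (hpath.comp measurable_fst).pathEval (hN.measurable_comp measurable_fst (by fun_prop))
  refine ⟨_, hm.stronglyMeasurable, ?_⟩
  filter_upwards [ae_kernel_eq hS hMN ν] with z hz using hz t

lemma IsMittagLefflerVersion.lintegral_lt_top (hN : IsMittagLefflerVersion β N P) (t : ℝ≥0) :
    ∫⁻ ω, (N ω t : ℝ≥0∞) ∂P < ∞ := by
  have hm : Measurable fun ω => N ω t := hN.measurable_comp measurable_id measurable_const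
  have e : ∫⁻ ω, (N ω t : ℝ≥0∞) ∂P = ∫⁻ ω, ENNReal.ofReal (N ω t : ℝ) ∂P := by
    simp only [ENNReal.ofReal_coe_nnreal]
  rw [e, lintegral_eq_lintegral_meas_lt P (ae_of_all _ fun ω => (N ω t).coe_nonneg)
    hm.coe_nnreal_real.aemeasurable]
  have hi : IntegrableOn (fun u : ℝ => Real.exp t * Real.exp (-u)) (Set.Ioi 0) volume :=
    (integrableOn_exp_neg_Ioi 0).const_mul _
  refine (setLIntegral_mono' measurableSet_Ioi fun u (hu : 0 < u) => ?_).trans_lt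
    hi.setLIntegral_lt_top
  have h := hN.tail t (Real.toNNReal u)
  rw [Real.coe_toNNReal _ hu.le, sub_eq_add_neg, Real.exp_add] at h
  refine (measure_mono fun ω (hω : u < N ω t) => ?_).trans h
  exact (Real.toNNReal_lt_iff_lt_coe hu.le).2 hω

variable [IsProbabilityMeasure P]

/-- Conditioning on the random time change. -/
lemma lintegral_prod_of_indepFun {J : Type*} [Countable J] {ν : Measure ℝ≥0} [SFinite ν]
    (hSm : ∀ t, Measurable (S t)) (hN : IsMittagLefflerVersion β N P)
    (hSN : IndepFun (fun ω t => S t ω) N P) {κ : J → ℝ≥0 → ℝ≥0} (hκ : ∀ j, Measurable (κ j))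
    {F : (J → ℝ≥0) × (ℝ≥0 → ℝ) → ℝ≥0∞} (hF : Measurable F) :
    ∫⁻ z, F (fun j => N z.1 (κ j z.2), fun t => S t z.1) ∂(P.prod ν)
      = ∫⁻ z, ∫⁻ p, F (fun j => N z.1 (κ j z.2), p) ∂(P.map fun ω t => S t ω) ∂(P.prod ν) := by
  have hpath : Measurable fun ω t => S t ω := measurable_pi_lambda _ hSm
  have := Measure.isProbabilityMeasure_map (μ := P) hpath.aemeasurable
  have hU : Measurable fun z : Ω × ℝ≥0 => fun j => N z.1 (κ j z.2) :=
    measurable_pi_lambda _ fun j => hN.measurable_comp measurable_fst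
      ((hκ j).comp measurable_snd)
  have hm1 : Measurable fun z : Ω × ℝ≥0 => F (fun j => N z.1 (κ j z.2), fun t => S t z.1) :=
    hF.comp (hU.prodMk (hpath.comp measurable_fst))
  have hm2 : Measurable fun z : Ω × ℝ≥0 =>
      ∫⁻ p, F (fun j => N z.1 (κ j z.2), p) ∂(P.map fun ω t => S t ω) :=
    hF.lintegral_prod_right'.comp hU
  rw [lintegral_prod_symm _ hm1.aemeasurable, lintegral_prod_symm _ hm2.aemeasurable]
  refine lintegral_congr fun x => ?_
  have hr : Measurable fun n : ℝ≥0 → ℝ≥0 => fun j => n (κ j x) :=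
    measurable_pi_lambda _ fun j => measurable_pi_apply _
  exact lintegral_of_indepFun (hSN.symm.comp hr measurable_id)
    (hU.comp measurable_prodMk_right) hpath hF

variable {ι : Type*} [Fintype ι]

lemma lintegral_kernel (hS : IsLevyProcess S P) (hN : IsMittagLefflerVersion β N P)
    (hMN : ∀ᵐ ω ∂P, ∀ t, M t ω = N ω t) (hSN : IndepFun (fun ω t => S t ω) N P)
    (ν : Measure ℝ≥0) [SFinite ν] (θ : ι → ℝ) (τ : ι → ℝ≥0) :
    ∫⁻ z, ‖∑ i, θ i * kernel S M (τ i) z‖ₑ ^ α ∂(P.prod ν)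
      = ∫⁻ z, pathMoment α θ (P.map fun ω t => S t ω) (fun i => N z.1 (τ i - z.2))
        ∂(P.prod ν) := by
  have h := lintegral_prod_of_indepFun (ν := ν) (κ := fun i x => τ i - x) hS.measurable hN hSN
    (fun i => by fun_prop) (measurable_sum_pathEval α θ)
  refine Eq.trans (lintegral_congr_ae ?_) h
  filter_upwards [ae_kernel_eq hS hMN ν] with z hz
  simp only [hz]

lemma measurable_sum_pathEval_sub (α : ℝ) (θ : ι → ℝ) :
    Measurable fun z : (Option ι → ℝ≥0) × (ℝ≥0 → ℝ) =>
      ‖∑ i, θ i * (pathEval z.2 (z.1 (some i)) - pathEval z.2 (z.1 none))‖ₑ ^ α := by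
  have h : ∀ j : Option ι, Measurable fun z : (Option ι → ℝ≥0) × (ℝ≥0 → ℝ) =>
      pathEval z.2 (z.1 j) := fun j =>
    measurable_snd.pathEval ((measurable_pi_apply j).comp measurable_fst)
  refine Measurable.pow_const (Measurable.enorm (Finset.measurable_fun_sum _ fun i _ => ?_)) _
  exact ((h _).sub (h _)).const_mul _

lemma lintegral_kernel_sub (hS : IsLevyProcess S P) (hN : IsMittagLefflerVersion β N P)
    (hMN : ∀ᵐ ω ∂P, ∀ t, M t ω = N ω t) (hSN : IndepFun (fun ω t => S t ω) N P)
    (ν : Measure ℝ≥0) [SFinite ν] (θ : ι → ℝ) (τ : ι → ℝ≥0) (s : ℝ≥0) :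
    ∫⁻ z, ‖∑ i, θ i * (kernel S M (τ i + s) z - kernel S M s z)‖ₑ ^ α ∂(P.prod ν)
      = ∫⁻ z, pathMoment α θ (P.map fun ω t => S t ω)
          (fun i => N z.1 (τ i + s - z.2) - N z.1 (s - z.2)) ∂(P.prod ν) := by
  have hpath : Measurable fun ω t => S t ω := measurable_pi_lambda _ hS.measurable
  -- The extra index `none` carries the base time `s`.
  have h := lintegral_prod_of_indepFun (ν := ν)
    (κ := fun (j : Option ι) x => j.elim s (fun i => τ i + s) - x) hS.measurable hN hSN
    (fun i => by fun_prop) (measurable_sum_pathEval_sub α θ)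
  refine Eq.trans (lintegral_congr_ae ?_) (h.trans (lintegral_congr_ae ?_))
  · filter_upwards [ae_kernel_eq hS hMN ν] with z hz
    simp only [hz, Option.elim]
  · filter_upwards [Measure.quasiMeasurePreserving_fst.ae hN.mono] with z hz
    have hu : ∀ i, N z.1 (s - z.2) ≤ N z.1 (τ i + s - z.2) := fun i =>
      hz (tsub_le_tsub_right le_add_self _)
    rw [← pathMoment_shift hS α θ hu]
    have hF : Measurable fun p : ℝ≥0 → ℝ => ‖∑ i, θ i * (pathEval p (N z.1 (τ i + s - z.2))
        - pathEval p (N z.1 (s - z.2)))‖ₑ ^ α :=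
      (Finset.measurable_fun_sum _ fun i _ => ((measurable_id.pathEval measurable_const).sub
        (measurable_id.pathEval measurable_const)).const_mul (θ i)).enorm.pow_const α
    refine (lintegral_map hF hpath).trans (lintegral_congr_ae ?_)
    filter_upwards [ae_pathEval_eq hS] with ω hω
    simp only [hω]

/-- Given the time change, the moment is `N(t - x)^(α/γ) E |S(1)|^α`. As `α/γ ≤ 1`, the power is at
most `1 + N(t)`, which has finite mean; delays beyond `t` contribute nothing. -/
lemma lintegral_kernel_lt_top (hS : IsSymmStableLevyMotion γ S P)
    (hN : IsMittagLefflerVersion β N P) (hMN : ∀ᵐ ω ∂P, ∀ t, M t ω = N ω t)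
    (hSN : IndepFun (fun ω t => S t ω) N P) (hα : 0 < α) (hαγ : α < γ) (hβ : β ≤ 1) (t : ℝ≥0) :
    ∫⁻ z, ‖kernel S M t z‖ₑ ^ α ∂(P.prod (nu β)) < ∞ := by
  have hγ : 0 < γ := hα.trans hαγ
  have h1 := lintegral_kernel (α := α) hS.levy hN hMN hSN (nu β) (fun _ : Unit => 1) (fun _ => t)
  simp only [Finset.univ_unique, Finset.sum_singleton, one_mul] at h1
  rw [h1]
  set C := pathMoment α (fun _ : Unit => 1) (P.map fun ω t => S t ω) (fun _ => 1) with hC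
  have hCtop : C < ∞ := by
    rw [hC, pathMoment_eq hS.levy]
    simpa using hS.lintegral_one_lt_top hα hαγ
  have h2 : ∀ u : ℝ≥0, pathMoment α (fun _ : Unit => 1) (P.map fun ω t => S t ω) (fun _ => u)
      = ENNReal.ofReal ((u : ℝ) ^ (α / γ)) * C := fun u => by
    simpa using pathMoment_scale hS hα hγ (fun _ : Unit => 1) u (fun _ => 1)
  have hp : 0 < α / γ := div_pos hα hγ
  have h3 : ∀ᵐ z ∂(P.prod (nu β)), ENNReal.ofReal ((N z.1 (t - z.2) : ℝ) ^ (α / γ)) * C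
      ≤ (1 + (N z.1 t : ℝ≥0∞)) * (C * (Set.Iic t).indicator 1 z.2) := by
    filter_upwards [Measure.quasiMeasurePreserving_fst.ae hN.mono,
      Measure.quasiMeasurePreserving_fst.ae hN.zero] with z hz hz0
    by_cases hx : z.2 ≤ t
    · rw [Set.indicator_of_mem (Set.mem_Iic.2 hx), Pi.one_apply, mul_one]
      refine mul_le_mul_left ?_ C
      have h4 : (N z.1 (t - z.2) : ℝ) ≤ N z.1 t := by exact_mod_cast hz tsub_le_self
      have h5 : (N z.1 (t - z.2) : ℝ) ^ (α / γ) ≤ 1 + N z.1 t := by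
        have h0 := (N z.1 (t - z.2)).coe_nonneg
        calc (N z.1 (t - z.2) : ℝ) ^ (α / γ) ≤ (1 + N z.1 t) ^ (α / γ) :=
              Real.rpow_le_rpow h0 (by linarith) hp.le
          _ ≤ (1 + N z.1 t) ^ (1 : ℝ) := Real.rpow_le_rpow_of_exponent_le (by linarith)
              ((div_le_one hγ).2 hαγ.le)
          _ = _ := Real.rpow_one _
      refine (ENNReal.ofReal_le_ofReal h5).trans_eq ?_
      rw [ENNReal.ofReal_add zero_le_one (N z.1 t).coe_nonneg, ENNReal.ofReal_one,
        ENNReal.ofReal_coe_nnreal]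
    · rw [tsub_eq_zero_of_le (not_le.1 hx).le, hz0, NNReal.coe_zero, Real.zero_rpow hp.ne']
      simp
  simp only [h2]
  refine (lintegral_mono_ae h3).trans_lt ?_
  have hmN : Measurable fun ω => N ω t := hN.measurable_comp measurable_id measurable_const
  rw [lintegral_prod_mul (f := fun ω => 1 + (N ω t : ℝ≥0∞))
    (g := fun x => C * (Set.Iic t).indicator 1 x) (by fun_prop) (by
    exact ((measurable_one.indicator measurableSet_Iic).const_mul C).aemeasurable)]
  refine ENNReal.mul_lt_top ?_ ?_
  · rw [lintegral_add_left measurable_const]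
    exact ENNReal.add_lt_top.2 ⟨by simp, hN.lintegral_lt_top t⟩
  · rw [lintegral_const_mul _ (measurable_one.indicator measurableSet_Iic),
      lintegral_indicator_one measurableSet_Iic]
    exact ENNReal.mul_lt_top hCtop (nu_Iic_lt_top hβ t)

/-- Substituting `c x` for the delay gives the exponent `1 - β`; then `N(c ·)` has the law of `c^β
N`, and homogeneity of `pathMoment` turns `c^β` into `c^(β α/γ)`. -/
lemma lintegral_kernel_scale (hS : IsSymmStableLevyMotion γ S P)
    (hN : IsMittagLefflerVersion β N P) (hMN : ∀ᵐ ω ∂P, ∀ t, M t ω = N ω t)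
    (hSN : IndepFun (fun ω t => S t ω) N P) (hα : 0 < α) (hγ : 0 < γ) {c : ℝ≥0} (hc : 0 < c)
    (I : Finset ℝ≥0) (θ : I → ℝ) :
    ∫⁻ z, ‖∑ t, θ t * kernel S M (c * t) z‖ₑ ^ α ∂(P.prod (nu β))
      = ENNReal.ofReal ((c : ℝ) ^ (1 - β + β * (α / γ)))
        * ∫⁻ z, ‖∑ t, θ t * kernel S M t z‖ₑ ^ α ∂(P.prod (nu β)) := by
  have hpath : Measurable fun ω t => S t ω := measurable_pi_lambda _ hS.levy.measurable
  have := Measure.isProbabilityMeasure_map (μ := P) hpath.aemeasurable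
  have hΨ := measurable_pathMoment α θ (P.map fun ω t => S t ω)
  have hc' : (0 : ℝ) < c := by exact_mod_cast hc
  have hm : ∀ τ : I → ℝ≥0, Measurable fun z : Ω × ℝ≥0 =>
      pathMoment α θ (P.map fun ω t => S t ω) (fun t => N z.1 (τ t - z.2)) := fun τ =>
    hΨ.comp (measurable_pi_lambda _ fun t => hN.measurable_comp measurable_fst (by fun_prop))
  rw [lintegral_kernel hS.levy hN hMN hSN (nu β), lintegral_kernel hS.levy hN hMN hSN (nu β),
    lintegral_prod_symm _ (hm _).aemeasurable, lintegral_prod_symm _ (hm _).aemeasurable,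
    lintegral_nu_scale (hm _).lintegral_prod_left' hc, Real.rpow_add hc',
    ENNReal.ofReal_mul (by positivity), mul_assoc]
  congr 1
  rw [← lintegral_const_mul' _ _ ENNReal.ofReal_ne_top]
  refine lintegral_congr fun x => ?_
  simp only [← mul_tsub]
  rw [hN.scale c hc I (fun t => t - x) _ hΨ, ← lintegral_const_mul' _ _ ENNReal.ofReal_ne_top]
  refine lintegral_congr fun ω => ?_
  rw [pathMoment_scale hS hα hγ, NNReal.coe_rpow, ← Real.rpow_mul hc'.le]

lemma lintegral_kernel_shift (hS : IsLevyProcess S P) (hN : IsMittagLefflerVersion β N P)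
    (hMN : ∀ᵐ ω ∂P, ∀ t, M t ω = N ω t) (hSN : IndepFun (fun ω t => S t ω) N P) (hα : 0 < α)
    (s : ℝ≥0) (I : Finset ℝ≥0) (θ : I → ℝ) :
    ∫⁻ z, ‖∑ t : I, θ t * (kernel S M (t + s) z - kernel S M s z)‖ₑ ^ α ∂(P.prod (nu β))
      = ∫⁻ z, ‖∑ t : I, θ t * kernel S M t z‖ₑ ^ α ∂(P.prod (nu β)) := by
  have hpath : Measurable fun ω t => S t ω := measurable_pi_lambda _ hS.measurable
  have := Measure.isProbabilityMeasure_map (μ := P) hpath.aemeasurable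
  rw [lintegral_kernel_sub hS hN hMN hSN (nu β), lintegral_kernel hS hN hMN hSN (nu β)]
  exact hN.shift s I _ (measurable_pathMoment α θ _) (pathMoment_zero hS hα θ)

end Kernel

end StableProcess

/-! ### Assembly of the theorem -/

theorem mainTheorem3 {Ω' Ω : Type*} [MeasurableSpace Ω'] [MeasurableSpace Ω]
    (P' : Measure Ω') [IsProbabilityMeasure P'] (P : Measure Ω) [IsProbabilityMeasure P]
    (α β γ : ℝ) (hα : 0 < α) (hαγ : α < γ) (hγ : γ ≤ 2) (hβ0 : 0 ≤ β) (hβ1 : β ≤ 1)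
    (S : ℝ≥0 → Ω' → ℝ) (hS : StableProcess.IsSymmStableLevyMotion γ S P')
    (M : ℝ≥0 → Ω' → ℝ≥0) (hM : StableProcess.IsMittagLefflerProcess β M P')
    (hSM : IndepFun (fun ω' t => S t ω') (fun ω' t => M t ω') P')
    (Z : Set (Ω' × ℝ≥0) → Ω → ℝ)
    (hZ : StableProcess.IsSymmStableRandomMeasure α (P'.prod (StableProcess.nu β)) Z P) :
    -- the process is well defined: the integrands are in `L^α`, the integrals exist, and they
    -- are unique up to null sets
    (∀ t, MemLp (StableProcess.kernel S M t) (ENNReal.ofReal α)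
      (P'.prod (StableProcess.nu β))) ∧
    (∀ t, ∃ Y : Ω → ℝ, StableProcess.IsStableIntegral α (P'.prod (StableProcess.nu β)) Z P
      (StableProcess.kernel S M t) Y) ∧
    (∀ t, ∀ Y₁ Y₂ : Ω → ℝ,
      StableProcess.IsStableIntegral α (P'.prod (StableProcess.nu β)) Z P
        (StableProcess.kernel S M t) Y₁ →
      StableProcess.IsStableIntegral α (P'.prod (StableProcess.nu β)) Z P
        (StableProcess.kernel S M t) Y₂ →
      Y₁ =ᵐ[P] Y₂) ∧
    -- every version of it is a symmetric `α`-stable, `H`-self-similar process with stationary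
    -- increments
    ∀ Y : ℝ≥0 → Ω → ℝ,
      (∀ t, StableProcess.IsStableIntegral α (P'.prod (StableProcess.nu β)) Z P
        (StableProcess.kernel S M t) (Y t)) →
      StableProcess.IsSymmStableProcess α Y P ∧
      StableProcess.IsSelfSimilar (β / γ + (1 - β) / α) Y P ∧
      StableProcess.HasStationaryIncrements Y P := by
  have hγ0 : 0 < γ := hα.trans hαγ
  obtain ⟨N, hN, hMN⟩ := hM.exists_version hβ0 hβ1
  -- Independence transfers because `M` and `N` agree almost surely as whole paths.
  have hSN : IndepFun (fun ω' t => S t ω') N P' :=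
    hSM.congr EventuallyEq.rfl (hMN.mono fun ω h => funext h)
  have hLp : ∀ t, MemLp (StableProcess.kernel S M t) (ENNReal.ofReal α)
      (P'.prod (StableProcess.nu β)) := fun t =>
    StableProcess.memLp_of_lintegral_rpow_enorm_ne_top hα
      (StableProcess.aestronglyMeasurable_kernel hS.levy hN hMN _ t)
      (StableProcess.lintegral_kernel_lt_top hS hN hMN hSN hα hαγ hβ1 t).ne
  refine ⟨hLp, fun t => StableProcess.exists_isStableIntegral hα hZ (hLp t),
    fun t Y₁ Y₂ h₁ h₂ => h₁.ae_eq hα hZ h₂, fun Y hY => ⟨⟨fun t => (hY t).measurable, fun I =>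
      StableProcess.isSymmStableLaw_of_isStableIntegral hα hZ fun t => hY t⟩, ?_, ?_⟩⟩
  · intro c hc I
    have hc' : (0 : ℝ) < c := by exact_mod_cast hc
    refine StableProcess.identDistrib_of_isStableIntegral hα hZ (fun t : I => hY (c * t))
      (fun t : I => (hY t).const_mul hα hZ ((c : ℝ) ^ (β / γ + (1 - β) / α))) fun θ => ?_
    rw [StableProcess.lintegral_kernel_scale hS hN hMN hSN hα hγ0 hc]
    simp only [mul_left_comm _ ((c : ℝ) ^ (β / γ + (1 - β) / α)), ← Finset.mul_sum]
    rw [StableProcess.lintegral_const_mul_rpow hα,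
      abs_of_nonneg (Real.rpow_nonneg hc'.le _), ← Real.rpow_mul hc'.le]
    -- It remains to see that `1 - β + β (α/γ) = H α`.
    congr 3
    field_simp
    ring
  · intro s I
    refine StableProcess.identDistrib_of_isStableIntegral hα hZ
      (fun t : I => (hY (t + s)).sub hα hZ (hY s)) (fun t : I => (hY t).sub hα hZ (hY 0))
      fun θ => ?_
    rw [StableProcess.lintegral_kernel_shift hS.levy hN hMN hSN hα]
    refine lintegral_congr_ae ?_
    -- The kernel at time `0` vanishes almost everywhere, so subtracting `Y 0` does not change the
    -- integral.
    filter_upwards [StableProcess.ae_kernel_zero hS.levy hN hMN (StableProcess.nu β)] with z hz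
    simp only [hz, sub_zero]

end
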